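/- Let $d\in\mathbb N$, $\mathcal X=\mathbb R^d$, $\mathcal X^*\cong\mathbb R^d$, and $\Xi=\mathcal X\times\mathcal X^*$ with points $X=(x,\xi)$, $Y=(y,\eta)$, $Z=(z,\zeta)$, and $\sigma(X,Y)=\langle\xi,y\rangle-\langle\eta,x\rangle$, $\langle\xi\rangle=\sqrt{1+|\xi|^2}$. For $m\in\mathbb R$ let $S^m_1(\Xi)$ be the space of all $F\in C^\infty(\Xi;\mathbb C)$ such that for all $N,M\in\mathbb N$ $$\nu^{m-M}_{N,M}(F)=\sup_{(x,\xi)\in\Xi}\langle\xi\rangle^{-(m-M)}\sum_{|\alpha|=N}\sum_{|\beta|=M}\bigl|(\partial_x^\alpha\partial_\xi^\beta F)(x,\xi)\bigr|<\infty ,$$ with the Fréchet topology defined by these seminorms. Let $BC^\infty(\mathcal X)$ be the space of smooth real functions on $\mathcal X$ that are bounded together with all their derivatives, with the Fréchet topology defined by the seminorms $\nu_n(f)=\sup_x\sup_{|\alpha|\le n}|\partial^\alpha f(x)|$, $n\in\mathbb N$. A magnetic field is a closed $2$-form $B=\sum_{j<k}B_{jk}\,dx_j\wedge dx_k$ on $\mathcal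 X$, with $B_{kj}=-B_{jk}$, whose components $B_{jk}$ are of class $BC^\infty(\mathcal X)$. Put $$\Omega^B(x,y,z)=\exp\Bigl\{-i\int_{<x,y,z>}B\Bigr\},\qquad \omega^B(x,y,z)=\Omega^B(x-y-z,\,x+y-z,\,x-y+z),$$ where $<x,y,z>$ is the oriented triangle with vertices $x,y,z$. The magnetic Moyal product of $f$ and $g$ is $$(f\,\sharp^B g)(X)=\pi^{-2d}\int_\Xi\int_\Xi e^{-2i\sigma(Y,Z)}\,\omega^B(x,y,z)\,f(X-Y)\,g(X-Z)\,dY\,dZ$$ as an oscillatory integral: the limit as $\varepsilon\to0^+$ of the absolutely convergent integrals with the additional factor $\chi(\varepsilon Y,\varepsilon Z)$ in the integrand, which is to exist and to be the same for every Schwartz function $\chi$ on $\Xi\times\Xi$ with $\chi(0)=1$. **Proposition.** Let $m,p\in\mathbb R$. For every magnetic field $B$ with components of class $BC^\infty(\mathcal X)$, every $f\in S^m_1(\Xi)$ and $g\in S^p_1(\Xi)$, the oscillatory integral that defines $(f\,\sharp^Bg)(X)$ exists for every $X\in\Xi$, the function $f\,\sharp^B g$ belongs to $S^{m+p}_1(\Xi)$,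 and the bilinear map $$S^m_1(\Xi)\times S^p_1(\Xi)\ni(f,g)\mapsto f\,\sharp^B g\in S^{m+p}_1(\Xi)$$ is continuous for the Fréchet topologies. Moreover, for every bounded subset $\mathcal B$ of the Fréchet space $BC^\infty(\mathcal X)$, the family of these maps, where $B$ runs over all magnetic fields with $B_{jk}\in\mathcal B$ for all $j,k$, is equicontinuous. -/

import Mathlib

open MeasureTheory Filter Topology
open scoped ContDiff SchwartzMap

noncomputable section

namespace MagneticWeyl

/-- Configuration space `𝓧 = ℝ^d`.  Its dual `𝓧^*` is identified with `ℝ^d` through the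
Euclidean inner product. -/
abbrev Conf (d : ℕ) : Type := EuclideanSpace ℝ (Fin d)

/-- Phase space `Ξ = 𝓧 × 𝓧^*`, with points `X = (x, ξ)`, `x = X.1`, `ξ = X.2`. -/
abbrev Phase (d : ℕ) : Type := Conf d × Conf d

/-- The standard basis vector `e_j` of `ℝ^d`. -/
def stdVec {d : ℕ} (j : Fin d) : Conf d := EuclideanSpace.single j 1

/-- `⟨v⟩ = √(1 + |v|²)`. -/
def bracket {d : ℕ} (v : Conf d) : ℝ := Real.sqrt (1 + ‖v‖ ^ 2)

/-- The canonical symplectic form `σ((x,ξ),(y,η)) = ⟨ξ,y⟩ - ⟨η,x⟩`. -/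
def sympl {d : ℕ} (X Y : Phase d) : ℝ := inner ℝ X.2 Y.1 - inner ℝ Y.2 X.1

section Derivatives

variable {V E : Type*} [NormedAddCommGroup V] [NormedSpace ℝ V]
  [NormedAddCommGroup E] [NormedSpace ℝ E]

/-- Derivative of `F` in the direction `v`. -/
def dirDeriv (v : V) (F : V → E) : V → E := fun x => fderiv ℝ F x v

/-- The partial derivative `∂^α F = ∂_{e_0}^{α_0} ⋯ ∂_{e_{d-1}}^{α_{d-1}} F`, for a multi-index
`α`, along the directions `e_0, …, e_{d-1}`. -/
def multiDeriv {d : ℕ} (e : Fin d → V) (α : Fin d → ℕ) (F : V → E) : V → E :=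
  (List.finRange d).foldr (fun j G => (dirDeriv (e j))^[α j] G) F

theorem contDiff_dirDeriv (v : V) {F : V → E} (hF : ContDiff ℝ ∞ F) :
    ContDiff ℝ ∞ (dirDeriv v F) :=
  (hF.fderiv_right (m := ∞) (by simp)).clm_apply contDiff_const

theorem contDiff_dirDeriv_iter (v : V) (n : ℕ) {F : V → E} (hF : ContDiff ℝ ∞ F) :
    ContDiff ℝ ∞ ((dirDeriv v)^[n] F) := by
  induction n with
  | zero => exact hF
  | succ n ih => rw [Function.iterate_succ_apply']; exact contDiff_dirDeriv v ih

theorem dirDeriv_iter_add (v : V) (n : ℕ) {F G : V → E}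
    (hF : ContDiff ℝ ∞ F) (hG : ContDiff ℝ ∞ G) :
    (dirDeriv v)^[n] (F + G) = (dirDeriv v)^[n] F + (dirDeriv v)^[n] G := by
  induction n with
  | zero => rfl
  | succ n ih =>
    simp only [Function.iterate_succ_apply', ih]
    funext x
    have h1 := (contDiff_dirDeriv_iter v n hF).differentiable (by simp) x
    have h2 := (contDiff_dirDeriv_iter v n hG).differentiable (by simp) x
    simp [dirDeriv, fderiv_add h1 h2]

theorem dirDeriv_iter_smul {𝕜 : Type*} [NormedField 𝕜] [NormedSpace 𝕜 E] [SMulCommClass ℝ 𝕜 E]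
    (v : V) (n : ℕ) (c : 𝕜) {F : V → E} (hF : ContDiff ℝ ∞ F) :
    (dirDeriv v)^[n] (c • F) = c • (dirDeriv v)^[n] F := by
  induction n with
  | zero => rfl
  | succ n ih =>
    simp only [Function.iterate_succ_apply', ih]
    funext x
    have h1 := (contDiff_dirDeriv_iter v n hF).differentiable (by simp) x
    simp [dirDeriv, fderiv_const_smul h1 c]

theorem contDiff_multiDeriv {d : ℕ} (e : Fin d → V) (α : Fin d → ℕ) {F : V → E}
    (hF : ContDiff ℝ ∞ F) : ContDiff ℝ ∞ (multiDeriv e α F) := by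
  unfold multiDeriv
  induction List.finRange d with
  | nil => exact hF
  | cons j l ih => exact contDiff_dirDeriv_iter _ _ ih

theorem multiDeriv_add {d : ℕ} (e : Fin d → V) (α : Fin d → ℕ) {F G : V → E}
    (hF : ContDiff ℝ ∞ F) (hG : ContDiff ℝ ∞ G) :
    multiDeriv e α (F + G) = multiDeriv e α F + multiDeriv e α G := by
  unfold multiDeriv
  suffices h : ∀ l : List (Fin d),
      ContDiff ℝ ∞ (l.foldr (fun j G => (dirDeriv (e j))^[α j] G) F) ∧
      ContDiff ℝ ∞ (l.foldr (fun j G => (dirDeriv (e j))^[α j] G) G) ∧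
      l.foldr (fun j G => (dirDeriv (e j))^[α j] G) (F + G) =
        l.foldr (fun j G => (dirDeriv (e j))^[α j] G) F +
        l.foldr (fun j G => (dirDeriv (e j))^[α j] G) G from (h _).2.2
  intro l
  induction l with
  | nil => exact ⟨hF, hG, rfl⟩
  | cons j l ih =>
    obtain ⟨h1, h2, h3⟩ := ih
    refine ⟨contDiff_dirDeriv_iter _ _ h1, contDiff_dirDeriv_iter _ _ h2, ?_⟩
    simp only [List.foldr_cons]
    rw [h3, dirDeriv_iter_add _ _ h1 h2]

theorem multiDeriv_smul {𝕜 : Type*} [NormedField 𝕜] [NormedSpace 𝕜 E] [SMulCommClass ℝ 𝕜 E]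
    {d : ℕ} (e : Fin d → V) (α : Fin d → ℕ) (c : 𝕜) {F : V → E} (hF : ContDiff ℝ ∞ F) :
    multiDeriv e α (c • F) = c • multiDeriv e α F := by
  unfold multiDeriv
  suffices h : ∀ l : List (Fin d),
      ContDiff ℝ ∞ (l.foldr (fun j G => (dirDeriv (e j))^[α j] G) F) ∧
      l.foldr (fun j G => (dirDeriv (e j))^[α j] G) (c • F) =
        c • l.foldr (fun j G => (dirDeriv (e j))^[α j] G) F from (h _).2
  intro l
  induction l with
  | nil => exact ⟨hF, rfl⟩
  | cons j l ih =>
    obtain ⟨h1, h3⟩ := ih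
    refine ⟨contDiff_dirDeriv_iter _ _ h1, ?_⟩
    simp only [List.foldr_cons]
    rw [h3, dirDeriv_iter_smul _ _ c h1]

theorem multiDeriv_zero {d : ℕ} (e : Fin d → V) (α : Fin d → ℕ) :
    multiDeriv e α (0 : V → E) = 0 := by
  have h := multiDeriv_smul e α (0 : ℝ) (F := (0 : V → E)) contDiff_const
  simpa using h

end Derivatives

/-! ### The space `BC^∞(𝓧)` -/

/-- `∂^α f` for a real function on `𝓧`. -/
def pderiv {d : ℕ} (α : Fin d → ℕ) (f : Conf d → ℝ) : Conf d → ℝ := multiDeriv stdVec α f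

/-- Multi-indices of length at most `n`. -/
abbrev MultiLE (d n : ℕ) : Type := {α : Fin d → ℕ // ∑ j, α j ≤ n}

instance (d n : ℕ) : Finite (MultiLE d n) :=
  Set.Finite.to_subtype ((Set.finite_Iic (fun _ : Fin d => n)).subset fun α hα j =>
    (Finset.single_le_sum (fun i _ => Nat.zero_le (α i)) (Finset.mem_univ j)).trans hα)

instance (d n : ℕ) : Nonempty (MultiLE d n) := ⟨⟨0, by simp⟩⟩

/-- Smooth real functions on `𝓧` that are bounded together with all their derivatives. -/
def bcSubmodule (d : ℕ) : Submodule ℝ (Conf d → ℝ) where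
  carrier := {f | ContDiff ℝ ∞ f ∧ ∀ α : Fin d → ℕ, ∃ C : ℝ, ∀ x, |pderiv α f x| ≤ C}
  add_mem' := by
    rintro f g ⟨hf, hf'⟩ ⟨hg, hg'⟩
    refine ⟨hf.add hg, fun α => ?_⟩
    obtain ⟨C, hC⟩ := hf' α
    obtain ⟨D, hD⟩ := hg' α
    refine ⟨C + D, fun x => ?_⟩
    rw [pderiv, multiDeriv_add _ _ hf hg]
    exact (abs_add_le _ _).trans (add_le_add (hC x) (hD x))
  zero_mem' := ⟨contDiff_const, fun α => ⟨0, fun x => by rw [pderiv, multiDeriv_zero]; simp⟩⟩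
  smul_mem' := by
    rintro c f ⟨hf, hf'⟩
    refine ⟨contDiff_const.smul hf, fun α => ?_⟩
    obtain ⟨C, hC⟩ := hf' α
    refine ⟨|c| * C, fun x => ?_⟩
    rw [pderiv, multiDeriv_smul _ _ c hf, Pi.smul_apply, smul_eq_mul, abs_mul]
    exact mul_le_mul_of_nonneg_left (hC x) (abs_nonneg c)

/-- The space `BC^∞(𝓧)` of real-valued functions (with its Fréchet topology, below). -/
def BCInf (d : ℕ) : Type := bcSubmodule d

instance (d : ℕ) : AddCommGroup (BCInf d) := inferInstanceAs (AddCommGroup (bcSubmodule d))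
instance (d : ℕ) : Module ℝ (BCInf d) := inferInstanceAs (Module ℝ (bcSubmodule d))
instance (d : ℕ) : CoeFun (BCInf d) (fun _ => Conf d → ℝ) := ⟨fun f => f.1⟩

/-- `ν_n(f) = sup_x sup_{|α| ≤ n} |∂^α f(x)|`. -/
def bcNu {d : ℕ} (n : ℕ) (f : Conf d → ℝ) : ℝ :=
  ⨆ q : Conf d × MultiLE d n, |pderiv q.2.1 f q.1|

theorem bddAbove_bcNu {d : ℕ} (n : ℕ) {f : Conf d → ℝ} (hf : f ∈ bcSubmodule d) :
    BddAbove (Set.range fun q : Conf d × MultiLE d n => |pderiv q.2.1 f q.1|) := by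
  choose C hC using hf.2
  obtain ⟨D, hD⟩ := (Set.finite_range fun α : MultiLE d n => C α.1).bddAbove
  refine ⟨D, ?_⟩
  rintro _ ⟨q, rfl⟩
  exact (hC q.2.1 q.1).trans (hD ⟨q.2, rfl⟩)

/-- The seminorms `ν_n` defining the Fréchet topology of `BC^∞(𝓧)`. -/
def bcSeminorm (d : ℕ) : SeminormFamily ℝ (BCInf d) ℕ := fun n =>
  Seminorm.of (fun f => bcNu n f.1)
    (fun f g => ciSup_le fun q => by
      have h : |pderiv q.2.1 (f.1 + g.1) q.1| ≤ |pderiv q.2.1 f.1 q.1| + |pderiv q.2.1 g.1 q.1| := by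
        rw [pderiv, multiDeriv_add _ _ f.2.1 g.2.1]
        exact abs_add_le _ _
      exact h.trans (add_le_add (le_ciSup (bddAbove_bcNu n f.2) q)
        (le_ciSup (bddAbove_bcNu n g.2) q)))
    (fun c f => by
      have h : ∀ q : Conf d × MultiLE d n,
          |pderiv q.2.1 (c • f.1) q.1| = ‖c‖ * |pderiv q.2.1 f.1 q.1| := fun q => by
        rw [pderiv, multiDeriv_smul _ _ c f.2.1, Pi.smul_apply, smul_eq_mul, abs_mul]
        rfl
      change (⨆ q : Conf d × MultiLE d n, |pderiv q.2.1 (c • f.1) q.1|) = _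
      simp only [h]
      exact (Real.mul_iSup_of_nonneg (norm_nonneg c) _).symm)

instance (d : ℕ) : TopologicalSpace (BCInf d) := (bcSeminorm d).moduleFilterBasis.topology

theorem bcInf_withSeminorms (d : ℕ) : WithSeminorms (bcSeminorm d) := ⟨rfl⟩

/-! ### The symbol classes `S^m_1(Ξ)` -/

/-- `∂_x^α ∂_ξ^β F` for a complex function on phase space. -/
def phaseDeriv {d : ℕ} (α β : Fin d → ℕ) (F : Phase d → ℂ) : Phase d → ℂ :=
  multiDeriv (fun j => ((stdVec j, 0) : Phase d)) α
    (multiDeriv (fun j => ((0, stdVec j) : Phase d)) β F)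

theorem phaseDeriv_add {d : ℕ} (α β : Fin d → ℕ) {F G : Phase d → ℂ}
    (hF : ContDiff ℝ ∞ F) (hG : ContDiff ℝ ∞ G) :
    phaseDeriv α β (F + G) = phaseDeriv α β F + phaseDeriv α β G := by
  unfold phaseDeriv
  rw [multiDeriv_add _ _ hF hG,
    multiDeriv_add _ _ (contDiff_multiDeriv _ _ hF) (contDiff_multiDeriv _ _ hG)]

theorem phaseDeriv_smul {d : ℕ} (α β : Fin d → ℕ) (c : ℂ) {F : Phase d → ℂ}
    (hF : ContDiff ℝ ∞ F) : phaseDeriv α β (c • F) = c • phaseDeriv α β F := by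
  unfold phaseDeriv
  rw [multiDeriv_smul _ _ c hF, multiDeriv_smul _ _ c (contDiff_multiDeriv _ _ hF)]

/-- `⟨ξ⟩^{-m} ∑_{|α| = N} ∑_{|β| = M} |∂_x^α ∂_ξ^β F(x,ξ)|`. -/
def symbolWeight {d : ℕ} (m : ℝ) (N M : ℕ) (F : Phase d → ℂ) (X : Phase d) : ℝ :=
  bracket X.2 ^ (-m) *
    ∑ α ∈ Finset.piAntidiag Finset.univ N, ∑ β ∈ Finset.piAntidiag Finset.univ M,
      ‖phaseDeriv α β F X‖

/-- `ν^m_{N,M}(F)`, the supremum over `Ξ` of the previous quantity. -/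
def symbolNu {d : ℕ} (m : ℝ) (N M : ℕ) (F : Phase d → ℂ) : ℝ :=
  ⨆ X : Phase d, symbolWeight m N M F X

theorem symbolWeight_add {d : ℕ} (m : ℝ) (N M : ℕ) {F G : Phase d → ℂ}
    (hF : ContDiff ℝ ∞ F) (hG : ContDiff ℝ ∞ G) (X : Phase d) :
    symbolWeight m N M (F + G) X ≤ symbolWeight m N M F X + symbolWeight m N M G X := by
  unfold symbolWeight
  rw [← mul_add, ← Finset.sum_add_distrib]
  refine mul_le_mul_of_nonneg_left (Finset.sum_le_sum fun α _ => ?_)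
    (Real.rpow_nonneg (Real.sqrt_nonneg _) _)
  rw [← Finset.sum_add_distrib]
  refine Finset.sum_le_sum fun β _ => ?_
  rw [phaseDeriv_add α β hF hG]
  exact norm_add_le _ _

theorem symbolWeight_smul {d : ℕ} (m : ℝ) (N M : ℕ) (c : ℂ) {F : Phase d → ℂ}
    (hF : ContDiff ℝ ∞ F) (X : Phase d) :
    symbolWeight m N M (c • F) X = ‖c‖ * symbolWeight m N M F X := by
  unfold symbolWeight
  simp only [phaseDeriv_smul _ _ c hF, Pi.smul_apply, norm_smul, ← Finset.mul_sum]
  ring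

/-- The class `S^m_1(Ξ)`: smooth `F` with `ν^{m-M}_{N,M}(F) < ∞` for all `N, M`. -/
def symbolSubmodule (d : ℕ) (m : ℝ) : Submodule ℂ (Phase d → ℂ) where
  carrier := {F | ContDiff ℝ ∞ F ∧
    ∀ N M : ℕ, BddAbove (Set.range (symbolWeight (m - M) N M F))}
  add_mem' := by
    rintro F G ⟨hF, hF'⟩ ⟨hG, hG'⟩
    refine ⟨hF.add hG, fun N M => ?_⟩
    obtain ⟨C, hC⟩ := hF' N M
    obtain ⟨D, hD⟩ := hG' N M
    refine ⟨C + D, ?_⟩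
    rintro _ ⟨X, rfl⟩
    exact (symbolWeight_add _ N M hF hG X).trans (add_le_add (hC ⟨X, rfl⟩) (hD ⟨X, rfl⟩))
  zero_mem' := by
    refine ⟨contDiff_const, fun N M => ⟨0, ?_⟩⟩
    rintro _ ⟨X, rfl⟩
    have h := symbolWeight_smul (m - M) N M 0 (F := (0 : Phase d → ℂ)) contDiff_const X
    rw [zero_smul, norm_zero, zero_mul] at h
    exact h.le
  smul_mem' := by
    rintro c F ⟨hF, hF'⟩
    refine ⟨contDiff_const.smul hF, fun N M => ?_⟩
    obtain ⟨C, hC⟩ := hF' N M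
    refine ⟨‖c‖ * C, ?_⟩
    rintro _ ⟨X, rfl⟩
    rw [symbolWeight_smul _ N M c hF X]
    exact mul_le_mul_of_nonneg_left (hC ⟨X, rfl⟩) (norm_nonneg c)

/-- The symbol space `S^m_1(Ξ)` (with its Fréchet topology, below). -/
def Symbol (d : ℕ) (m : ℝ) : Type := symbolSubmodule d m

instance (d : ℕ) (m : ℝ) : AddCommGroup (Symbol d m) :=
  inferInstanceAs (AddCommGroup (symbolSubmodule d m))
instance (d : ℕ) (m : ℝ) : Module ℂ (Symbol d m) :=
  inferInstanceAs (Module ℂ (symbolSubmodule d m))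
instance (d : ℕ) (m : ℝ) : CoeFun (Symbol d m) (fun _ => Phase d → ℂ) := ⟨fun f => f.1⟩

/-- The seminorms `ν^{m-M}_{N,M}` of `S^m_1(Ξ)`, indexed by `(N, M)`. -/
def symbolSeminorm (d : ℕ) (m : ℝ) : SeminormFamily ℂ (Symbol d m) (ℕ × ℕ) := fun k =>
  Seminorm.of (fun F => symbolNu (m - k.2) k.1 k.2 F.1)
    (fun F G => ciSup_le fun X =>
      (symbolWeight_add _ k.1 k.2 F.2.1 G.2.1 X).trans
        (add_le_add (le_ciSup (F.2.2 k.1 k.2) X) (le_ciSup (G.2.2 k.1 k.2) X)))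
    (fun c F => by
      change (⨆ X : Phase d, symbolWeight (m - k.2) k.1 k.2 (c • F.1) X) = _
      simp only [symbolWeight_smul _ k.1 k.2 c F.2.1]
      exact (Real.mul_iSup_of_nonneg (norm_nonneg c) _).symm)

instance (d : ℕ) (m : ℝ) : UniformSpace (Symbol d m) :=
  (symbolSeminorm d m).addGroupFilterBasis.uniformSpace

instance (d : ℕ) (m : ℝ) : IsUniformAddGroup (Symbol d m) :=
  (symbolSeminorm d m).addGroupFilterBasis.isUniformAddGroup

/-- The topology of `S^m_1(Ξ)` is the one generated by its seminorms. -/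
theorem symbol_withSeminorms (d : ℕ) (m : ℝ) : WithSeminorms (symbolSeminorm d m) := ⟨rfl⟩

/-! ### Magnetic fields -/

/-- A magnetic field: a closed `2`-form on `𝓧` with components `B_{jk} = B(e_j, e_k)` (that is,
`B = ∑_{j<k} B_{jk} dx_j ∧ dx_k`) of class `BC^∞`. -/
structure MagneticField (d : ℕ) where
  form : Conf d → Conf d [⋀^Fin 2]→L[ℝ] ℝ
  mem_bc : ∀ j k : Fin d, (fun x => form x ![stdVec j, stdVec k]) ∈ bcSubmodule d
  closed : ∀ x, extDeriv form x = 0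

/-- The component `B_{jk}` as an element of `BC^∞(𝓧)`. -/
def MagneticField.comp {d : ℕ} (B : MagneticField d) (j k : Fin d) : BCInf d :=
  ⟨fun x => B.form x ![stdVec j, stdVec k], B.mem_bc j k⟩

/-- The flux `∫_{<x,y,z>} B` through the oriented triangle with vertices `x, y, z`, parametrized
by `(s,t) ↦ x + s (y - x) + t (z - y)`, `0 ≤ t ≤ s ≤ 1`. -/
def MagneticField.flux {d : ℕ} (B : MagneticField d) (x y z : Conf d) : ℝ :=
  ∫ s in (0 : ℝ)..1, ∫ t in (0 : ℝ)..s, B.form (x + s • (y - x) + t • (z - y)) ![y - x, z - y]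

/-- `Ω^B(x,y,z) = exp(-i ∫_{<x,y,z>} B)`. -/
def MagneticField.Omega {d : ℕ} (B : MagneticField d) (x y z : Conf d) : ℂ :=
  Complex.exp (-Complex.I * (B.flux x y z : ℂ))

/-- `ω^B(x,y,z) = Ω^B(x-y-z, x+y-z, x-y+z)`. -/
def MagneticField.omega {d : ℕ} (B : MagneticField d) (x y z : Conf d) : ℂ :=
  B.Omega (x - y - z) (x + y - z) (x - y + z)

/-! ### Oscillatory integrals and the magnetic Moyal product -/

section Osc

variable {V : Type*} [NormedAddCommGroup V] [NormedSpace ℝ V] [MeasureSpace V]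

/-- The oscillatory integral `∫ e^{iφ(v)} a(v) dv` exists with value `I`: for every Schwartz
function `χ` with `χ(0) = 1` the regularized integrals `∫ χ(εv) e^{iφ(v)} a(v) dv`, `ε > 0`,
converge absolutely, and they tend to `I` as `ε → 0`. -/
def HasOscIntegral (φ : V → ℝ) (a : V → ℂ) (I : ℂ) : Prop :=
  ∀ χ : 𝓢(V, ℂ), χ 0 = 1 →
    (∀ ε : ℝ, 0 < ε →
      Integrable (fun v => χ (ε • v) * Complex.exp (Complex.I * (φ v : ℂ)) * a v)) ∧
    Tendsto (fun ε : ℝ => ∫ v, χ (ε • v) * Complex.exp (Complex.I * (φ v : ℂ)) * a v)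
      (𝓝[>] 0) (𝓝 I)

open Classical in
/-- The value of the oscillatory integral (with the value `0` if it does not exist). -/
def oscIntegral (φ : V → ℝ) (a : V → ℂ) : ℂ :=
  if h : ∃ I, HasOscIntegral φ a I then h.choose else 0

end Osc

/-- The phase `-2σ(Y,Z)` on `Ξ × Ξ`. -/
def moyalPhase {d : ℕ} (Q : Phase d × Phase d) : ℝ := -2 * sympl Q.1 Q.2

/-- The amplitude `(Y,Z) ↦ ω^B(x,y,z) f(X-Y) g(X-Z)` at the point `X = (x,ξ)`. -/
def moyalAmplitude {d : ℕ} (B : MagneticField d) (f g : Phase d → ℂ) (X : Phase d)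
    (Q : Phase d × Phase d) : ℂ :=
  B.omega X.1 Q.1.1 Q.2.1 * f (X - Q.1) * g (X - Q.2)

/-- The magnetic Moyal product
`(f ♯^B g)(X) = π^{-2d} ∫∫ e^{-2iσ(Y,Z)} ω^B(x,y,z) f(X-Y) g(X-Z) dY dZ`,
as an oscillatory integral. -/
def moyal {d : ℕ} (B : MagneticField d) (f g : Phase d → ℂ) : Phase d → ℂ := fun X =>
  ((Real.pi : ℂ) ^ (2 * d))⁻¹ * oscIntegral moyalPhase (moyalAmplitude B f g X)

end MagneticWeyl

end

noncomputable section

namespace MagneticWeyl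

open Asymptotics

/-! ### Calculus of directional derivatives. -/

section DirDeriv

variable {U V E E' : Type*} [NormedAddCommGroup U] [NormedSpace ℝ U] [NormedAddCommGroup V]
  [NormedSpace ℝ V] [NormedAddCommGroup E] [NormedSpace ℝ E] [NormedAddCommGroup E']
  [NormedSpace ℝ E']

/-! The integrand `ω^B(x,y,z) f(X-Y) g(X-Z)` is studied as one function of `(X,Y,Z)`, with a weight
and with a price for each derivative (`HasBounds`). The logarithm of `ω^B` is `-i` times a sum of
products of a coordinate of `2y`, a coordinate of `2z-2y` and a mean of a component of `B` over the
triangle. Its derivatives in `x, y, z` are therefore `O(⟨y⟩²⟨z⟩²)`, and `ω^B` has modulus one, so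
each such derivative costs at most `⟨y⟩²⟨z⟩²` (`hasBounds_omega`). Derivatives in `η, ζ` cost
nothing. A derivative in `ξ` gains `⟨ξ⟩⁻¹` at the price `⟨η⟩⟨ζ⟩`, because `⟨ξ-η⟩⁻¹ ≤ 2⟨ξ⟩⁻¹⟨η⟩`. By
Peetre's inequality the amplitude is `O(⟨ξ⟩^(m+p) ⟨η⟩^|m| ⟨ζ⟩^|p|)` (`hasBounds_moyalAmplitude`).

The phase `-2σ(Y,Z)` pairs `y` with `ζ` and `z` with `η`. Integration by parts in `y` and `z`
produces decay in `ζ` and `η` at the price of powers of `⟨y⟩⟨z⟩`; integration by parts in `η` and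
`ζ` then produces decay in `z` and `y` for free. In this order, finitely many steps make any
amplitude absolutely integrable, whatever its growth (`ampConverges`). What is carried through the
steps is quantitative: the regularized integrals are `χ(0) I + O(ε⟨ξ⟩^μ)` with `I = O(⟨ξ⟩^μ)`,
uniformly in the family (`OscConv`).

Convergence with a locally uniform rate allows differentiation in `X` under the oscillatory integral
(`hasFDerivAt_ampOsc`). An `x`-derivative of the amplitude keeps the order `μ` and a `ξ`-derivative
lowers it by one; the other exponents change, but they are arbitrary anyway. So the integral is a
symbol of order `μ` (`HasBounds.ampOsc`).

All bounds are stated for families, so bounded families of fields and symbols have bounded families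
of products. Since the topologies are given by countably many seminorms, a rescaling argument along
sequences converts this into equicontinuity (`equicontinuous_of_symbolBounded`), and continuity is
the case of a single field. -/

theorem dirDeriv_const (v : U) (c : E) : dirDeriv v (fun _ => c) = fun _ => 0 := by
  funext x; simp [dirDeriv]

theorem dirDeriv_add (v : U) {F G : U → E} (hF : ContDiff ℝ ∞ F) (hG : ContDiff ℝ ∞ G) :
    dirDeriv v (fun x => F x + G x) = fun x => dirDeriv v F x + dirDeriv v G x := by
  funext x
  have h1 := hF.differentiable (by simp) x
  have h2 := hG.differentiable (by simp) x
  simp only [dirDeriv]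
  rw [fderiv_fun_add h1 h2]
  rfl

theorem dirDeriv_mul (v : U) {F G : U → ℂ} (hF : ContDiff ℝ ∞ F) (hG : ContDiff ℝ ∞ G) :
    dirDeriv v (fun x => F x * G x) = fun x => dirDeriv v F x * G x + F x * dirDeriv v G x := by
  funext x
  have h1 := hF.differentiable (by simp) x
  have h2 := hG.differentiable (by simp) x
  simp only [dirDeriv]
  rw [fderiv_fun_mul h1 h2]
  simp
  ring

theorem dirDeriv_clm (v : U) (L : E →L[ℝ] E') {F : U → E} (hF : ContDiff ℝ ∞ F) :
    dirDeriv v (fun x => L (F x)) = fun x => L (dirDeriv v F x) := by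
  funext x
  have h1 := hF.differentiable (by simp) x
  have := (L.hasFDerivAt.comp x h1.hasFDerivAt).fderiv
  simp only [dirDeriv]
  change fderiv ℝ (⇑L ∘ F) x v = _
  rw [this]
  rfl

theorem dirDeriv_comp_clm (v : U) (T : U →L[ℝ] V) {F : V → E} (hF : ContDiff ℝ ∞ F) :
    dirDeriv v (fun x => F (T x)) = fun x => dirDeriv (T v) F (T x) := by
  funext x
  have h1 := hF.differentiable (by simp) (T x)
  have := (h1.hasFDerivAt.comp x T.hasFDerivAt).fderiv
  simp only [dirDeriv]
  change fderiv ℝ (F ∘ ⇑T) x v = _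
  rw [this]
  rfl

theorem dirDeriv_smul_dir (c : ℝ) (v : U) (F : U → E) :
    dirDeriv (c • v) F = fun x => c • dirDeriv v F x := by
  funext x; simp [dirDeriv]

theorem dirDeriv_linear (v : U) (L : U →L[ℝ] E) : dirDeriv v (fun x => L x) = fun _ => L v := by
  funext x; simp [dirDeriv]

/-- The derivative is written as a product of controlled factors so that the product estimate
applies to it as it stands in `HasBounds.inv`. -/
theorem dirDeriv_inv (v : U) {F : U → ℂ} (hF : ContDiff ℝ ∞ F) (h0 : ∀ x, F x ≠ 0) :
    dirDeriv v (fun x => (F x)⁻¹) = fun x => -1 * dirDeriv v F x * ((F x)⁻¹ * (F x)⁻¹) := by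
  funext x
  have h1 := hF.differentiable (by simp) x
  have h2 := (hasFDerivAt_inv' (𝕜 := ℝ) (h0 x)).comp x h1.hasFDerivAt
  simp only [dirDeriv]
  change fderiv ℝ (Inv.inv ∘ F) x v = _
  rw [h2.fderiv]
  simp
  ring

theorem dirDeriv_cexp (v : U) {F : U → ℂ} (hF : ContDiff ℝ ∞ F) :
    dirDeriv v (fun x => Complex.exp (F x)) = fun x => dirDeriv v F x * Complex.exp (F x) := by
  funext x
  have h1 := hF.differentiable (by simp) x
  simp only [dirDeriv]
  rw [h1.hasFDerivAt.cexp.fderiv]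
  simp [mul_comm]

theorem dirDeriv_comm (u v : U) {F : U → E} (hF : ContDiff ℝ ∞ F) :
    dirDeriv u (dirDeriv v F) = dirDeriv v (dirDeriv u F) := by
  have key : ∀ a b : U, ∀ x, dirDeriv a (dirDeriv b F) x = fderiv ℝ (fderiv ℝ F) x a b := by
    intro a b x
    have hd : DifferentiableAt ℝ (fderiv ℝ F) x :=
      (hF.fderiv_right (m := ∞) (by simp)).differentiable (by simp) x
    have := (hd.hasFDerivAt.clm_apply (hasFDerivAt_const b x)).fderiv
    change fderiv ℝ (fun y => fderiv ℝ F y b) x a = _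
    rw [this]
    simp
  funext x
  rw [key, key]
  refine (hF.contDiffAt (x := x)).isSymmSndFDerivAt ?_ u v
  rw [minSmoothness_of_isRCLikeNormedField]
  exact WithTop.coe_le_coe.2 (le_top : (2 : ℕ∞) ≤ ⊤)

end DirDeriv

/-! ### Uniform derivative bounds for families of functions. -/

section Bounds

variable {ι U V E E' J : Type*} [NormedAddCommGroup U] [NormedSpace ℝ U]
  [NormedAddCommGroup V] [NormedSpace ℝ V]
  [NormedAddCommGroup E] [NormedSpace ℝ E] [NormedAddCommGroup E'] [NormedSpace ℝ E']

/-- Uniform bounds for a family `a` of functions and its derivatives of order at most `n` along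
the directions `e j`: the functions are `O(w)`, and each derivative along `e j` costs a
factor `κ j`. -/
def BoundsUpTo (e : J → U) (κ : J → U → ℝ) : ℕ → (U → ℝ) → (ι → U → E) → Prop
  | 0, w, a => (fun q : ι × U => a q.1 q.2) =O[⊤] fun q => w q.2
  | n + 1, w, a => ((fun q : ι × U => a q.1 q.2) =O[⊤] fun q => w q.2) ∧
      ∀ j, BoundsUpTo e κ n (fun u => κ j u * w u) (fun i => dirDeriv (e j) (a i))

/-- A family of smooth functions all whose derivatives are bounded in terms of the weight `w` and
of the costs `κ`. -/
structure HasBounds (e : J → U) (κ : J → U → ℝ) (w : U → ℝ) (a : ι → U → E) : Prop where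
  smooth : ∀ i, ContDiff ℝ ∞ (a i)
  upTo : ∀ n, BoundsUpTo e κ n w a

variable {e : J → U} {κ κ' : J → U → ℝ} {w w' : U → ℝ} {n : ℕ}

/-- In the product rule one factor is differentiated and the other is not; the latter has to give up
one order to match. -/
theorem BoundsUpTo.pred {a : ι → U → E} (h : BoundsUpTo e κ (n + 1) w a) :
    BoundsUpTo e κ n w a := by
  induction n generalizing w a with
  | zero => exact h.1
  | succ n ih => exact ⟨h.1, fun j => ih (h.2 j)⟩

theorem BoundsUpTo.mono {a : ι → U → E} (h : BoundsUpTo e κ n w a)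
    (hκ : ∀ j, κ j =O[⊤] κ' j) (hw : w =O[⊤] w') : BoundsUpTo e κ' n w' a := by
  have hw2 : (fun q : ι × U => w q.2) =O[⊤] fun q => w' q.2 := hw.comp_tendsto le_top
  induction n generalizing w w' a with
  | zero => exact IsBigO.trans h hw2
  | succ n ih =>
    exact ⟨h.1.trans hw2, fun j => ih (h.2 j) ((hκ j).mul hw)
      (((hκ j).mul hw).comp_tendsto le_top)⟩

theorem BoundsUpTo.zero : BoundsUpTo e κ n w (fun (_ : ι) (_ : U) => (0 : E)) := by
  induction n generalizing w with
  | zero => exact isBigO_zero _ _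
  | succ n ih =>
    refine ⟨isBigO_zero _ _, fun j => ?_⟩
    simp only [dirDeriv_const]
    exact ih

theorem BoundsUpTo.add {a b : ι → U → E} (ha : BoundsUpTo e κ n w a)
    (hb : BoundsUpTo e κ n w b) (sa : ∀ i, ContDiff ℝ ∞ (a i)) (sb : ∀ i, ContDiff ℝ ∞ (b i)) :
    BoundsUpTo e κ n w (fun i u => a i u + b i u) := by
  induction n generalizing w a b with
  | zero => exact IsBigO.add ha hb
  | succ n ih =>
    refine ⟨ha.1.add hb.1, fun j => ?_⟩
    simp only [dirDeriv_add _ (sa _) (sb _)]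
    exact ih (ha.2 j) (hb.2 j) (fun i => contDiff_dirDeriv _ (sa i))
      (fun i => contDiff_dirDeriv _ (sb i))

/-- Leibniz rule: it does not matter which factor is differentiated, since both terms have the
weight `κ j * (w * w')`. -/
theorem BoundsUpTo.mul {a b : ι → U → ℂ} (ha : BoundsUpTo e κ n w a)
    (hb : BoundsUpTo e κ n w' b) (sa : ∀ i, ContDiff ℝ ∞ (a i)) (sb : ∀ i, ContDiff ℝ ∞ (b i)) :
    BoundsUpTo e κ n (fun u => w u * w' u) (fun i u => a i u * b i u) := by
  induction n generalizing w w' a b with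
  | zero => exact IsBigO.mul ha hb
  | succ n ih =>
    refine ⟨ha.1.mul hb.1, fun j => ?_⟩
    simp only [dirDeriv_mul _ (sa _) (sb _)]
    have h1 := ih (ha.2 j) hb.pred (fun i => contDiff_dirDeriv _ (sa i)) sb
    have h2 := ih ha.pred (hb.2 j) sa (fun i => contDiff_dirDeriv _ (sb i))
    have e1 : (fun u => κ j u * w u * w' u) = fun u => κ j u * (w u * w' u) := by
      funext u; ring
    have e2 : (fun u => w u * (κ j u * w' u)) = fun u => κ j u * (w u * w' u) := by
      funext u; ring
    rw [e1] at h1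
    rw [e2] at h2
    exact h1.add h2 (fun i => (contDiff_dirDeriv _ (sa i)).mul (sb i))
      (fun i => (sa i).mul (contDiff_dirDeriv _ (sb i)))

theorem BoundsUpTo.clm {a : ι → U → E} (ha : BoundsUpTo e κ n w a)
    (sa : ∀ i, ContDiff ℝ ∞ (a i)) (L : E →L[ℝ] E') :
    BoundsUpTo e κ n w (fun i u => L (a i u)) := by
  induction n generalizing w a with
  | zero => exact (L.isBigO_comp _ _).trans ha
  | succ n ih =>
    refine ⟨(L.isBigO_comp _ _).trans ha.1, fun j => ?_⟩
    simp only [dirDeriv_clm _ L (sa _)]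
    exact ih (ha.2 j) (fun i => contDiff_dirDeriv _ (sa i))

theorem BoundsUpTo.const_smul {a : ι → U → E} (ha : BoundsUpTo e κ n w a)
    (sa : ∀ i, ContDiff ℝ ∞ (a i)) (c : ℝ) :
    BoundsUpTo e κ n (fun u => c * w u) (fun i u => c • a i u) := by
  induction n generalizing w a with
  | zero => exact (isBigO_refl (fun _ => c) ⊤).smul ha
  | succ n ih =>
    refine ⟨(isBigO_refl (fun _ => c) ⊤).smul ha.1, fun j => ?_⟩
    have h1 := ih (ha.2 j) (fun i => contDiff_dirDeriv _ (sa i))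
    have h2 : ∀ i, dirDeriv (e j) (fun u => c • a i u) = fun u => c • dirDeriv (e j) (a i) u :=
      fun i => dirDeriv_clm (e j) (c • ContinuousLinearMap.id ℝ E) (sa i)
    simp only [h2]
    convert h1 using 2 with u
    ring

namespace HasBounds

theorem isBigO {a : ι → U → E} (h : HasBounds e κ w a) :
    (fun q : ι × U => a q.1 q.2) =O[⊤] fun q => w q.2 := h.upTo 0

theorem dirDeriv {a : ι → U → E} (h : HasBounds e κ w a) (j : J) :
    HasBounds e κ (fun u => κ j u * w u) (fun i => dirDeriv (e j) (a i)) :=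
  ⟨fun i => contDiff_dirDeriv _ (h.smooth i), fun n => (h.upTo (n + 1)).2 j⟩

theorem mono {a : ι → U → E} (h : HasBounds e κ w a) (hw : w =O[⊤] w') : HasBounds e κ w' a :=
  ⟨h.smooth, fun n => (h.upTo n).mono (fun _ => isBigO_refl _ _) hw⟩

theorem mono_cost {a : ι → U → E} (h : HasBounds e κ w a) (hκ : ∀ j, κ j =O[⊤] κ' j) :
    HasBounds e κ' w a :=
  ⟨h.smooth, fun n => (h.upTo n).mono hκ (isBigO_refl _ _)⟩

theorem reindex {ι' : Type*} {a : ι → U → E} (h : HasBounds e κ w a) (f : ι' → ι) :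
    HasBounds e κ w (fun i => a (f i)) := by
  refine ⟨fun i => h.smooth _, fun n => ?_⟩
  have := h.upTo n
  clear h
  induction n generalizing w a with
  | zero => exact IsBigO.comp_tendsto (k := fun q : ι' × U => (f q.1, q.2)) this le_top
  | succ n ih =>
    exact ⟨IsBigO.comp_tendsto (k := fun q : ι' × U => (f q.1, q.2)) this.1 le_top,
      fun j => ih (this.2 j)⟩

theorem zero : HasBounds e κ w (fun (_ : ι) (_ : U) => (0 : E)) :=
  ⟨fun _ => contDiff_const, fun _ => BoundsUpTo.zero⟩

theorem const (c : E) (h : (fun _ : U => c) =O[⊤] w) :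
    HasBounds e κ w (fun (_ : ι) (_ : U) => c) := by
  have hc : (fun _ : ι × U => c) =O[⊤] fun q : ι × U => w q.2 :=
    h.comp_tendsto (k := Prod.snd) le_top
  refine ⟨fun _ => contDiff_const, fun n => ?_⟩
  cases n with
  | zero => exact hc
  | succ n =>
    refine ⟨hc, fun j => ?_⟩
    simp only [dirDeriv_const]
    exact BoundsUpTo.zero

theorem add {a b : ι → U → E} (ha : HasBounds e κ w a) (hb : HasBounds e κ w b) :
    HasBounds e κ w (fun i u => a i u + b i u) :=
  ⟨fun i => (ha.smooth i).add (hb.smooth i),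
    fun n => (ha.upTo n).add (hb.upTo n) ha.smooth hb.smooth⟩

theorem sum {S : Type*} (s : Finset S) {a : S → ι → U → E} (ha : ∀ k, HasBounds e κ w (a k)) :
    HasBounds e κ w (fun i u => ∑ k ∈ s, a k i u) := by
  classical
  induction s using Finset.induction_on with
  | empty => simpa using zero
  | insert k s hk ih =>
    simp only [Finset.sum_insert hk]
    exact (ha k).add ih

theorem mul {a b : ι → U → ℂ} (ha : HasBounds e κ w a) (hb : HasBounds e κ w' b) :
    HasBounds e κ (fun u => w u * w' u) (fun i u => a i u * b i u) :=
  ⟨fun i => (ha.smooth i).mul (hb.smooth i),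
    fun n => (ha.upTo n).mul (hb.upTo n) ha.smooth hb.smooth⟩

theorem clm {a : ι → U → E} (ha : HasBounds e κ w a) (L : E →L[ℝ] E') :
    HasBounds e κ w (fun i u => L (a i u)) :=
  ⟨fun i => L.contDiff.comp (ha.smooth i), fun n => (ha.upTo n).clm ha.smooth L⟩

theorem const_mul {a : ι → U → ℂ} (ha : HasBounds e κ w a) (c : ℂ) :
    HasBounds e κ w (fun i u => c * a i u) :=
  ha.clm (ContinuousLinearMap.mul ℝ ℂ c)

theorem linear (L : U →L[ℝ] E) (h : (fun u => L u) =O[⊤] w)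
    (hj : ∀ j, (fun _ : U => L (e j)) =O[⊤] fun u => κ j u * w u) :
    HasBounds e κ w (fun (_ : ι) u => L u) := by
  have hL : (fun q : ι × U => L q.2) =O[⊤] fun q : ι × U => w q.2 :=
    h.comp_tendsto (k := Prod.snd) le_top
  refine ⟨fun _ => L.contDiff, fun n => ?_⟩
  cases n with
  | zero => exact hL
  | succ n =>
    refine ⟨hL, fun j => ?_⟩
    simp only [dirDeriv_linear]
    exact (const (ι := ι) (e := e) (κ := κ) _ (hj j)).upTo n

/-- Since `(1/a)' = -a' · (1/a) · (1/a)`, bounds of order `n` for `1/a` yield those of order `n +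
1`. Only the lower bound on `|a|`, that is `hinv`, is needed as new information. -/
theorem inv {a : ι → U → ℂ} (ha : HasBounds e κ w a) (hw : ∀ u, w u ≠ 0) (h0 : ∀ i u, a i u ≠ 0)
    (hinv : (fun q : ι × U => (a q.1 q.2)⁻¹) =O[⊤] fun q => (w q.2)⁻¹) :
    HasBounds e κ (fun u => (w u)⁻¹) (fun i u => (a i u)⁻¹) := by
  have hs : ∀ i, ContDiff ℝ ∞ fun u => (a i u)⁻¹ := fun i => (ha.smooth i).inv (h0 i)
  refine ⟨hs, fun n => ?_⟩
  induction n with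
  | zero => exact hinv
  | succ n ih =>
    refine ⟨hinv, fun j => ?_⟩
    simp only [dirDeriv_inv _ (ha.smooth _) (h0 _)]
    have h1 := (((ha.dirDeriv j).const_mul (-1)).upTo n).mul (ih.mul ih hs hs)
      ((ha.dirDeriv j).const_mul (-1)).smooth (fun i => (hs i).mul (hs i))
    convert h1 using 2 with u
    have := hw u
    field_simp

/-- The exponent itself may be unbounded. Being imaginary it gives modulus one, and each derivative
reproduces the exponential times a derivative of the exponent, which has the weight `κ j`. -/
theorem cexp {a : ι → U → ℂ} (hs : ∀ i, ContDiff ℝ ∞ (a i))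
    (ha : ∀ j, HasBounds e κ (κ j) (fun i => MagneticWeyl.dirDeriv (e j) (a i)))
    (hre : ∀ i u, (a i u).re = 0) :
    HasBounds e κ (fun _ => 1) (fun i u => Complex.exp (a i u)) := by
  have hs' : ∀ i, ContDiff ℝ ∞ fun u => Complex.exp (a i u) := fun i => (hs i).cexp
  have hb : (fun q : ι × U => Complex.exp (a q.1 q.2)) =O[⊤] fun _ => (1 : ℝ) :=
    IsBigO.of_bound 1 (Eventually.of_forall fun q => by simp [Complex.norm_exp, hre])
  refine ⟨hs', fun n => ?_⟩
  induction n with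
  | zero => exact hb
  | succ n ih =>
    refine ⟨hb, fun j => ?_⟩
    simp only [dirDeriv_cexp _ (hs _)]
    exact ((ha j).upTo n).mul ih (ha j).smooth hs'

/-- As `T` sends each direction to a multiple of a single direction, the chain rule produces one
term and no sum; the multiple `c` may be `0`. -/
theorem comp_clm {J' : Type*} {e' : J' → V} {κ₁ : J' → V → ℝ} {w₁ : V → ℝ} {a : ι → V → E}
    (ha : HasBounds e' κ₁ w₁ a) (T : U →L[ℝ] V)
    (hT : ∀ j, ∃ k, ∃ c : ℝ, T (e j) = c • e' k ∧ (fun u => c * κ₁ k (T u)) =O[⊤] κ j) :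
    HasBounds e κ (fun u => w₁ (T u)) (fun i u => a i (T u)) := by
  refine ⟨fun i => (ha.smooth i).comp T.contDiff, fun n => ?_⟩
  have hc : ∀ {w₁ : V → ℝ} {a : ι → V → E}, HasBounds e' κ₁ w₁ a →
      (fun q : ι × U => a q.1 (T q.2)) =O[⊤] fun q : ι × U => w₁ (T q.2) := fun h =>
    h.isBigO.comp_tendsto (k := fun q : ι × U => (q.1, T q.2)) le_top
  induction n generalizing w₁ a with
  | zero => exact hc ha
  | succ n ih =>
    refine ⟨hc ha, fun j => ?_⟩
    obtain ⟨k, c, h1, h2⟩ := hT j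
    simp only [dirDeriv_comp_clm _ T (ha.smooth _), h1, dirDeriv_smul_dir]
    have hd := ha.dirDeriv k
    have h3 := ih hd
    have h4 := h3.const_smul (fun i => (hd.smooth i).comp T.contDiff) c
    refine h4.mono (fun _ => isBigO_refl _ _) ?_
    have := h2.mul (isBigO_refl (fun u => w₁ (T u)) ⊤)
    simpa only [mul_assoc] using this

end HasBounds

/-! ### Smoothness from directional derivatives along a frame. -/

section Frame

variable [Fintype J] (coord : J → U →L[ℝ] ℝ)

theorem fderiv_eq_sum_dirDeriv (hcoord : ∀ u, ∑ j, coord j u • e j = u) (F : U → E) (u : U) :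
    fderiv ℝ F u = ∑ j, (coord j).smulRight (dirDeriv (e j) F u) := by
  ext v
  conv_lhs => rw [← hcoord v]
  simp [dirDeriv]

/-- The full derivative is a finite combination of directional ones, so a class of differentiable
functions that is stable under these is smooth by induction. This gives smoothness of integrals
without any formula for their higher derivatives. -/
theorem contDiff_of_dirDeriv_mem (hcoord : ∀ u, ∑ j, coord j u • e j = u) (S : Set (U → E))
    (hd : ∀ F ∈ S, Differentiable ℝ F) (hS : ∀ F ∈ S, ∀ j, dirDeriv (e j) F ∈ S) :
    ∀ F ∈ S, ContDiff ℝ ∞ F := by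
  have key : ∀ n : ℕ, ∀ F ∈ S, ContDiff ℝ n F := by
    intro n
    induction n with
    | zero => exact fun F hF => contDiff_zero.2 (hd F hF).continuous
    | succ n ih =>
      intro F hF
      refine (contDiff_succ_iff_fderiv (n := n)).2
        ⟨hd F hF, fun h => absurd h (WithTop.coe_ne_top (a := (n : ℕ∞))), ?_⟩
      have : fderiv ℝ F = fun u => ∑ j, (coord j).smulRight (dirDeriv (e j) F u) :=
        funext fun u => fderiv_eq_sum_dirDeriv coord hcoord F u
      rw [this]
      exact ContDiff.sum fun j _ =>
        ((ContinuousLinearMap.smulRightL ℝ U E (coord j)).contDiff).comp (ih _ (hS F hF j))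
  exact fun F hF => contDiff_infty.2 fun n => key n F hF

theorem norm_fderiv_le_sum (hcoord : ∀ u, ∑ j, coord j u • e j = u) (F : U → E) (u : U) :
    ‖fderiv ℝ F u‖ ≤ ∑ j, ‖coord j‖ * ‖dirDeriv (e j) F u‖ := by
  rw [fderiv_eq_sum_dirDeriv coord hcoord]
  refine (norm_sum_le _ _).trans (Finset.sum_le_sum fun j _ => ?_)
  rw [ContinuousLinearMap.norm_smulRight_apply]

end Frame

/-! ### Integrals over a compact parameter space. -/

section ParamIntegral

variable {T J' : Type*} [TopologicalSpace T] [CompactSpace T] [SecondCountableTopology T]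
  [MeasurableSpace T] [BorelSpace T] {ν : Measure T} [IsFiniteMeasure ν]
  {L : T → U →L[ℝ] V} {e' : J' → V} {k : J → J'} {c : J → T → ℝ}

theorem integrable_of_continuous_compact {F : Type*} [NormedAddCommGroup F] {f : T → F}
    (hf : Continuous f) : Integrable f ν := by
  obtain ⟨C, hC⟩ := isCompact_univ.exists_bound_of_continuousOn hf.continuousOn
  exact Integrable.of_bound hf.aestronglyMeasurable C
    (Eventually.of_forall fun t => hC t (Set.mem_univ t))

/-- Domination is automatic: finitely many bounded directional derivatives bound `fderiv ℝ a`, and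
continuous functions on the compact space `T` are integrable for a finite measure. -/
theorem hasFDerivAt_paramIntegral [Fintype J'] {coord' : J' → V →L[ℝ] ℝ}
    (hcoord' : ∀ u, ∑ j, coord' j u • e' j = u) (hL : Continuous L) {a : V → ℂ}
    (ha : HasBounds e' (fun _ _ => 1) (fun _ => 1) (fun _ : Unit => a)) {ρ : T → ℝ}
    (hρ : Continuous ρ) (u : U) :
    HasFDerivAt (fun u => ∫ t, ρ t • a (L t u) ∂ν)
      (∫ t, ρ t • (fderiv ℝ a (L t u)).comp (L t) ∂ν) u := by
  have hs : ContDiff ℝ ∞ a := ha.smooth ()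
  have hca : Continuous a := hs.continuous
  have hcd : Continuous (fderiv ℝ a) := hs.continuous_fderiv (by simp)
  have hLu : ∀ u, Continuous fun t => L t u := fun u => hL.clm_apply continuous_const
  obtain ⟨C, hC⟩ : ∃ C, ∀ x, ‖fderiv ℝ a x‖ ≤ C := by
    have h1 : ∀ j, ∃ D : ℝ, ∀ x, ‖dirDeriv (e' j) a x‖ ≤ D := fun j => by
      obtain ⟨D, hD⟩ := (ha.dirDeriv j).isBigO.bound
      exact ⟨D, fun x => by simpa using (eventually_top.1 hD) ((), x)⟩
    choose D hD using h1
    exact ⟨∑ j, ‖coord' j‖ * D j, fun x => (norm_fderiv_le_sum coord' hcoord' a x).trans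
      (Finset.sum_le_sum fun j _ => mul_le_mul_of_nonneg_left (hD j x) (norm_nonneg _))⟩
  refine hasFDerivAt_integral_of_dominated_of_fderiv_le (s := Set.univ)
    (bound := fun t => ‖ρ t‖ * (C * ‖L t‖))
    (F' := fun u t => ρ t • (fderiv ℝ a (L t u)).comp (L t)) univ_mem ?_ ?_ ?_ ?_ ?_ ?_
  · exact Eventually.of_forall fun u =>
      (hρ.smul (hca.comp (hLu u))).aestronglyMeasurable
  · exact integrable_of_continuous_compact (hρ.smul (hca.comp (hLu u)))
  · exact (hρ.smul ((hcd.comp (hLu u)).clm_comp hL)).aestronglyMeasurable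
  · refine Eventually.of_forall fun t u _ => ?_
    rw [norm_smul]
    refine mul_le_mul_of_nonneg_left ?_ (norm_nonneg _)
    exact (ContinuousLinearMap.opNorm_comp_le _ _).trans
      (mul_le_mul_of_nonneg_right (hC _) (norm_nonneg _))
  · exact integrable_of_continuous_compact (hρ.norm.mul (continuous_const.mul hL.norm))
  · refine Eventually.of_forall fun t u _ => ?_
    have h1 := (hs.differentiable (by simp) (L t u)).hasFDerivAt
    exact (h1.comp u (L t).hasFDerivAt).const_smul (ρ t)

theorem dirDeriv_paramIntegral [Fintype J'] {coord' : J' → V →L[ℝ] ℝ}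
    (hcoord' : ∀ u, ∑ j, coord' j u • e' j = u) (hL : Continuous L)
    (hLe : ∀ j t, L t (e j) = c j t • e' (k j)) {a : V → ℂ}
    (ha : HasBounds e' (fun _ _ => 1) (fun _ => 1) (fun _ : Unit => a)) {ρ : T → ℝ}
    (hρ : Continuous ρ) (j : J) :
    dirDeriv (e j) (fun u => ∫ t, ρ t • a (L t u) ∂ν) =
      fun u => ∫ t, (ρ t * c j t) • dirDeriv (e' (k j)) a (L t u) ∂ν := by
  funext u
  have hcd : Continuous (fderiv ℝ a) := (ha.smooth ()).continuous_fderiv (by simp)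
  simp only [dirDeriv]
  rw [(hasFDerivAt_paramIntegral hcoord' hL ha hρ u).fderiv, ContinuousLinearMap.integral_apply]
  · refine integral_congr_ae (Eventually.of_forall fun t => ?_)
    simp [hLe, mul_assoc]
  · exact integrable_of_continuous_compact
      (hρ.smul ((hcd.comp (hL.clm_apply continuous_const)).clm_comp hL))

/-- Differentiating gives an integral of the same type, with `ρ * c j` for `ρ` and a derivative of
`a` for `a`. Smoothness and bounds both follow by letting `ρ` and `a` vary. -/
theorem HasBounds.paramIntegral [Fintype J] {coord : J → U →L[ℝ] ℝ}
    (hcoord : ∀ u, ∑ j, coord j u • e j = u) [Fintype J'] {coord' : J' → V →L[ℝ] ℝ}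
    (hcoord' : ∀ u, ∑ j, coord' j u • e' j = u) (hL : Continuous L)
    (hLe : ∀ j t, L t (e j) = c j t • e' (k j)) (hc : ∀ j, Continuous (c j))
    (hcκ : ∀ j, (fun q : T × U => c j q.1) =O[⊤] fun q => κ j q.2) {a : ι → V → ℂ}
    (ha : HasBounds e' (fun _ _ => 1) (fun _ => 1) a) {ρ : T → ℝ}
    (hρ : Continuous ρ) (hw : (fun q : T × U => ρ q.1) =O[⊤] fun q => w q.2) :
    HasBounds e κ w (fun i u => ∫ t, ρ t • a i (L t u) ∂ν) := by
  refine ⟨fun i => ?_, fun n => ?_⟩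
  · let S : Set (U → ℂ) := {F | ∃ (ρ : T → ℝ) (a : V → ℂ), Continuous ρ ∧
      HasBounds e' (fun _ _ => 1) (fun _ => 1) (fun _ : Unit => a) ∧
      F = fun u => ∫ t, ρ t • a (L t u) ∂ν}
    refine contDiff_of_dirDeriv_mem coord hcoord S ?_ ?_ _
      ⟨ρ, a i, hρ, ha.reindex (fun _ : Unit => i), rfl⟩
    · rintro F ⟨ρ, a, hρ, ha, rfl⟩ u
      exact (hasFDerivAt_paramIntegral hcoord' hL ha hρ u).differentiableAt
    · rintro F ⟨ρ, a, hρ, ha, rfl⟩ j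
      refine ⟨fun t => ρ t * c j t, MagneticWeyl.dirDeriv (e' (k j)) a, hρ.mul (hc j), ?_,
        dirDeriv_paramIntegral hcoord' hL hLe ha hρ j⟩
      simpa using ha.dirDeriv (k j)
  · have hO : ∀ {a : ι → V → ℂ}, HasBounds e' (fun _ _ => 1) (fun _ => 1) a → ∀ {ρ : T → ℝ}
        {w : U → ℝ}, ((fun q : T × U => ρ q.1) =O[⊤] fun q => w q.2) →
        (fun q : ι × U => ∫ t, ρ t • a q.1 (L t q.2) ∂ν) =O[⊤] fun q => w q.2 := by
      intro a ha ρ w hw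
      obtain ⟨C, hC⟩ := ha.isBigO.bound
      obtain ⟨D, hD⟩ := hw.bound
      refine IsBigO.of_bound (D * C * ν.real Set.univ) (Eventually.of_forall fun q => ?_)
      have : ∀ t, ‖ρ t • a q.1 (L t q.2)‖ ≤ D * ‖w q.2‖ * C := fun t => by
        rw [norm_smul]
        have h1 := eventually_top.1 hC (q.1, L t q.2)
        have h2 := eventually_top.1 hD (t, q.2)
        simp only [norm_one, mul_one] at h1 h2
        exact mul_le_mul h2 h1 (norm_nonneg _) ((norm_nonneg _).trans h2)
      refine (norm_integral_le_of_norm_le_const (Eventually.of_forall this)).trans (le_of_eq ?_)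
      ring
    induction n generalizing w ρ a with
    | zero => exact hO ha hw
    | succ n ih =>
      refine ⟨hO ha hw, fun j => ?_⟩
      have h1 : ∀ i, _ := fun i => dirDeriv_paramIntegral (ν := ν) hcoord' hL hLe
        (ha.reindex (fun _ : Unit => i)) hρ j
      simp only [h1]
      refine ih ?_ (hρ.mul (hc j)) ?_
      · simpa using ha.dirDeriv (k j)
      · simpa only [mul_comm] using (hcκ j).mul hw

end ParamIntegral

end Bounds

/-! ### Commutation of partial derivatives. -/

section MultiDeriv

variable {V E : Type*} [NormedAddCommGroup V] [NormedSpace ℝ V]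
  [NormedAddCommGroup E] [NormedSpace ℝ E] {d : ℕ}

theorem dirDeriv_iterate_comm (u v : V) (n : ℕ) {F : V → E} (hF : ContDiff ℝ ∞ F) :
    dirDeriv v ((dirDeriv u)^[n] F) = (dirDeriv u)^[n] (dirDeriv v F) := by
  induction n with
  | zero => rfl
  | succ n ih =>
    rw [Function.iterate_succ_apply', Function.iterate_succ_apply', ← ih,
      dirDeriv_comm _ _ (contDiff_dirDeriv_iter u n hF)]

theorem contDiff_foldr_dirDeriv (e : Fin d → V) (α : Fin d → ℕ) (l : List (Fin d)) {F : V → E}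
    (hF : ContDiff ℝ ∞ F) :
    ContDiff ℝ ∞ (l.foldr (fun j G => (dirDeriv (e j))^[α j] G) F) := by
  induction l with
  | nil => exact hF
  | cons j l ih => exact contDiff_dirDeriv_iter _ _ ih

theorem dirDeriv_multiDeriv_comm (v : V) (e : Fin d → V) (α : Fin d → ℕ) {F : V → E}
    (hF : ContDiff ℝ ∞ F) : dirDeriv v (multiDeriv e α F) = multiDeriv e α (dirDeriv v F) := by
  unfold multiDeriv
  induction List.finRange d with
  | nil => rfl
  | cons j l ih =>
    simp only [List.foldr_cons]
    rw [dirDeriv_iterate_comm _ _ _ (contDiff_foldr_dirDeriv e α l hF), ih]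

/-- The fold fixes an order of the coordinates, so the new derivative is commuted inwards to the
block of index `j`; `Nodup` ensures that no other block changes. -/
theorem dirDeriv_multiDeriv (e : Fin d → V) (α : Fin d → ℕ) (j : Fin d) {F : V → E}
    (hF : ContDiff ℝ ∞ F) :
    dirDeriv (e j) (multiDeriv e α F) = multiDeriv e (α + Pi.single j 1) F := by
  have hnot : ∀ l : List (Fin d), j ∉ l →
      l.foldr (fun k G => (dirDeriv (e k))^[(α + Pi.single j 1 : Fin d → ℕ) k] G) F =
        l.foldr (fun k G => (dirDeriv (e k))^[α k] G) F := by
    intro l hl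
    induction l with
    | nil => rfl
    | cons k l ih =>
      rw [List.mem_cons, not_or] at hl
      simp only [List.foldr_cons]
      rw [ih hl.2, Pi.add_apply, Pi.single_eq_of_ne (Ne.symm hl.1), add_zero]
  suffices h : ∀ l : List (Fin d), l.Nodup → j ∈ l →
      dirDeriv (e j) (l.foldr (fun k G => (dirDeriv (e k))^[α k] G) F) =
        l.foldr (fun k G => (dirDeriv (e k))^[(α + Pi.single j 1 : Fin d → ℕ) k] G) F from
    h _ (List.nodup_finRange d) (List.mem_finRange j)
  intro l hnd hj
  induction l with
  | nil => simp at hj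
  | cons k l ih =>
    rw [List.nodup_cons] at hnd
    simp only [List.foldr_cons]
    by_cases hkj : k = j
    · subst hkj
      rw [hnot l hnd.1, Pi.add_apply, Pi.single_eq_same, Function.iterate_succ_apply']
    · rw [dirDeriv_iterate_comm _ _ _ (contDiff_foldr_dirDeriv e α l hF),
        ih hnd.2 ((List.mem_cons.1 hj).resolve_left (Ne.symm hkj)), Pi.add_apply,
        Pi.single_eq_of_ne hkj, add_zero]

theorem sum_add_single (α : Fin d → ℕ) (j : Fin d) :
    ∑ k, (α + Pi.single j 1 : Fin d → ℕ) k = ∑ k, α k + 1 := by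
  simp [Finset.sum_add_distrib]

end MultiDeriv

/-! ### Coordinate frames of products. -/

section Frames

variable {U V J J' : Type*} [NormedAddCommGroup U] [NormedSpace ℝ U]
  [NormedAddCommGroup V] [NormedSpace ℝ V]

/-- The directions in a product given by directions in the factors. -/
def prodDir (e : J → U) (e' : J' → V) : J ⊕ J' → U × V :=
  Sum.elim (fun j => (e j, 0)) (fun j => (0, e' j))

/-- The coordinates in a product given by coordinates in the factors. -/
def prodCoord (c : J → U →L[ℝ] ℝ) (c' : J' → V →L[ℝ] ℝ) : J ⊕ J' → U × V →L[ℝ] ℝ :=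
  Sum.elim (fun j => (c j).comp (ContinuousLinearMap.fst ℝ U V))
    (fun j => (c' j).comp (ContinuousLinearMap.snd ℝ U V))

theorem sum_prodCoord [Fintype J] [Fintype J'] {e : J → U} {e' : J' → V} {c : J → U →L[ℝ] ℝ}
    {c' : J' → V →L[ℝ] ℝ} (h : ∀ u, ∑ j, c j u • e j = u) (h' : ∀ v, ∑ j, c' j v • e' j = v)
    (u : U × V) : ∑ j, prodCoord c c' j u • prodDir e e' j = u := by
  rw [Fintype.sum_sum_type]
  ext
  · simp [prodCoord, prodDir, Prod.fst_sum, h]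
  · simp [prodCoord, prodDir, Prod.snd_sum, h']

/-- The coordinates of a vector of `ℝ^d`. -/
def stdCoord {d : ℕ} (j : Fin d) : Conf d →L[ℝ] ℝ := EuclideanSpace.proj j

@[simp] theorem stdCoord_apply {d : ℕ} (j : Fin d) (x : Conf d) : stdCoord j x = x j := rfl

theorem sum_stdCoord {d : ℕ} (x : Conf d) : ∑ j, stdCoord j x • stdVec j = x := by
  ext k
  simp [stdVec, Pi.single_apply]

end Frames

/-! ### Inequalities for `⟨v⟩`. -/

section Bracket

variable {d : ℕ}

theorem one_le_bracket (v : Conf d) : 1 ≤ bracket v :=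
  Real.one_le_sqrt.2 (by nlinarith [sq_nonneg ‖v‖])

theorem bracket_pos (v : Conf d) : 0 < bracket v := zero_lt_one.trans_le (one_le_bracket v)

theorem bracket_sq (v : Conf d) : bracket v ^ 2 = 1 + ‖v‖ ^ 2 := Real.sq_sqrt (by positivity)

theorem norm_le_bracket (v : Conf d) : ‖v‖ ≤ bracket v :=
  Real.le_sqrt_of_sq_le (by linarith)

theorem bracket_le_one_add_norm (v : Conf d) : bracket v ≤ 1 + ‖v‖ :=
  Real.sqrt_le_iff.2 ⟨by positivity, by nlinarith [norm_nonneg v]⟩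

theorem one_add_norm_le_two_mul_bracket (v : Conf d) : 1 + ‖v‖ ≤ 2 * bracket v := by
  linarith [one_le_bracket v, norm_le_bracket v]

theorem bracket_sub_le (v w : Conf d) : bracket (v - w) ≤ 2 * (bracket v * bracket w) := by
  have h1 := one_le_bracket v
  have h2 := one_le_bracket w
  have h3 := bracket_sq v
  have h4 := bracket_sq w
  have h5 := norm_sub_le v w
  refine Real.sqrt_le_iff.2 ⟨by positivity, ?_⟩
  have h6 : ‖v - w‖ ^ 2 ≤ 2 * ‖v‖ ^ 2 + 2 * ‖w‖ ^ 2 := by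
    nlinarith [norm_nonneg (v - w), sq_nonneg (‖v‖ - ‖w‖), norm_nonneg v, norm_nonneg w]
  have h7 : (2 * (bracket v * bracket w)) ^ 2 = 4 * (1 + ‖v‖ ^ 2) * (1 + ‖w‖ ^ 2) := by
    rw [← h3, ← h4]; ring
  rw [h7]
  nlinarith [mul_nonneg (sq_nonneg ‖v‖) (sq_nonneg ‖w‖)]

theorem bracket_le_sub (v w : Conf d) : bracket v ≤ 2 * (bracket (v - w) * bracket w) := by
  have h := bracket_sub_le (v - w) (-w)
  have h' : bracket (-w) = bracket w := by simp [bracket]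
  rwa [h', sub_neg_eq_add, sub_add_cancel] at h

theorem continuous_bracket : Continuous (bracket (d := d)) := by
  unfold bracket; fun_prop

/-- Peetre's inequality. -/
theorem bracket_sub_rpow_le (s : ℝ) (v w : Conf d) :
    bracket (v - w) ^ s ≤ 2 ^ |s| * (bracket v ^ s * bracket w ^ |s|) := by
  have hv := bracket_pos v
  have hw := bracket_pos w
  have hvw := bracket_pos (v - w)
  rcases le_total 0 s with hs | hs
  · rw [abs_of_nonneg hs, ← Real.mul_rpow hv.le hw.le, ← Real.mul_rpow (by norm_num)
      (by positivity)]
    exact Real.rpow_le_rpow hvw.le (bracket_sub_le v w) hs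
  -- For a negative exponent the roles of `v` and `v - w` are exchanged: `⟨v⟩ ≤ 2⟨v-w⟩⟨w⟩` is raised
  -- to the power `-s` and the powers are moved across.
  · rw [abs_of_nonpos hs]
    have h := Real.rpow_le_rpow hv.le (bracket_le_sub v w) (neg_nonneg.2 hs)
    rw [Real.mul_rpow (by norm_num) (by positivity), Real.mul_rpow hvw.le hw.le] at h
    have h1 : bracket v ^ (-s) * bracket v ^ s = 1 := by
      rw [← Real.rpow_add hv]; simp
    have h2 : bracket (v - w) ^ (-s) * bracket (v - w) ^ s = 1 := by
      rw [← Real.rpow_add hvw]; simp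
    have h3 := mul_le_mul_of_nonneg_right h
      (mul_nonneg (Real.rpow_nonneg hv.le s) (Real.rpow_nonneg hvw.le s))
    calc bracket (v - w) ^ s = (bracket v ^ (-s) * bracket v ^ s) * bracket (v - w) ^ s := by
          rw [h1, one_mul]
      _ = bracket v ^ (-s) * (bracket v ^ s * bracket (v - w) ^ s) := by ring
      _ ≤ _ := h3
      _ = (bracket (v - w) ^ (-s) * bracket (v - w) ^ s) *
          (2 ^ (-s) * (bracket v ^ s * bracket w ^ (-s))) := by ring
      _ = _ := by rw [h2, one_mul]

end Bracket

/-! ### Fréchet seminorms versus `HasBounds`. -/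

section Frozen

variable {d : ℕ} {ι : Type*} {m : ℝ}

/-- The coordinate directions of phase space. -/
def phaseDir : Fin d ⊕ Fin d → Phase d := prodDir stdVec stdVec

/-- A derivative of a symbol in `x` costs nothing, one in `ξ` gains a factor `⟨ξ⟩⁻¹`. -/
def phaseCost : Fin d ⊕ Fin d → Phase d → ℝ :=
  Sum.elim (fun _ _ => 1) (fun _ X => (bracket X.2)⁻¹)

theorem dirDeriv_inl_phaseDeriv (α β : Fin d → ℕ) (j : Fin d) {F : Phase d → ℂ}
    (hF : ContDiff ℝ ∞ F) : dirDeriv (phaseDir (Sum.inl j)) (phaseDeriv α β F) =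
      phaseDeriv (α + Pi.single j 1) β F :=
  dirDeriv_multiDeriv (fun j => ((stdVec j, 0) : Phase d)) α j (contDiff_multiDeriv _ _ hF)

theorem dirDeriv_inr_phaseDeriv (α β : Fin d → ℕ) (j : Fin d) {F : Phase d → ℂ}
    (hF : ContDiff ℝ ∞ F) : dirDeriv (phaseDir (Sum.inr j)) (phaseDeriv α β F) =
      phaseDeriv α (β + Pi.single j 1) F := by
  unfold phaseDeriv
  rw [dirDeriv_multiDeriv_comm _ _ _ (contDiff_multiDeriv _ _ hF)]
  congr 1
  exact dirDeriv_multiDeriv (fun j => ((0, stdVec j) : Phase d)) β j hF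

theorem multiDeriv_zero_index {V E : Type*} [NormedAddCommGroup V] [NormedSpace ℝ V]
    [NormedAddCommGroup E] [NormedSpace ℝ E] (e : Fin d → V) (F : V → E) :
    multiDeriv e 0 F = F := by
  unfold multiDeriv
  induction List.finRange d with
  | nil => rfl
  | cons j l ih => exact ih

theorem bracket_rpow_sub_succ (m : ℝ) (k : ℕ) (v : Conf d) :
    (bracket v)⁻¹ * bracket v ^ (m - k) = bracket v ^ (m - (k + 1 : ℕ)) := by
  rw [← Real.rpow_neg_one, ← Real.rpow_add (bracket_pos v)]
  congr 1
  push_cast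
  ring

theorem norm_phaseDeriv_le (f : Symbol d m) (α β : Fin d → ℕ) (X : Phase d) :
    ‖phaseDeriv α β f.1 X‖ ≤ symbolSeminorm d m (∑ j, α j, ∑ j, β j) f *
      bracket X.2 ^ (m - (∑ j, β j : ℕ)) := by
  set N := ∑ j, α j
  set M := ∑ j, β j
  have h1 : symbolWeight (m - M) N M f.1 X ≤ symbolSeminorm d m (N, M) f :=
    le_ciSup (f.2.2 N M) X
  have hpos := bracket_pos X.2
  have h2 : ‖phaseDeriv α β f.1 X‖ ≤ ∑ α ∈ Finset.piAntidiag Finset.univ N,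
      ∑ β ∈ Finset.piAntidiag Finset.univ M, ‖phaseDeriv α β f.1 X‖ := by
    refine le_trans ?_ (Finset.single_le_sum (f := fun α : Fin d → ℕ =>
      ∑ β ∈ Finset.piAntidiag Finset.univ M, ‖phaseDeriv α β f.1 X‖)
      (fun _ _ => Finset.sum_nonneg fun _ _ => norm_nonneg _) (a := α) ?_)
    · exact Finset.single_le_sum (f := fun β : Fin d → ℕ => ‖phaseDeriv α β f.1 X‖)
        (fun _ _ => norm_nonneg _) (by simp [Finset.mem_piAntidiag, M])
    · simp [Finset.mem_piAntidiag, N]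
  refine h2.trans ?_
  refine le_trans (le_of_eq ?_) (mul_le_mul_of_nonneg_right h1
    (Real.rpow_nonneg hpos.le (m - M)))
  unfold symbolWeight
  rw [mul_right_comm, ← Real.rpow_add hpos]
  simp

/-- Bounded families in the Fréchet space enter the calculus of bounds here;
`HasBounds.symbolSeminorm_le` leads back. -/
theorem hasBounds_of_symbolSeminorm_le {f : ι → Symbol d m}
    (h : ∀ k, ∃ C, ∀ i, symbolSeminorm d m k (f i) ≤ C) :
    HasBounds phaseDir phaseCost (fun X => bracket X.2 ^ m) (fun i => (f i).1) := by
  refine ⟨fun i => (f i).2.1, fun n => ?_⟩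
  -- All `∂_x^α ∂_ξ^β f` are treated at once, since the induction on the order replaces one of them
  -- by another.
  suffices H : ∀ α β : Fin d → ℕ, BoundsUpTo phaseDir phaseCost n
      (fun X => bracket X.2 ^ (m - (∑ j, β j : ℕ))) (fun i => phaseDeriv α β (f i).1) by
    simpa [phaseDeriv, multiDeriv_zero_index] using H 0 0
  have hO : ∀ α β : Fin d → ℕ, (fun q : ι × Phase d => phaseDeriv α β (f q.1).1 q.2) =O[⊤]
      fun q => bracket q.2.2 ^ (m - (∑ j, β j : ℕ)) := by
    intro α β
    obtain ⟨C, hC⟩ := h (∑ j, α j, ∑ j, β j)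
    refine IsBigO.of_bound C (Eventually.of_forall fun q => ?_)
    rw [Real.norm_of_nonneg (Real.rpow_nonneg (bracket_pos _).le _)]
    exact (norm_phaseDeriv_le _ _ _ _).trans
      (mul_le_mul_of_nonneg_right (hC _) (Real.rpow_nonneg (bracket_pos _).le _))
  induction n with
  | zero => exact hO
  | succ n ih =>
    intro α β
    refine ⟨hO α β, ?_⟩
    rintro (j | j)
    · simp only [dirDeriv_inl_phaseDeriv α β j (f _).2.1]
      simpa [phaseCost] using ih (α + Pi.single j 1) β
    · simp only [dirDeriv_inr_phaseDeriv α β j (f _).2.1]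
      have := ih α (β + Pi.single j 1)
      simp only [sum_add_single] at this
      simpa only [phaseCost, Sum.elim_inr, bracket_rpow_sub_succ] using this

theorem HasBounds.multiDeriv_inl {w : Phase d → ℝ} {a : ι → Phase d → ℂ}
    (h : HasBounds phaseDir phaseCost w a) (α : Fin d → ℕ) :
    HasBounds phaseDir phaseCost w
      (fun i => multiDeriv (fun j => ((stdVec j, 0) : Phase d)) α (a i)) := by
  unfold multiDeriv
  induction List.finRange d with
  | nil => exact h
  | cons j l ih =>
    simp only [List.foldr_cons]
    induction α j with
    | zero => exact ih
    | succ n ihn =>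
      simp only [Function.iterate_succ_apply']
      have := ihn.dirDeriv (Sum.inl j)
      simp only [phaseCost, Sum.elim_inl, one_mul] at this
      exact this

theorem HasBounds.multiDeriv_inr {a : ι → Phase d → ℂ}
    (h : HasBounds phaseDir phaseCost (fun X => bracket X.2 ^ m) a) (β : Fin d → ℕ) :
    HasBounds phaseDir phaseCost (fun X => bracket X.2 ^ (m - (∑ j, β j : ℕ)))
      (fun i => multiDeriv (fun j => ((0, stdVec j) : Phase d)) β (a i)) := by
  unfold multiDeriv
  -- The length of `β` becomes a sum over the same list that defines the iterated derivative, so one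
  -- induction on the list treats both.
  rw [← List.sum_ofFn, List.ofFn_eq_map]
  induction List.finRange d with
  | nil => simpa using h
  | cons j l ih =>
    simp only [List.foldr_cons, List.map_cons, List.sum_cons]
    induction β j with
    | zero => simpa using ih
    | succ n ihn =>
      simp only [Function.iterate_succ_apply']
      have := ihn.dirDeriv (Sum.inr j)
      simp only [phaseCost, Sum.elim_inr, bracket_rpow_sub_succ] at this
      rwa [add_right_comm]

theorem HasBounds.symbolWeight_le {a : ι → Phase d → ℂ}
    (h : HasBounds phaseDir phaseCost (fun X => bracket X.2 ^ m) a) (N M : ℕ) :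
    ∃ C, ∀ i X, symbolWeight (m - M) N M (a i) X ≤ C := by
  have h1 : ∀ α β : Fin d → ℕ, ∃ C, ∀ i X, ‖phaseDeriv α β (a i) X‖ ≤
      C * bracket X.2 ^ (m - (∑ j, β j : ℕ)) := by
    intro α β
    obtain ⟨C, hC⟩ := ((h.multiDeriv_inr β).multiDeriv_inl α).isBigO.bound
    refine ⟨C, fun i X => ?_⟩
    have := eventually_top.1 hC (i, X)
    rwa [Real.norm_of_nonneg (Real.rpow_nonneg (bracket_pos _).le _)] at this
  choose C hC using h1
  refine ⟨∑ α ∈ Finset.piAntidiag Finset.univ N, ∑ β ∈ Finset.piAntidiag Finset.univ M, C α β,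
    fun i X => ?_⟩
  unfold symbolWeight
  have hpos := bracket_pos X.2
  rw [Finset.mul_sum]
  refine Finset.sum_le_sum fun α _ => ?_
  rw [Finset.mul_sum]
  refine Finset.sum_le_sum fun β hβ => ?_
  have hM : ∑ j, β j = M := (Finset.mem_piAntidiag.1 hβ).1
  have := mul_le_mul_of_nonneg_left (hC α β i X) (Real.rpow_nonneg hpos.le (-(m - M)))
  refine this.trans (le_of_eq ?_)
  rw [hM, mul_left_comm, ← Real.rpow_add hpos]
  simp

theorem HasBounds.mem_symbolSubmodule {a : Phase d → ℂ}
    (h : HasBounds phaseDir phaseCost (fun X => bracket X.2 ^ m) (fun _ : Unit => a)) :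
    a ∈ symbolSubmodule d m := by
  refine ⟨h.smooth (), fun N M => ?_⟩
  obtain ⟨C, hC⟩ := h.symbolWeight_le N M
  exact ⟨C, by rintro _ ⟨X, rfl⟩; exact hC () X⟩

theorem HasBounds.symbolSeminorm_le {a : ι → Symbol d m}
    (h : HasBounds phaseDir phaseCost (fun X => bracket X.2 ^ m) (fun i => (a i).1)) (k : ℕ × ℕ) :
    ∃ C, ∀ i, symbolSeminorm d m k (a i) ≤ C := by
  obtain ⟨C, hC⟩ := h.symbolWeight_le k.1 k.2
  exact ⟨C, fun i => ciSup_le (hC i)⟩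

theorem hasBounds_of_bcSeminorm_le {f : ι → BCInf d}
    (h : ∀ n, ∃ C, ∀ i, bcSeminorm d n (f i) ≤ C) :
    HasBounds stdVec (fun _ _ => 1) (fun _ => 1) (fun i x => ((f i).1 x : ℂ)) := by
  refine HasBounds.clm (a := fun i => (f i).1) ⟨fun i => (f i).2.1, fun n => ?_⟩
    Complex.ofRealCLM
  suffices H : ∀ α : Fin d → ℕ, BoundsUpTo stdVec (fun _ _ => 1) n
      (fun _ => 1) (fun i => pderiv α (f i).1) by
    simpa [pderiv, multiDeriv_zero_index] using H 0
  have hO : ∀ α : Fin d → ℕ, (fun q : ι × Conf d => pderiv α (f q.1).1 q.2) =O[⊤]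
      fun _ => (1 : ℝ) := by
    intro α
    obtain ⟨C, hC⟩ := h (∑ j, α j)
    refine IsBigO.of_bound C (Eventually.of_forall fun q => ?_)
    rw [norm_one, mul_one]
    exact (le_ciSup (bddAbove_bcNu (∑ j, α j) (f q.1).2)
      (q.2, (⟨α, le_rfl⟩ : MultiLE d (∑ j, α j)))).trans (hC _)
  induction n with
  | zero => exact hO
  | succ n ih =>
    intro α
    refine ⟨hO α, fun j => ?_⟩
    have h1 : ∀ i, dirDeriv (stdVec j) (pderiv α (f i).1) =
      pderiv (α + Pi.single j 1) (f i).1 := fun i => dirDeriv_multiDeriv _ α j (f i).2.1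
    simp only [h1, mul_one]
    exact ih _

end Frozen

/-! ### Regularized oscillatory integrals and integration by parts. -/

section OscGeneral

set_option linter.unusedSectionVars false

open scoped LineDeriv

variable {V : Type*} [NormedAddCommGroup V]

/-- Polynomial boundedness. -/
def PolyBounded (a : V → ℂ) : Prop := ∃ (C : ℝ) (k : ℕ), ∀ v, ‖a v‖ ≤ C * (1 + ‖v‖) ^ k

theorem PolyBounded.add {a b : V → ℂ} (ha : PolyBounded a) (hb : PolyBounded b) :
    PolyBounded (fun v => a v + b v) := by
  obtain ⟨C, k, hC⟩ := ha
  obtain ⟨D, l, hD⟩ := hb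
  refine ⟨|C| + |D|, k + l, fun v => (norm_add_le _ _).trans ?_⟩
  have h1 : (1 : ℝ) ≤ 1 + ‖v‖ := by linarith [norm_nonneg v]
  rw [add_mul]
  refine add_le_add ((hC v).trans ?_) ((hD v).trans ?_)
  · exact mul_le_mul (le_abs_self C) (pow_le_pow_right₀ h1 (by lia)) (by positivity)
      (abs_nonneg _)
  · exact mul_le_mul (le_abs_self D) (pow_le_pow_right₀ h1 (by lia)) (by positivity)
      (abs_nonneg _)

theorem PolyBounded.mul {a b : V → ℂ} (ha : PolyBounded a) (hb : PolyBounded b) :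
    PolyBounded (fun v => a v * b v) := by
  obtain ⟨C, k, hC⟩ := ha
  obtain ⟨D, l, hD⟩ := hb
  refine ⟨C * D, k + l, fun v => ?_⟩
  rw [norm_mul]
  refine (mul_le_mul (hC v) (hD v) (norm_nonneg _) ((norm_nonneg _).trans (hC v))).trans
    (le_of_eq ?_)
  rw [pow_add]; ring

theorem PolyBounded.sum {J : Type*} (s : Finset J) {a : J → V → ℂ} (ha : ∀ j, PolyBounded (a j)) :
    PolyBounded (fun v => ∑ j ∈ s, a j v) := by
  classical
  induction s using Finset.induction_on with
  | empty => exact ⟨0, 0, by simp⟩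
  | insert k s hk ih =>
    simp only [Finset.sum_insert hk]
    exact (ha k).add ih

theorem PolyBounded.of_linear [NormedSpace ℝ V] (L : V →L[ℝ] ℝ) :
    PolyBounded (fun v => (L v : ℂ)) := by
  refine ⟨‖L‖, 1, fun v => ?_⟩
  rw [Complex.norm_real, pow_one]
  exact (L.le_opNorm v).trans (mul_le_mul_of_nonneg_left (by linarith) (norm_nonneg _))

variable [NormedSpace ℝ V]

/-- This is the source of the rate: `χ(εv) - χ(0)` is `O(ε‖v‖)` by the mean value inequality. -/
theorem SchwartzMap.exists_norm_sub_le (χ : 𝓢(V, ℂ)) : ∃ C, ∀ v, ‖χ v - χ 0‖ ≤ C * ‖v‖ := by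
  refine ⟨SchwartzMap.seminorm ℝ 0 1 χ, fun v => ?_⟩
  have h := Convex.norm_image_sub_le_of_norm_fderiv_le (𝕜 := ℝ) (f := χ) (s := Set.univ)
    (C := SchwartzMap.seminorm ℝ 0 1 χ) (fun x _ => χ.differentiableAt) (fun x _ => ?_)
    convex_univ (Set.mem_univ 0) (Set.mem_univ v)
  · simpa using h
  · rw [← norm_iteratedFDeriv_one]
    exact SchwartzMap.norm_iteratedFDeriv_le_seminorm ℝ χ 1 x

variable [FiniteDimensional ℝ V] [MeasureSpace V] [BorelSpace V]
  [(volume : Measure V).IsAddHaarMeasure]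

/-- The regularized oscillatory integral. -/
def regInt (φ : V → ℝ) (χ : 𝓢(V, ℂ)) (ε : ℝ) (a : V → ℂ) : ℂ :=
  ∫ v, χ (ε • v) * Complex.exp (Complex.I * (φ v : ℂ)) * a v

theorem norm_cexp_I_mul_ofReal (x : ℝ) : ‖Complex.exp (Complex.I * (x : ℂ))‖ = 1 := by
  rw [mul_comm, Complex.norm_exp_ofReal_mul_I]

theorem integrable_regularized {φ : V → ℝ} (hφ : Continuous φ) (χ : 𝓢(V, ℂ)) {ε : ℝ} (hε : 0 < ε)
    {a : V → ℂ} (ha : Continuous a) (hp : PolyBounded a) :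
    Integrable (fun v => χ (ε • v) * Complex.exp (Complex.I * (φ v : ℂ)) * a v) := by
  obtain ⟨C, k, hC⟩ := hp
  let g : V ≃L[ℝ] V := ContinuousLinearEquiv.smulLeft (Units.mk0 ε hε.ne')
  let χ' : 𝓢(V, ℂ) := SchwartzMap.compCLMOfContinuousLinearEquiv ℝ g χ
  have hχ' : ∀ v, χ' v = χ (ε • v) := fun v => rfl
  have h1 : Integrable (fun v => (C * 2 ^ k) * (‖v‖ ^ 0 * ‖χ' v‖ + ‖v‖ ^ k * ‖χ' v‖)) :=
    ((χ'.integrable_pow_mul volume 0).add (χ'.integrable_pow_mul volume k)).const_mul _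
  have hcont : Continuous fun v => χ (ε • v) := χ.continuous.comp (continuous_const_smul ε)
  refine h1.mono' (by fun_prop) (Eventually.of_forall fun v => ?_)
  rw [norm_mul, norm_mul, norm_cexp_I_mul_ofReal, mul_one, hχ']
  have hC0 : 0 ≤ C := by
    have := (norm_nonneg _).trans (hC 0)
    simpa using this
  -- Polynomial growth is reduced to the powers `0` and `k` of the norm, against which Schwartz
  -- functions are integrable.
  have h2 : (1 + ‖v‖) ^ k ≤ 2 ^ k * (1 + ‖v‖ ^ k) := by
    rcases le_total ‖v‖ 1 with h | h
    · calc (1 + ‖v‖) ^ k ≤ 2 ^ k := pow_le_pow_left₀ (by positivity) (by linarith) k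
        _ ≤ 2 ^ k * (1 + ‖v‖ ^ k) := le_mul_of_one_le_right (by positivity)
          (by linarith [pow_nonneg (norm_nonneg v) k])
    · calc (1 + ‖v‖) ^ k ≤ (2 * ‖v‖) ^ k := pow_le_pow_left₀ (by positivity) (by linarith) k
        _ = 2 ^ k * ‖v‖ ^ k := mul_pow _ _ _
        _ ≤ _ := by gcongr; linarith
  calc ‖χ (ε • v)‖ * ‖a v‖ ≤ ‖χ (ε • v)‖ * (C * (2 ^ k * (1 + ‖v‖ ^ k))) := by
        gcongr
        exact (hC v).trans (by gcongr)
    _ = _ := by ring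

theorem regInt_add {φ : V → ℝ} (hφ : Continuous φ) (χ : 𝓢(V, ℂ)) {ε : ℝ} (hε : 0 < ε)
    {a b : V → ℂ} (ha : Continuous a) (pa : PolyBounded a) (hb : Continuous b)
    (pb : PolyBounded b) :
    regInt φ χ ε (fun v => a v + b v) = regInt φ χ ε a + regInt φ χ ε b := by
  unfold regInt
  rw [← integral_add (integrable_regularized hφ χ hε ha pa)
    (integrable_regularized hφ χ hε hb pb)]
  simp only [mul_add]

theorem regInt_sum {J : Type*} (s : Finset J) {φ : V → ℝ} (hφ : Continuous φ) (χ : 𝓢(V, ℂ))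
    {ε : ℝ} (hε : 0 < ε) {a : J → V → ℂ} (ha : ∀ j, Continuous (a j))
    (pa : ∀ j, PolyBounded (a j)) :
    regInt φ χ ε (fun v => ∑ j ∈ s, a j v) = ∑ j ∈ s, regInt φ χ ε (a j) := by
  unfold regInt
  rw [← integral_finsetSum _ fun j _ => integrable_regularized hφ χ hε (ha j) (pa j)]
  simp only [Finset.mul_sum]

/-- Integration by parts in a regularized oscillatory integral. -/
theorem regInt_dirDeriv_phase_mul {φ : V → ℝ} (hφ : ContDiff ℝ ∞ φ) {v : V} (ℓ : V →L[ℝ] ℝ)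
    (hℓ : dirDeriv v φ = ℓ) (χ : 𝓢(V, ℂ)) {ε : ℝ} (hε : 0 < ε) {b : V → ℂ}
    (hb : ContDiff ℝ ∞ b) (pb : PolyBounded b) (pb' : PolyBounded (dirDeriv v b)) :
    regInt φ χ ε (fun u => (ℓ u : ℂ) * b u) =
      Complex.I * (regInt φ χ ε (dirDeriv v b) + ε * regInt φ (∂_{v} χ) ε b) := by
  have hφc := hφ.continuous
  have hbc := hb.continuous
  have hb'c : Continuous (dirDeriv v b) := (contDiff_dirDeriv v hb).continuous
  set f : V → ℂ := fun u => Complex.exp (Complex.I * (φ u : ℂ)) with hf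
  set g : V → ℂ := fun u => χ (ε • u) * b u with hg
  have hφC : ContDiff ℝ ∞ fun u => Complex.I * (φ u : ℂ) :=
    contDiff_const.mul (Complex.ofRealCLM.contDiff.comp hφ)
  have hfs : ContDiff ℝ ∞ f := hφC.cexp
  have hχs : ContDiff ℝ ∞ fun u : V => χ (ε • u) :=
    (χ.smooth ⊤).comp (contDiff_const_smul ε)
  have hf' : ∀ u, fderiv ℝ f u v = Complex.I * (ℓ u : ℂ) * f u := by
    intro u
    have h1 := congrFun (dirDeriv_cexp v hφC) u
    have h2 := congrFun (dirDeriv_clm v ((ContinuousLinearMap.mul ℝ ℂ Complex.I).comp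
      Complex.ofRealCLM) hφ) u
    simp only [ContinuousLinearMap.comp_apply, ContinuousLinearMap.mul_apply',
      Complex.ofRealCLM_apply, hℓ] at h2
    rw [h2] at h1
    exact h1
  have hg' : ∀ u, fderiv ℝ g u v = ε * ((∂_{v} χ) (ε • u)) * b u + χ (ε • u) * dirDeriv v b u := by
    intro u
    have h1 := congrFun (dirDeriv_mul v hχs hb) u
    have h2 := congrFun (dirDeriv_comp_clm v (ε • ContinuousLinearMap.id ℝ V) (χ.smooth ⊤)) u
    simp only [smul_apply, ContinuousLinearMap.id_apply,
      dirDeriv_smul_dir] at h2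
    rw [h2] at h1
    refine h1.trans ?_
    rw [SchwartzMap.lineDerivOp_apply_eq_fderiv, Complex.real_smul]
    rfl
  have i1 := integrable_regularized hφc χ hε hbc pb
  have i2 := integrable_regularized hφc χ hε hb'c pb'
  have i3 := integrable_regularized hφc (∂_{v} χ) hε hbc pb
  have i4 := integrable_regularized hφc χ hε
    (a := fun u => (ℓ u : ℂ) * b u) (by fun_prop) ((PolyBounded.of_linear ℓ).mul pb)
  have key := integral_mul_fderiv_eq_neg_fderiv_mul_of_integrable (μ := volume)
    (f := f) (g := g) (v := v) ?_ ?_ ?_ (fun x _ => hfs.differentiable (by simp) x)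
    (fun x _ => (hχs.mul hb).differentiable (by simp) x)
  · have e1 : ∫ x, f x * fderiv ℝ g x v =
        ε * regInt φ (∂_{v} χ) ε b + regInt φ χ ε (dirDeriv v b) := by
      unfold regInt
      rw [← integral_const_mul, ← integral_add (i3.const_mul _) i2]
      congr 1
      funext u
      rw [hg']
      ring
    have e2 : ∫ x, fderiv ℝ f x v * g x =
        Complex.I * regInt φ χ ε (fun u => (ℓ u : ℂ) * b u) := by
      unfold regInt
      rw [← integral_const_mul]
      congr 1
      funext u
      rw [hf']
      ring
    rw [e1, e2] at key
    rw [add_comm, key, mul_neg, ← mul_assoc, Complex.I_mul_I]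
    ring
  · refine (i4.const_mul Complex.I).congr (Eventually.of_forall fun u => ?_)
    beta_reduce
    rw [hf']
    simp only [hf, hg]
    ring
  · refine ((i3.const_mul (ε : ℂ)).add i2).congr (Eventually.of_forall fun u => ?_)
    simp only [Pi.add_apply, hg', hf]
    ring
  · refine i1.congr (Eventually.of_forall fun u => ?_)
    simp only [hf, hg]
    ring

variable {P : Type*}

/-- The regularized oscillatory integrals of the amplitudes `a p` are `χ(0) I(p) + O(ε w(p))`,
where `I = O(w)`, uniformly in the parameter `p`. -/
structure OscConv (φ : V → ℝ) (w : P → ℝ) (a : P → V → ℂ) (I : P → ℂ) : Prop where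
  isBigO : I =O[⊤] w
  conv : ∀ χ : 𝓢(V, ℂ), (fun q : P × Set.Ioc (0 : ℝ) 1 => regInt φ χ q.2 (a q.1) - χ 0 * I q.1)
    =O[⊤] fun q => (q.2 : ℝ) * w q.1

/-- A bound uniform in `ε ≤ 1`, with no normalization of `χ(0)`. It is applied to derivatives of the
cutoff, whose value at `0` is arbitrary. -/
theorem OscConv.regInt_isBigO {φ : V → ℝ} {w : P → ℝ} {a : P → V → ℂ} {I : P → ℂ}
    (h : OscConv φ w a I) (χ : 𝓢(V, ℂ)) :
    (fun q : P × Set.Ioc (0 : ℝ) 1 => regInt φ χ q.2 (a q.1)) =O[⊤] fun q => w q.1 := by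
  have h1 : (fun q : P × Set.Ioc (0 : ℝ) 1 => (q.2 : ℝ) * w q.1) =O[⊤] fun q => w q.1 := by
    refine IsBigO.of_bound 1 (Eventually.of_forall fun q => ?_)
    rw [norm_mul, Real.norm_of_nonneg q.2.2.1.le]
    exact mul_le_mul_of_nonneg_right q.2.2.2 (norm_nonneg _)
  have h2 : (fun q : P × Set.Ioc (0 : ℝ) 1 => χ 0 * I q.1) =O[⊤] fun q => w q.1 :=
    (h.isBigO.comp_tendsto (k := Prod.fst) le_top).const_mul_left (χ 0)
  simpa using ((h.conv χ).trans h1).add h2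

theorem OscConv.hasOscIntegral {φ : V → ℝ} (hφ : Continuous φ) {w : P → ℝ} {a : P → V → ℂ}
    {I : P → ℂ} (h : OscConv φ w a I) {p : P} (hc : Continuous (a p)) (hp : PolyBounded (a p)) :
    HasOscIntegral φ (a p) (I p) := by
  intro χ hχ
  refine ⟨fun ε hε => integrable_regularized hφ χ hε hc hp, ?_⟩
  obtain ⟨C, hC⟩ := (h.conv χ).bound
  rw [tendsto_iff_norm_sub_tendsto_zero]
  have h0 : Tendsto (fun ε : ℝ => C * ‖ε * w p‖) (𝓝[>] 0) (𝓝 0) := by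
    have : Tendsto (fun ε : ℝ => C * ‖ε * w p‖) (𝓝 0) (𝓝 (C * ‖(0 : ℝ) * w p‖)) :=
      Continuous.tendsto (by fun_prop) 0
    simpa using this.mono_left nhdsWithin_le_nhds
  refine squeeze_zero' (Eventually.of_forall fun _ => norm_nonneg _) ?_ h0
  filter_upwards [Ioc_mem_nhdsGT (zero_lt_one (α := ℝ))] with ε hε
  have := eventually_top.1 hC (p, ⟨ε, hε⟩)
  simpa [hχ, regInt] using this

/-- Without an admissible cutoff `HasOscIntegral` would be vacuous and its value not unique. -/
theorem exists_schwartz_apply_zero : ∃ χ : 𝓢(V, ℂ), χ 0 = 1 := by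
  let b : ContDiffBump (0 : V) := ⟨1, 2, by norm_num, by norm_num⟩
  have h1 : HasCompactSupport fun v => (b v : ℂ) :=
    b.hasCompactSupport.comp_left (g := fun x : ℝ => (x : ℂ)) (by simp)
  have h2 : ContDiff ℝ ∞ fun v => (b v : ℂ) := Complex.ofRealCLM.contDiff.comp b.contDiff
  refine ⟨h1.toSchwartzMap h2, ?_⟩
  have : b 0 = 1 := b.one_of_mem_closedBall (Metric.mem_closedBall_self b.rIn_pos.le)
  change ((b 0 : ℝ) : ℂ) = 1
  simp [this]

theorem HasOscIntegral.unique {φ : V → ℝ} {a : V → ℂ} {I I' : ℂ} (h : HasOscIntegral φ a I)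
    (h' : HasOscIntegral φ a I') : I = I' := by
  obtain ⟨χ, hχ⟩ := exists_schwartz_apply_zero (V := V)
  exact tendsto_nhds_unique (h χ hχ).2 (h' χ hχ).2

theorem HasOscIntegral.oscIntegral_eq {φ : V → ℝ} {a : V → ℂ} {I : ℂ}
    (h : HasOscIntegral φ a I) : oscIntegral φ a = I := by
  have hex : ∃ I, HasOscIntegral φ a I := ⟨I, h⟩
  rw [oscIntegral, dif_pos hex]
  exact hex.choose_spec.unique h

/-- The base case is an absolutely convergent integral. One extra moment `‖v‖ * h v` pays for the
rate `ε`. -/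
theorem OscConv.of_integrable {φ : V → ℝ} (hφ : Continuous φ) {w : P → ℝ} {a : P → V → ℂ}
    (hc : ∀ p, Continuous (a p)) {h : V → ℝ} (hi : Integrable h)
    (hi' : Integrable fun v => ‖v‖ * h v)
    (ha : (fun q : P × V => a q.1 q.2) =O[⊤] fun q => w q.1 * h q.2) :
    OscConv φ w a (fun p => ∫ v, Complex.exp (Complex.I * (φ v : ℂ)) * a p v) := by
  obtain ⟨C, hC⟩ := ha.bound
  have hC' : ∀ p v, ‖a p v‖ ≤ C * ‖w p‖ * ‖h v‖ := fun p v => by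
    have := eventually_top.1 hC (p, v)
    rwa [norm_mul, ← mul_assoc] at this
  have hint : ∀ p, Integrable fun v => Complex.exp (Complex.I * (φ v : ℂ)) * a p v := fun p => by
    have := hc p
    refine (hi.norm.const_mul (C * ‖w p‖)).mono' (by fun_prop)
      (Eventually.of_forall fun v => ?_)
    rw [norm_mul, norm_cexp_I_mul_ofReal, one_mul]
    exact hC' p v
  constructor
  · refine IsBigO.of_bound (C * ∫ v, ‖h v‖) (Eventually.of_forall fun p => ?_)
    refine (norm_integral_le_of_norm_le (hi.norm.const_mul (C * ‖w p‖))
      (Eventually.of_forall fun v => ?_)).trans (le_of_eq ?_)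
    · rw [norm_mul, norm_cexp_I_mul_ofReal, one_mul]
      exact hC' p v
    · rw [integral_const_mul]; ring
  · intro χ
    obtain ⟨D, hD⟩ := SchwartzMap.exists_norm_sub_le χ
    refine IsBigO.of_bound (C * D * ∫ v, ‖‖v‖ * h v‖) (Eventually.of_forall fun q => ?_)
    obtain ⟨p, ε, hε0, hε1⟩ := q
    have hχc : Continuous fun v : V => χ (ε • v) := χ.continuous.comp (continuous_const_smul ε)
    have hreg : Integrable fun v =>
        χ (ε • v) * Complex.exp (Complex.I * (φ v : ℂ)) * a p v := by
      have h1 := (hint p).bdd_mul (c := SchwartzMap.seminorm ℝ 0 0 χ) hχc.aestronglyMeasurable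
        (Eventually.of_forall fun v => χ.norm_le_seminorm ℝ (ε • v))
      simpa only [mul_assoc] using h1
    have e1 : regInt φ χ ε (a p) - χ 0 * ∫ v, Complex.exp (Complex.I * (φ v : ℂ)) * a p v =
        ∫ v, (χ (ε • v) - χ 0) * (Complex.exp (Complex.I * (φ v : ℂ)) * a p v) := by
      unfold regInt
      rw [← integral_const_mul, ← integral_sub hreg ((hint p).const_mul _)]
      congr 1
      funext v
      ring
    simp only
    rw [e1]
    refine (norm_integral_le_of_norm_le (hi'.norm.const_mul (C * D * (ε * ‖w p‖)))
      (Eventually.of_forall fun v => ?_)).trans (le_of_eq ?_)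
    · rw [norm_mul, norm_mul, norm_cexp_I_mul_ofReal, one_mul, norm_mul, norm_norm]
      have h1 := hD (ε • v)
      rw [norm_smul, Real.norm_of_nonneg hε0.le] at h1
      refine (mul_le_mul h1 (hC' p v) (norm_nonneg _) ((norm_nonneg _).trans h1)).trans
        (le_of_eq ?_)
      ring
    · rw [integral_const_mul, norm_mul, Real.norm_of_nonneg hε0.le]; ring

/-- A gain by integration by parts: `a = b₀ + ∑ⱼ ℓⱼ bⱼ`, where `ℓⱼ` is the derivative of the phase
in the direction `vⱼ`. -/
theorem OscConv.gain {J : Type*} [Fintype J] {φ : V → ℝ} (hφ : ContDiff ℝ ∞ φ) {v : J → V}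
    {ℓ : J → V →L[ℝ] ℝ} (hℓ : ∀ j, dirDeriv (v j) φ = ℓ j) {w : P → ℝ} {a b₀ : P → V → ℂ}
    {b : J → P → V → ℂ} (hab : ∀ p u, a p u = b₀ p u + ∑ j, (ℓ j u : ℂ) * b j p u)
    (c0 : ∀ p, Continuous (b₀ p)) (p0 : ∀ p, PolyBounded (b₀ p))
    (hb : ∀ j p, ContDiff ℝ ∞ (b j p)) (pb : ∀ j p, PolyBounded (b j p))
    (pb' : ∀ j p, PolyBounded (dirDeriv (v j) (b j p)))
    {I₀ : P → ℂ} {I₁ I₂ : J → P → ℂ} (h0 : OscConv φ w b₀ I₀)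
    (h1 : ∀ j, OscConv φ w (b j) (I₁ j))
    (h2 : ∀ j, OscConv φ w (fun p => dirDeriv (v j) (b j p)) (I₂ j)) :
    OscConv φ w a (fun p => I₀ p + ∑ j, Complex.I * I₂ j p) := by
  constructor
  · exact h0.isBigO.add (IsBigO.fun_sum fun j _ => (h2 j).isBigO.const_mul_left _)
  · intro χ
    -- Each `ℓ j * b j` is integrated by parts: it becomes `I` times the derivative of `b j` plus a
    -- term in which the derivative fell on `χ(ε·)`, which carries the factor `ε`.
    have key : ∀ q : P × Set.Ioc (0 : ℝ) 1,
        regInt φ χ q.2 (a q.1) - χ 0 * (I₀ q.1 + ∑ j, Complex.I * I₂ j q.1) =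
        (regInt φ χ q.2 (b₀ q.1) - χ 0 * I₀ q.1) +
        ∑ j, Complex.I * ((regInt φ χ q.2 (dirDeriv (v j) (b j q.1)) - χ 0 * I₂ j q.1) +
          ((q.2 : ℝ) : ℂ) * regInt φ (∂_{v j} χ) q.2 (b j q.1)) := by
      rintro ⟨p, ε, hε⟩
      have e1 : a p = fun u => b₀ p u + ∑ j, (ℓ j u : ℂ) * b j p u := funext (hab p)
      have c1 : ∀ j, Continuous fun u => (ℓ j u : ℂ) * b j p u := fun j =>
        (Complex.continuous_ofReal.comp (ℓ j).continuous).mul (hb j p).continuous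
      have q1 : ∀ j, PolyBounded fun u => (ℓ j u : ℂ) * b j p u := fun j =>
        (PolyBounded.of_linear (ℓ j)).mul (pb j p)
      simp only
      rw [e1, regInt_add hφ.continuous χ hε.1 (c0 p) (p0 p)
        (continuous_finsetSum _ fun j _ => c1 j) (PolyBounded.sum _ q1),
        regInt_sum _ hφ.continuous χ hε.1 c1 q1]
      have e2 : ∀ j, _ := fun j =>
        regInt_dirDeriv_phase_mul hφ (ℓ j) (hℓ j) χ hε.1 (hb j p) (pb j p) (pb' j p)
      simp only [e2]
      have e3 : ∀ j, Complex.I * ((regInt φ χ ε (dirDeriv (v j) (b j p)) - χ 0 * I₂ j p) +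
          (ε : ℂ) * regInt φ (∂_{v j} χ) ε (b j p)) =
          Complex.I * (regInt φ χ ε (dirDeriv (v j) (b j p)) +
          (ε : ℂ) * regInt φ (∂_{v j} χ) ε (b j p)) - χ 0 * (Complex.I * I₂ j p) := fun j => by
        ring
      simp only [e3, Finset.sum_sub_distrib, ← Finset.mul_sum]
      ring
    simp only [key]
    refine (h0.conv χ).add (IsBigO.fun_sum fun j _ => IsBigO.const_mul_left ?_ _)
    refine ((h2 j).conv χ).add ?_
    -- The factor `ε` is already explicit here, so for the cutoff `∂_{v j} χ` boundedness alone
    -- suffices.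
    refine IsBigO.mul ?_ ((h1 j).regInt_isBigO _)
    exact IsBigO.of_bound 1 (Eventually.of_forall fun q => by simp)

end OscGeneral

/-! ### Amplitudes on the space of `(X, (Y, Z))`. -/

section Amplitudes

variable {d : ℕ}

instance : (volume : Measure (Phase d)).IsAddHaarMeasure :=
  Measure.prod.instIsAddHaarMeasure (volume : Measure (Conf d)) (volume : Measure (Conf d))

instance : (volume : Measure (Phase d × Phase d)).IsAddHaarMeasure :=
  Measure.prod.instIsAddHaarMeasure (volume : Measure (Phase d)) (volume : Measure (Phase d))

/-- The space of the variables `(X, (Y, Z))`. -/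
abbrev AmpSpace (d : ℕ) : Type := Phase d × (Phase d × Phase d)

/-- Indices of the coordinates of `AmpSpace d`. -/
abbrev AmpIndex (d : ℕ) : Type := (Fin d ⊕ Fin d) ⊕ ((Fin d ⊕ Fin d) ⊕ (Fin d ⊕ Fin d))

/-- The coordinate directions of the space of `(Y, Z)`. -/
def pairDir : (Fin d ⊕ Fin d) ⊕ (Fin d ⊕ Fin d) → Phase d × Phase d := prodDir phaseDir phaseDir

/-- The coordinate directions of `AmpSpace d`. -/
def ampDir : AmpIndex d → AmpSpace d := prodDir phaseDir pairDir

/-- The coordinates of phase space. -/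
def phaseCoord : Fin d ⊕ Fin d → Phase d →L[ℝ] ℝ := prodCoord stdCoord stdCoord

theorem sum_phaseCoord (X : Phase d) : ∑ j, phaseCoord j X • phaseDir j = X :=
  sum_prodCoord sum_stdCoord sum_stdCoord X

/-- The cost `⟨y⟩²⟨z⟩²` of a derivative in one of the variables `x, y, z`. -/
def baseCost (u : AmpSpace d) : ℝ := (bracket u.2.1.1 * bracket u.2.2.1) ^ 2

/-- The cost of derivatives of amplitudes. -/
def ampCost : AmpIndex d → AmpSpace d → ℝ :=
  Sum.elim
    (Sum.elim (fun _ => baseCost)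
      (fun _ u => (bracket u.1.2)⁻¹ * (bracket u.2.1.2 * bracket u.2.2.2)))
    (Sum.elim (Sum.elim (fun _ => baseCost) (fun _ _ => 1))
      (Sum.elim (fun _ => baseCost) (fun _ _ => 1)))

/-- The weight `⟨y⟩^r₁ ⟨z⟩^r₂ ⟨η⟩^r₃ ⟨ζ⟩^r₄`. -/
def pairWeight (r₁ r₂ r₃ r₄ : ℝ) (Q : Phase d × Phase d) : ℝ :=
  bracket Q.1.1 ^ r₁ * bracket Q.2.1 ^ r₂ * bracket Q.1.2 ^ r₃ * bracket Q.2.2 ^ r₄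

/-- The weight `⟨ξ⟩^μ ⟨y⟩^r₁ ⟨z⟩^r₂ ⟨η⟩^r₃ ⟨ζ⟩^r₄`. -/
def ampWeight (μ r₁ r₂ r₃ r₄ : ℝ) (u : AmpSpace d) : ℝ :=
  bracket u.1.2 ^ μ * pairWeight r₁ r₂ r₃ r₄ u.2

theorem one_le_baseCost (u : AmpSpace d) : 1 ≤ baseCost u :=
  one_le_pow₀ (one_le_mul_of_one_le_of_one_le (one_le_bracket _) (one_le_bracket _))

theorem pairWeight_pos (r₁ r₂ r₃ r₄ : ℝ) (Q : Phase d × Phase d) :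
    0 < pairWeight r₁ r₂ r₃ r₄ Q := by
  unfold pairWeight
  have h := fun v : Conf d => bracket_pos v
  have h1 := Real.rpow_pos_of_pos (h Q.1.1) r₁
  have h2 := Real.rpow_pos_of_pos (h Q.2.1) r₂
  have h3 := Real.rpow_pos_of_pos (h Q.1.2) r₃
  have h4 := Real.rpow_pos_of_pos (h Q.2.2) r₄
  positivity

theorem ampWeight_pos (μ r₁ r₂ r₃ r₄ : ℝ) (u : AmpSpace d) : 0 < ampWeight μ r₁ r₂ r₃ r₄ u :=
  mul_pos (Real.rpow_pos_of_pos (bracket_pos _) _) (pairWeight_pos _ _ _ _ _)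

theorem continuous_bracket_rpow (r : ℝ) : Continuous fun v : Conf d => bracket v ^ r :=
  continuous_bracket.rpow_const fun v => Or.inl (bracket_pos v).ne'

theorem continuous_pairWeight (r₁ r₂ r₃ r₄ : ℝ) :
    Continuous (pairWeight r₁ r₂ r₃ r₄ : Phase d × Phase d → ℝ) := by
  unfold pairWeight
  have h := fun r => continuous_bracket_rpow (d := d) r
  exact (((h r₁).comp (by fun_prop)).mul ((h r₂).comp (by fun_prop))).mul
    ((h r₃).comp (by fun_prop)) |>.mul ((h r₄).comp (by fun_prop))

theorem pairWeight_le {r₁ r₂ r₃ r₄ s₁ s₂ s₃ s₄ : ℝ} (h₁ : r₁ ≤ s₁) (h₂ : r₂ ≤ s₂) (h₃ : r₃ ≤ s₃)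
    (h₄ : r₄ ≤ s₄) (Q : Phase d × Phase d) :
    pairWeight r₁ r₂ r₃ r₄ Q ≤ pairWeight s₁ s₂ s₃ s₄ Q := by
  unfold pairWeight
  have h := fun (v : Conf d) {r s : ℝ} (hrs : r ≤ s) =>
    Real.rpow_le_rpow_of_exponent_le (one_le_bracket v) hrs
  have h0 := fun (v : Conf d) (r : ℝ) => Real.rpow_nonneg (bracket_pos v).le r
  have i1 := mul_le_mul (h Q.1.1 h₁) (h Q.2.1 h₂) (h0 _ _) (h0 _ _)
  have i2 := mul_le_mul i1 (h Q.1.2 h₃) (h0 _ _) (mul_nonneg (h0 _ _) (h0 _ _))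
  exact mul_le_mul i2 (h Q.2.2 h₄) (h0 _ _) (mul_nonneg (mul_nonneg (h0 _ _) (h0 _ _)) (h0 _ _))

theorem ampWeight_isBigO (μ : ℝ) {r₁ r₂ r₃ r₄ s₁ s₂ s₃ s₄ : ℝ} (h₁ : r₁ ≤ s₁) (h₂ : r₂ ≤ s₂)
    (h₃ : r₃ ≤ s₃) (h₄ : r₄ ≤ s₄) : (ampWeight μ r₁ r₂ r₃ r₄ : AmpSpace d → ℝ) =O[⊤]
      ampWeight μ s₁ s₂ s₃ s₄ := by
  refine IsBigO.of_bound 1 (Eventually.of_forall fun u => ?_)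
  rw [Real.norm_of_nonneg (ampWeight_pos _ _ _ _ _ _).le,
    Real.norm_of_nonneg (ampWeight_pos _ _ _ _ _ _).le, one_mul]
  exact mul_le_mul_of_nonneg_left (pairWeight_le h₁ h₂ h₃ h₄ _)
    (Real.rpow_nonneg (bracket_pos _).le _)

theorem polyBounded_bracket_rpow {V : Type*} [NormedAddCommGroup V] {t : V → Conf d}
    (ht : ∀ v, ‖t v‖ ≤ ‖v‖) (r : ℝ) : PolyBounded fun v => ((bracket (t v) ^ r : ℝ) : ℂ) := by
  refine ⟨1, ⌈|r|⌉₊, fun v => ?_⟩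
  rw [Complex.norm_real, Real.norm_of_nonneg (Real.rpow_nonneg (bracket_pos _).le _), one_mul]
  calc bracket (t v) ^ r ≤ bracket (t v) ^ ((⌈|r|⌉₊ : ℕ) : ℝ) :=
        Real.rpow_le_rpow_of_exponent_le (one_le_bracket _)
          ((le_abs_self r).trans (Nat.le_ceil _))
    _ = bracket (t v) ^ ⌈|r|⌉₊ := Real.rpow_natCast _ _
    _ ≤ (1 + ‖v‖) ^ ⌈|r|⌉₊ := pow_le_pow_left₀ (bracket_pos _).le
        ((bracket_le_one_add_norm _).trans (by linarith [ht v])) _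

theorem polyBounded_pairWeight (r₁ r₂ r₃ r₄ : ℝ) :
    PolyBounded fun Q : Phase d × Phase d => (pairWeight r₁ r₂ r₃ r₄ Q : ℂ) := by
  unfold pairWeight
  simp only [Complex.ofReal_mul]
  refine (((polyBounded_bracket_rpow (t := fun Q : Phase d × Phase d => Q.1.1) ?_ r₁).mul
    (polyBounded_bracket_rpow (t := fun Q : Phase d × Phase d => Q.2.1) ?_ r₂)).mul
    (polyBounded_bracket_rpow (t := fun Q : Phase d × Phase d => Q.1.2) ?_ r₃)).mul
    (polyBounded_bracket_rpow (t := fun Q : Phase d × Phase d => Q.2.2) ?_ r₄)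
  · exact fun Q => (norm_fst_le Q.1).trans (norm_fst_le Q)
  · exact fun Q => (norm_fst_le Q.2).trans (norm_snd_le Q)
  · exact fun Q => (norm_snd_le Q.1).trans (norm_fst_le Q)
  · exact fun Q => (norm_snd_le Q.2).trans (norm_snd_le Q)

theorem integrable_bracket_rpow {r : ℝ} (hr : r < -d) :
    Integrable fun v : Conf d => bracket v ^ r := by
  have h1 : Integrable fun v : Conf d => 2 ^ (-r) * (1 + ‖v‖) ^ (-(-r)) :=
    (integrable_one_add_norm (by simpa using lt_neg_of_lt_neg hr)).const_mul _
  refine h1.mono' (continuous_bracket_rpow r).aestronglyMeasurable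
    (Eventually.of_forall fun v => ?_)
  have hb := bracket_pos v
  rw [Real.norm_of_nonneg (Real.rpow_nonneg hb.le _), neg_neg]
  have hr0 : r ≤ 0 := by
    have : (0 : ℝ) ≤ d := Nat.cast_nonneg d
    linarith
  have h2 := Real.rpow_le_rpow_of_nonpos (by positivity) (one_add_norm_le_two_mul_bracket v) hr0
  rw [Real.mul_rpow (by norm_num) hb.le] at h2
  have h3 := mul_le_mul_of_nonneg_left h2 (Real.rpow_nonneg (show (0 : ℝ) ≤ 2 by norm_num) (-r))
  rwa [← mul_assoc, ← Real.rpow_add (by norm_num), neg_add_cancel, Real.rpow_zero, one_mul] at h3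

theorem integrable_pairWeight {r : ℝ} (hr : r < -d) :
    Integrable (pairWeight r r r r : Phase d × Phase d → ℝ) := by
  have h := integrable_bracket_rpow hr
  have h2 : Integrable fun X : Phase d => bracket X.1 ^ r * bracket X.2 ^ r := h.mul_prod h
  refine (h2.mul_prod h2).congr (Eventually.of_forall fun Q => ?_)
  simp only [pairWeight]
  ring

/-- It lets the moment `‖Q‖` be absorbed by raising all four exponents by one. -/
theorem norm_le_pairWeight_one (Q : Phase d × Phase d) : ‖Q‖ ≤ pairWeight 1 1 1 1 Q := by
  simp only [pairWeight, Real.rpow_one]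
  have h1 := one_le_bracket Q.1.1
  have h2 := one_le_bracket Q.2.1
  have h3 := one_le_bracket Q.1.2
  have h4 := one_le_bracket Q.2.2
  have h12 := one_le_mul_of_one_le_of_one_le h1 h2
  have h123 := one_le_mul_of_one_le_of_one_le h12 h3
  have key : ∀ {a b : ℝ}, 1 ≤ a → 1 ≤ b → a ≤ a * b ∧ b ≤ a * b := fun ha hb =>
    ⟨le_mul_of_one_le_right (by linarith) hb, le_mul_of_one_le_left (by linarith) ha⟩
  rw [Prod.norm_def, Prod.norm_def, Prod.norm_def]
  refine max_le (max_le ?_ ?_) (max_le ?_ ?_) <;> refine (norm_le_bracket _).trans ?_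
  · exact (key h1 h2).1.trans ((key h12 h3).1.trans (key h123 h4).1)
  · exact (key h12 h3).2.trans (key h123 h4).1
  · exact (key h1 h2).2.trans ((key h12 h3).1.trans (key h123 h4).1)
  · exact (key h123 h4).2

theorem pairWeight_mul (r₁ r₂ r₃ r₄ s₁ s₂ s₃ s₄ : ℝ) (Q : Phase d × Phase d) :
    pairWeight r₁ r₂ r₃ r₄ Q * pairWeight s₁ s₂ s₃ s₄ Q =
      pairWeight (r₁ + s₁) (r₂ + s₂) (r₃ + s₃) (r₄ + s₄) Q := by
  simp only [pairWeight, Real.rpow_add (bracket_pos _)]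
  ring

theorem ampWeight_mul (μ ν r₁ r₂ r₃ r₄ s₁ s₂ s₃ s₄ : ℝ) (u : AmpSpace d) :
    ampWeight μ r₁ r₂ r₃ r₄ u * ampWeight ν s₁ s₂ s₃ s₄ u =
      ampWeight (μ + ν) (r₁ + s₁) (r₂ + s₂) (r₃ + s₃) (r₄ + s₄) u := by
  simp only [ampWeight, Real.rpow_add (bracket_pos _), ← pairWeight_mul]
  ring

theorem baseCost_eq (u : AmpSpace d) : baseCost u = ampWeight 0 2 2 0 0 u := by
  simp [ampWeight, pairWeight, baseCost, mul_pow]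

theorem contDiff_moyalPhase : ContDiff ℝ ∞ (moyalPhase (d := d)) := by
  unfold moyalPhase sympl
  exact contDiff_const.mul (((contDiff_snd.comp contDiff_fst).inner ℝ
    (contDiff_fst.comp contDiff_snd)).sub ((contDiff_snd.comp contDiff_snd).inner ℝ
    (contDiff_fst.comp contDiff_fst)))

/-- The projection `(Y, Z) ↦ y`. -/
def projY : Phase d × Phase d →L[ℝ] Conf d :=
  (ContinuousLinearMap.fst ℝ _ _).comp (ContinuousLinearMap.fst ℝ _ _)

/-- The projection `(Y, Z) ↦ η`. -/
def projEta : Phase d × Phase d →L[ℝ] Conf d :=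
  (ContinuousLinearMap.snd ℝ _ _).comp (ContinuousLinearMap.fst ℝ _ _)

/-- The projection `(Y, Z) ↦ z`. -/
def projZ : Phase d × Phase d →L[ℝ] Conf d :=
  (ContinuousLinearMap.fst ℝ _ _).comp (ContinuousLinearMap.snd ℝ _ _)

/-- The projection `(Y, Z) ↦ ζ`. -/
def projZeta : Phase d × Phase d →L[ℝ] Conf d :=
  (ContinuousLinearMap.snd ℝ _ _).comp (ContinuousLinearMap.snd ℝ _ _)

@[simp] theorem projY_apply (Q : Phase d × Phase d) : projY Q = Q.1.1 := rfl
@[simp] theorem projEta_apply (Q : Phase d × Phase d) : projEta Q = Q.1.2 := rfl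
@[simp] theorem projZ_apply (Q : Phase d × Phase d) : projZ Q = Q.2.1 := rfl
@[simp] theorem projZeta_apply (Q : Phase d × Phase d) : projZeta Q = Q.2.2 := rfl

theorem dirDeriv_moyalPhase (v Q : Phase d × Phase d) :
    dirDeriv v moyalPhase Q = -2 * (sympl Q.1 v.2 + sympl v.1 Q.2) := by
  have h := ((((projEta (d := d)).hasFDerivAt (x := Q)).inner ℝ (projZ.hasFDerivAt (x := Q))).sub
    ((projZeta.hasFDerivAt (x := Q)).inner ℝ (projY.hasFDerivAt (x := Q)))).const_mul (-2)
  have h6 : HasFDerivAt moyalPhase _ Q := h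
  rw [dirDeriv, h6.fderiv]
  simp [sympl]
  ring

/-- The linear form `σ t_k`, as a function on the space of `(Y, Z)`. -/
def scaledCoord (σ : ℝ) (t : Phase d × Phase d →L[ℝ] Conf d) (k : Fin d) :
    Phase d × Phase d →L[ℝ] ℝ := σ • (stdCoord k).comp t

theorem scaledCoord_apply (σ : ℝ) (t : Phase d × Phase d →L[ℝ] Conf d) (k : Fin d)
    (Q : Phase d × Phase d) : scaledCoord σ t k Q = σ * t Q k := rfl

/-- In this formula and the next three, differentiation along one variable produces its symplectic
partner: `y ↔ ζ`, `z ↔ η`. This decides which variable an integration by parts improves. -/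
theorem dirDeriv_moyalPhase_y (j : Fin d) :
    dirDeriv (pairDir (Sum.inl (Sum.inl j))) moyalPhase = scaledCoord 2 projZeta j := by
  funext Q
  rw [dirDeriv_moyalPhase, scaledCoord_apply]
  simp [sympl, pairDir, prodDir, phaseDir, stdVec, EuclideanSpace.inner_single_right]

theorem dirDeriv_moyalPhase_eta (j : Fin d) :
    dirDeriv (pairDir (Sum.inl (Sum.inr j))) moyalPhase = scaledCoord (-2) projZ j := by
  funext Q
  rw [dirDeriv_moyalPhase, scaledCoord_apply]
  simp [sympl, pairDir, prodDir, phaseDir, stdVec, EuclideanSpace.inner_single_left]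

theorem dirDeriv_moyalPhase_z (j : Fin d) :
    dirDeriv (pairDir (Sum.inr (Sum.inl j))) moyalPhase = scaledCoord (-2) projEta j := by
  funext Q
  rw [dirDeriv_moyalPhase, scaledCoord_apply]
  simp [sympl, pairDir, prodDir, phaseDir, stdVec, EuclideanSpace.inner_single_right]

theorem dirDeriv_moyalPhase_zeta (j : Fin d) :
    dirDeriv (pairDir (Sum.inr (Sum.inr j))) moyalPhase = scaledCoord 2 projY j := by
  funext Q
  rw [dirDeriv_moyalPhase, scaledCoord_apply]
  simp [sympl, pairDir, prodDir, phaseDir, stdVec, EuclideanSpace.inner_single_left]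

/-! ### Lowering the exponents by integration by parts. -/

section Gain

variable {ι : Type*} {σ : ℝ} {t : Phase d × Phase d →L[ℝ] Conf d}

theorem hasBounds_scaledCoord
    (ht : ∀ j, (fun _ : AmpSpace d => ‖t (ampDir j).2‖) =O[⊤] ampCost j) (k : Fin d) :
    HasBounds ampDir ampCost (fun u => bracket (t u.2))
      (fun (_ : ι) u => (scaledCoord σ t k u.2 : ℂ)) := by
  have hk : ∀ Q, ‖((scaledCoord σ t k Q : ℝ) : ℂ)‖ ≤ |σ| * ‖t Q‖ := fun Q => by
    rw [Complex.norm_real, scaledCoord_apply, norm_mul]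
    exact mul_le_mul_of_nonneg_left (PiLp.norm_apply_le (t Q) k) (abs_nonneg _)
  refine HasBounds.linear ((Complex.ofRealCLM.comp (scaledCoord σ t k)).comp
    (ContinuousLinearMap.snd ℝ (Phase d) (Phase d × Phase d))) ?_ fun j => ?_
  · refine IsBigO.of_bound |σ| (Eventually.of_forall fun u => (hk u.2).trans ?_)
    rw [Real.norm_of_nonneg (bracket_pos _).le]
    exact mul_le_mul_of_nonneg_left (norm_le_bracket _) (abs_nonneg _)
  · obtain ⟨C, hC⟩ := (ht j).bound
    refine IsBigO.of_bound (|σ| * C) (Eventually.of_forall fun u => (hk _).trans ?_)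
    rw [mul_assoc, norm_mul]
    refine mul_le_mul_of_nonneg_left ?_ (abs_nonneg _)
    have h1 := eventually_top.1 hC u
    rw [norm_norm] at h1
    refine h1.trans ?_
    rw [← mul_assoc]
    refine le_mul_of_one_le_right ((norm_nonneg _).trans h1) ?_
    rw [Real.norm_of_nonneg (bracket_pos _).le]
    exact one_le_bracket _

/-- The function `1 + σ²|t|²`. -/
def gainDenom (σ : ℝ) (t : Phase d × Phase d →L[ℝ] Conf d) (Q : Phase d × Phase d) : ℂ :=
  1 + ∑ k, (scaledCoord σ t k Q : ℂ) * (scaledCoord σ t k Q : ℂ)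

theorem gainDenom_eq (σ : ℝ) (t : Phase d × Phase d →L[ℝ] Conf d) (Q : Phase d × Phase d) :
    gainDenom σ t Q = ((1 + σ ^ 2 * ‖t Q‖ ^ 2 : ℝ) : ℂ) := by
  unfold gainDenom
  rw [EuclideanSpace.real_norm_sq_eq, Finset.mul_sum]
  push_cast
  congr 1
  refine Finset.sum_congr rfl fun k _ => ?_
  rw [scaledCoord_apply]
  push_cast
  ring

theorem gainDenom_ne_zero (σ : ℝ) (t : Phase d × Phase d →L[ℝ] Conf d) (Q : Phase d × Phase d) :
    gainDenom σ t Q ≠ 0 := by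
  rw [gainDenom_eq]
  exact_mod_cast (by positivity : (0 : ℝ) < 1 + σ ^ 2 * ‖t Q‖ ^ 2).ne'

/-- From `σ² ≥ 1` one has `1 + σ²|t|² ≥ ⟨t⟩²`, the lower bound required by `HasBounds.inv`. -/
theorem hasBounds_gainDenom_inv (hσ : 1 ≤ σ ^ 2)
    (ht : ∀ j, (fun _ : AmpSpace d => ‖t (ampDir j).2‖) =O[⊤] ampCost j) :
    HasBounds ampDir ampCost (fun u => (bracket (t u.2) * bracket (t u.2))⁻¹)
      (fun (_ : ι) u => (gainDenom σ t u.2)⁻¹) := by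
  refine HasBounds.inv ?_ (fun u => (mul_pos (bracket_pos _) (bracket_pos _)).ne')
    (fun _ u => gainDenom_ne_zero σ t u.2) ?_
  · refine HasBounds.add (HasBounds.const 1 ?_) (HasBounds.sum _ fun k =>
      (hasBounds_scaledCoord ht k).mul (hasBounds_scaledCoord ht k))
    refine IsBigO.of_bound 1 (Eventually.of_forall fun u => ?_)
    rw [norm_one, one_mul, Real.norm_of_nonneg (mul_pos (bracket_pos _) (bracket_pos _)).le]
    exact one_le_mul_of_one_le_of_one_le (one_le_bracket _) (one_le_bracket _)
  · refine IsBigO.of_bound 1 (Eventually.of_forall fun q => ?_)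
    have hb := bracket_pos (t q.2.2)
    rw [one_mul, norm_inv, norm_inv]
    refine inv_anti₀ (norm_pos_iff.2 (mul_pos hb hb).ne') ?_
    rw [gainDenom_eq, Complex.norm_real, Real.norm_of_nonneg (mul_pos hb hb).le,
      Real.norm_of_nonneg (by positivity), ← sq, bracket_sq]
    nlinarith [sq_nonneg ‖t q.2.2‖]

theorem dirDeriv_prodMk {F : AmpSpace d → ℂ} (hF : ContDiff ℝ ∞ F) (X : Phase d)
    (v : Phase d × Phase d) :
    dirDeriv v (fun Q => F (X, Q)) = fun Q => dirDeriv ((0, v) : AmpSpace d) F (X, Q) := by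
  funext Q
  have h1 := (hF.differentiable (by simp) (X, Q)).hasFDerivAt
  have h2 := h1.comp Q (hasFDerivAt_prodMk_right X Q)
  have h3 : fderiv ℝ (fun Q => F (X, Q)) Q = _ := h2.fderiv
  simp only [dirDeriv]
  rw [h3]
  rfl

theorem HasBounds.continuous_slice {w : AmpSpace d → ℝ} {A : ι → AmpSpace d → ℂ}
    (h : HasBounds ampDir ampCost w A) (i : ι) (X : Phase d) : Continuous fun Q => A i (X, Q) :=
  (h.smooth i).continuous.comp (by fun_prop)

theorem HasBounds.polyBounded_slice {μ r₁ r₂ r₃ r₄ : ℝ} {A : ι → AmpSpace d → ℂ}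
    (h : HasBounds ampDir ampCost (ampWeight μ r₁ r₂ r₃ r₄) A) (i : ι) (X : Phase d) :
    PolyBounded fun Q => A i (X, Q) := by
  obtain ⟨C, hC⟩ := h.isBigO.bound
  obtain ⟨D, k, hD⟩ := polyBounded_pairWeight (d := d) r₁ r₂ r₃ r₄
  refine ⟨|C| * (bracket X.2 ^ μ * D), k, fun Q => ?_⟩
  have h1 := eventually_top.1 hC (i, (X, Q))
  have h2 := hD Q
  have hp := pairWeight_pos r₁ r₂ r₃ r₄ Q
  have hb := Real.rpow_nonneg (bracket_pos X.2).le μ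
  rw [Complex.norm_real] at h2
  refine h1.trans ?_
  rw [mul_assoc, mul_assoc, ampWeight, norm_mul, Real.norm_of_nonneg hb]
  exact (mul_le_mul_of_nonneg_right (le_abs_self C) (by positivity)).trans
    (mul_le_mul_of_nonneg_left (mul_le_mul_of_nonneg_left h2 hb) (abs_nonneg _))

/-- Every family of amplitudes of the given orders has oscillatory integrals that are `O(⟨ξ⟩^μ)`,
uniformly in the family. -/
def AmpConverges (d : ℕ) (ι : Type*) (μ r₁ r₂ r₃ r₄ : ℝ) : Prop :=
  ∀ A : ι → AmpSpace d → ℂ, HasBounds ampDir ampCost (ampWeight μ r₁ r₂ r₃ r₄) A →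
    ∃ I : ι × Phase d → ℂ, OscConv moyalPhase (fun p : ι × Phase d => bracket p.2.2 ^ μ)
      (fun p Q => A p.1 (p.2, Q)) I

theorem AmpConverges.mono {μ r₁ r₂ r₃ r₄ s₁ s₂ s₃ s₄ : ℝ} (h : AmpConverges d ι μ s₁ s₂ s₃ s₄)
    (h₁ : r₁ ≤ s₁) (h₂ : r₂ ≤ s₂) (h₃ : r₃ ≤ s₃) (h₄ : r₄ ≤ s₄) :
    AmpConverges d ι μ r₁ r₂ r₃ r₄ :=
  fun A hA => h A (hA.mono (ampWeight_isBigO μ h₁ h₂ h₃ h₄))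

/-- The exponent `r + 1`, and not just `r`, has to be below `-d` because of the extra moment in
`OscConv.of_integrable`. -/
theorem ampConverges_of_lt {μ r : ℝ} (hr : r + 1 < -d) : AmpConverges d ι μ r r r r := by
  intro A hA
  refine ⟨_, OscConv.of_integrable contDiff_moyalPhase.continuous
    (fun p => hA.continuous_slice p.1 p.2) (integrable_pairWeight (d := d) (r := r) (by linarith))
    ?_ (hA.isBigO.comp_tendsto
      (k := fun q : (ι × Phase d) × (Phase d × Phase d) => (q.1.1, (q.1.2, q.2))) le_top)⟩
  refine (integrable_pairWeight (d := d) hr).mono'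
    (continuous_norm.mul (continuous_pairWeight _ _ _ _)).aestronglyMeasurable
    (Eventually.of_forall fun Q => ?_)
  have hp := pairWeight_pos r r r r Q
  rw [norm_mul, norm_norm, Real.norm_of_nonneg hp.le]
  refine (mul_le_mul_of_nonneg_right (norm_le_pairWeight_one Q) hp.le).trans (le_of_eq ?_)
  rw [pairWeight_mul, add_comm]

/-- With `ℓ_j = σ t_j` the derivatives of the phase and `D = 1 + ∑ ℓ_j²`, one has `A = A/D + ∑ ℓ_j
(ℓ_j A/D)`, the decomposition required by `OscConv.gain`. Here `A/D` and `ℓ_j A/D` are smaller than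
`A` by at least one power of `⟨t⟩`; the price is one derivative in the directions `n j`. -/
theorem AmpConverges.gain {μ r₁ r₂ r₃ r₄ s₁ s₂ s₃ s₄ : ℝ} (h : AmpConverges d ι μ s₁ s₂ s₃ s₄)
    (hσ : 1 ≤ σ ^ 2) (ht : ∀ j, (fun _ : AmpSpace d => ‖t (ampDir j).2‖) =O[⊤] ampCost j)
    (n : Fin d → (Fin d ⊕ Fin d) ⊕ (Fin d ⊕ Fin d))
    (hn : ∀ j, dirDeriv (pairDir (n j)) moyalPhase = scaledCoord σ t j)
    (h0 : (fun u => ampWeight μ r₁ r₂ r₃ r₄ u * (bracket (t u.2))⁻¹) =O[⊤]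
      (ampWeight μ s₁ s₂ s₃ s₄ : AmpSpace d → ℝ))
    (h1 : ∀ j, (fun u => ampCost (Sum.inr (n j)) u *
      (ampWeight μ r₁ r₂ r₃ r₄ u * (bracket (t u.2))⁻¹)) =O[⊤]
      (ampWeight μ s₁ s₂ s₃ s₄ : AmpSpace d → ℝ)) :
    AmpConverges d ι μ r₁ r₂ r₃ r₄ := by
  intro A hA
  have hc := hasBounds_gainDenom_inv (ι := ι) hσ ht
  -- The quotient gains `⟨t⟩⁻²`; one power is given up so that it shares the weight of the other
  -- terms.
  have hB : HasBounds ampDir ampCost (fun u => ampWeight μ r₁ r₂ r₃ r₄ u * (bracket (t u.2))⁻¹)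
      (fun i u => (gainDenom σ t u.2)⁻¹ * A i u) := by
    refine (hc.mul hA).mono (IsBigO.of_bound 1 (Eventually.of_forall fun u => ?_))
    have hb := bracket_pos (t u.2)
    have hw := ampWeight_pos μ r₁ r₂ r₃ r₄ u
    rw [one_mul, Real.norm_of_nonneg (by positivity), Real.norm_of_nonneg (by positivity),
      mul_comm]
    refine mul_le_mul_of_nonneg_left (inv_anti₀ hb ?_) hw.le
    exact le_mul_of_one_le_right hb.le (one_le_bracket _)
  have hBj : ∀ j, HasBounds ampDir ampCost
      (fun u => ampWeight μ r₁ r₂ r₃ r₄ u * (bracket (t u.2))⁻¹)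
      (fun i u => (scaledCoord σ t j u.2 : ℂ) * ((gainDenom σ t u.2)⁻¹ * A i u)) := fun j => by
    have := (hasBounds_scaledCoord (ι := ι) (σ := σ) ht j).mul (hc.mul hA)
    convert this using 2 with u
    have hb := (bracket_pos (t u.2)).ne'
    field_simp
  obtain ⟨I₀, hI₀⟩ := h _ (hB.mono h0)
  choose I₁ hI₁ using fun j => h _ ((hBj j).mono h0)
  choose I₂ hI₂ using fun j => h _ (((hBj j).dirDeriv (Sum.inr (n j))).mono (h1 j))
  have hd : ∀ j (p : ι × Phase d), dirDeriv (pairDir (n j)) (fun Q => (scaledCoord σ t j Q : ℂ) *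
      ((gainDenom σ t Q)⁻¹ * A p.1 (p.2, Q))) = _ := fun j p =>
    dirDeriv_prodMk ((hBj j).smooth p.1) p.2 (pairDir (n j))
  have hbs : ∀ j (p : ι × Phase d), ContDiff ℝ ∞ fun Q : Phase d × Phase d =>
      (scaledCoord σ t j Q : ℂ) * ((gainDenom σ t Q)⁻¹ * A p.1 (p.2, Q)) := fun j p =>
    ((hBj j).smooth p.1).comp (contDiff_prodMk_right p.2)
  have hbp : ∀ j (p : ι × Phase d), PolyBounded fun Q : Phase d × Phase d =>
      (scaledCoord σ t j Q : ℂ) * ((gainDenom σ t Q)⁻¹ * A p.1 (p.2, Q)) := fun j p =>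
    ((hBj j).mono h0).polyBounded_slice p.1 p.2
  refine ⟨_, OscConv.gain (b := fun j p Q => (scaledCoord σ t j Q : ℂ) *
      ((gainDenom σ t Q)⁻¹ * A p.1 (p.2, Q))) contDiff_moyalPhase hn (fun p Q => ?_)
    (fun p => (hB.mono h0).continuous_slice p.1 p.2)
    (fun p => (hB.mono h0).polyBounded_slice p.1 p.2)
    hbs hbp
    (fun j p => ?_) hI₀ hI₁ (I₂ := I₂) (fun j => ?_)⟩
  · have h0 := gainDenom_ne_zero σ t Q
    have e1 : ∀ c : ℂ, c + ∑ j, (scaledCoord σ t j Q : ℂ) * ((scaledCoord σ t j Q : ℂ) * c) =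
        gainDenom σ t Q * c := fun c => by
      rw [gainDenom, add_mul, one_mul, Finset.sum_mul]
      simp only [mul_assoc]
    refine Eq.trans ?_ (e1 _).symm
    rw [← mul_assoc, mul_inv_cancel₀ h0, one_mul]
  · have := ((((hBj j).dirDeriv (Sum.inr (n j))).mono (h1 j)).polyBounded_slice p.1 p.2)
    exact (congrArg PolyBounded (hd j p)).mpr this
  · have := hI₂ j
    convert this using 2 with p
    exact hd j p

theorem isBigO_const_of_one_le {κ : AmpSpace d → ℝ} (h : ∀ u, 1 ≤ κ u) (c : ℝ) :
    (fun _ : AmpSpace d => c) =O[⊤] κ := by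
  refine IsBigO.of_bound |c| (Eventually.of_forall fun u => ?_)
  rw [Real.norm_of_nonneg (zero_le_one.trans (h u)), Real.norm_eq_abs]
  exact le_mul_of_one_le_right (abs_nonneg c) (h u)

theorem isBigO_norm_apply_ampDir (t : Phase d × Phase d →L[ℝ] Conf d) (j : AmpIndex d) :
    (fun _ : AmpSpace d => ‖t (ampDir j).2‖) =O[⊤] ampCost j := by
  rcases j with (j | j) | ((j | j) | (j | j))
  · exact isBigO_const_of_one_le one_le_baseCost _
  · have h : t (ampDir (Sum.inl (Sum.inr j))).2 = 0 := map_zero t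
    rw [h, norm_zero]
    exact isBigO_zero (E' := ℝ) _ _
  · exact isBigO_const_of_one_le one_le_baseCost _
  · exact isBigO_const_of_one_le (fun _ => le_rfl) _
  · exact isBigO_const_of_one_le one_le_baseCost _
  · exact isBigO_const_of_one_le (fun _ => le_rfl) _

/-- The integration by parts is in `ζ`, where derivatives cost `1`, so the gain is free; `gain_z` is
the same with `η`. -/
theorem AmpConverges.gain_y {μ r₁ r₂ r₃ r₄ : ℝ} (h : AmpConverges d ι μ (r₁ - 1) r₂ r₃ r₄) :
    AmpConverges d ι μ r₁ r₂ r₃ r₄ := by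
  have e : (fun u : AmpSpace d => ampWeight μ r₁ r₂ r₃ r₄ u * (bracket (projY u.2))⁻¹) =
      ampWeight μ (r₁ - 1) r₂ r₃ r₄ := by
    funext u
    simp only [ampWeight, pairWeight, projY_apply, Real.rpow_sub_one (bracket_pos _).ne']
    ring
  refine h.gain (σ := 2) (by norm_num) (isBigO_norm_apply_ampDir _) (fun j => Sum.inr (Sum.inr j))
    dirDeriv_moyalPhase_zeta (e ▸ isBigO_refl _ _) fun j => ?_
  simp only [ampCost, Sum.elim_inr, one_mul]
  exact e ▸ isBigO_refl _ _

theorem AmpConverges.gain_z {μ r₁ r₂ r₃ r₄ : ℝ} (h : AmpConverges d ι μ r₁ (r₂ - 1) r₃ r₄) :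
    AmpConverges d ι μ r₁ r₂ r₃ r₄ := by
  have e : (fun u : AmpSpace d => ampWeight μ r₁ r₂ r₃ r₄ u * (bracket (projZ u.2))⁻¹) =
      ampWeight μ r₁ (r₂ - 1) r₃ r₄ := by
    funext u
    simp only [ampWeight, pairWeight, projZ_apply, Real.rpow_sub_one (bracket_pos _).ne']
    ring
  refine h.gain (σ := -2) (by norm_num) (isBigO_norm_apply_ampDir _) (fun j => Sum.inl (Sum.inr j))
    dirDeriv_moyalPhase_eta (e ▸ isBigO_refl _ _) fun j => ?_
  simp only [ampCost, Sum.elim_inr, Sum.elim_inl, one_mul]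
  exact e ▸ isBigO_refl _ _

theorem isBigO_baseCost_mul (w : AmpSpace d → ℝ) : w =O[⊤] fun u => baseCost u * w u := by
  simpa using (isBigO_const_of_one_le one_le_baseCost 1).mul (isBigO_refl w ⊤)

theorem baseCost_mul_ampWeight (μ r₁ r₂ r₃ r₄ : ℝ) (u : AmpSpace d) :
    baseCost u * ampWeight μ r₁ r₂ r₃ r₄ u = ampWeight μ (r₁ + 2) (r₂ + 2) r₃ r₄ u := by
  rw [baseCost_eq, ampWeight_mul]
  simp only [zero_add, add_comm (2 : ℝ)]

/-- The integration by parts is in `z`, where a derivative costs `⟨y⟩²⟨z⟩²`; hence the shift by `2`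
of the first two exponents. -/
theorem AmpConverges.gain_eta {μ r₁ r₂ r₃ r₄ : ℝ}
    (h : AmpConverges d ι μ (r₁ + 2) (r₂ + 2) (r₃ - 1) r₄) : AmpConverges d ι μ r₁ r₂ r₃ r₄ := by
  have e : (fun u : AmpSpace d => baseCost u * (ampWeight μ r₁ r₂ r₃ r₄ u *
      (bracket (projEta u.2))⁻¹)) = ampWeight μ (r₁ + 2) (r₂ + 2) (r₃ - 1) r₄ := by
    funext u
    rw [← mul_assoc, baseCost_mul_ampWeight]
    simp only [ampWeight, pairWeight, projEta_apply, Real.rpow_sub_one (bracket_pos _).ne']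
    ring
  refine h.gain (σ := -2) (by norm_num) (isBigO_norm_apply_ampDir _) (fun j => Sum.inr (Sum.inl j))
    dirDeriv_moyalPhase_z (e ▸ isBigO_baseCost_mul _) fun j => ?_
  simp only [ampCost, Sum.elim_inr, Sum.elim_inl]
  exact e ▸ isBigO_refl _ _

theorem AmpConverges.gain_zeta {μ r₁ r₂ r₃ r₄ : ℝ}
    (h : AmpConverges d ι μ (r₁ + 2) (r₂ + 2) r₃ (r₄ - 1)) : AmpConverges d ι μ r₁ r₂ r₃ r₄ := by
  have e : (fun u : AmpSpace d => baseCost u * (ampWeight μ r₁ r₂ r₃ r₄ u *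
      (bracket (projZeta u.2))⁻¹)) = ampWeight μ (r₁ + 2) (r₂ + 2) r₃ (r₄ - 1) := by
    funext u
    rw [← mul_assoc, baseCost_mul_ampWeight]
    simp only [ampWeight, pairWeight, projZeta_apply, Real.rpow_sub_one (bracket_pos _).ne']
    ring
  refine h.gain (σ := 2) (by norm_num) (isBigO_norm_apply_ampDir _) (fun j => Sum.inl (Sum.inl j))
    dirDeriv_moyalPhase_y (e ▸ isBigO_baseCost_mul _) fun j => ?_
  simp only [ampCost, Sum.elim_inr, Sum.elim_inl]
  exact e ▸ isBigO_refl _ _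

/-- Decay in `η, ζ` is bought first, with uncontrolled growth in `y, z`; that growth is then removed
for free. The proof runs backwards from the integrable case, so `h1` raises the exponents of `y, z`
before `h2` raises those of `η, ζ`. -/
theorem ampConverges (μ r₁ r₂ r₃ r₄ : ℝ) : AmpConverges d ι μ r₁ r₂ r₃ r₄ := by
  -- Chosen so that `D + 1 = -d - 1 < -d`.
  set D : ℝ := -(d + 2) with hD
  have h0 : AmpConverges d ι μ D D D D := ampConverges_of_lt (by rw [hD]; linarith)
  have h1 : ∀ (n : ℕ) (r₁ r₂ : ℝ), r₁ ≤ D + n → r₂ ≤ D + n → AmpConverges d ι μ r₁ r₂ D D := by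
    intro n
    induction n with
    | zero =>
      intro r₁ r₂ h₁ h₂
      exact h0.mono (by simpa using h₁) (by simpa using h₂) le_rfl le_rfl
    | succ n ih =>
      intro r₁ r₂ h₁ h₂
      push_cast at h₁ h₂
      exact (ih (r₁ - 1) (r₂ - 1) (by linarith) (by linarith)).gain_y.gain_z
  -- The exponents `r₁, r₂` stay quantified inside the induction, since each step raises both by
  -- `4`.
  have h2 : ∀ (n : ℕ) (r₁ r₂ r₃ r₄ : ℝ), r₃ ≤ D + n → r₄ ≤ D + n →
      AmpConverges d ι μ r₁ r₂ r₃ r₄ := by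
    intro n
    induction n with
    | zero =>
      intro r₁ r₂ r₃ r₄ h₃ h₄
      obtain ⟨k, hk⟩ := exists_nat_ge (max r₁ r₂ - D)
      have h₁ := le_max_left r₁ r₂
      have h₂ := le_max_right r₁ r₂
      exact (h1 k r₁ r₂ (by linarith) (by linarith)).mono le_rfl le_rfl (by simpa using h₃)
        (by simpa using h₄)
    | succ n ih =>
      intro r₁ r₂ r₃ r₄ h₃ h₄
      push_cast at h₃ h₄
      exact AmpConverges.gain_zeta (AmpConverges.gain_eta
        (ih _ _ (r₃ - 1) (r₄ - 1) (by linarith) (by linarith)))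
  obtain ⟨k, hk⟩ := exists_nat_ge (max r₃ r₄ - D)
  have h₃ := le_max_left r₃ r₄
  have h₄ := le_max_right r₃ r₄
  exact h2 k r₁ r₂ r₃ r₄ (by linarith) (by linarith)

end Gain

end Amplitudes

/-! ### Differentiation under the integral sign. -/

theorem smul_smulRight {H : Type*} [NormedAddCommGroup H] [NormedSpace ℝ H] (c z : ℂ)
    (f : H →L[ℝ] ℝ) : c • f.smulRight z = f.smulRight (c * z) := by
  ext v
  simp only [smul_apply, ContinuousLinearMap.smulRight_apply, smul_eq_mul]
  exact mul_smul_comm _ _ _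

/-- The derivative remains a finite sum over directions of fixed linear maps applied to integrals,
so the domination is checked one direction at a time. -/
theorem hasFDerivAt_integral_sum_clm {H E α J : Type*} [NormedAddCommGroup H] [NormedSpace ℝ H]
    [NormedAddCommGroup E] [NormedSpace ℝ E] [CompleteSpace E]
    [MeasurableSpace α] {ν : Measure α} [Fintype J] (T : J → E →L[ℝ] (H →L[ℝ] E)) {F : H → α → E}
    {D : J → H → α → E} {bound : J → α → ℝ} {s : Set H} {x₀ : H} (hs : s ∈ 𝓝 x₀)
    (hF : ∀ x, Integrable (F x) ν) (hD : ∀ j, Integrable (D j x₀) ν)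
    (hb : ∀ j, Integrable (bound j) ν) (hle : ∀ j t, ∀ x ∈ s, ‖D j x t‖ ≤ bound j t)
    (hd : ∀ t x, HasFDerivAt (fun x => F x t) (∑ j, T j (D j x t)) x) :
    HasFDerivAt (fun x => ∫ t, F x t ∂ν) (∑ j, T j (∫ t, D j x₀ t ∂ν)) x₀ := by
  have hD' : ∀ j ∈ Finset.univ, Integrable (fun t => T j (D j x₀ t)) ν :=
    fun j _ => (T j).integrable_comp (hD j)
  have h1 : ∑ j, T j (∫ t, D j x₀ t ∂ν) = ∫ t, ∑ j, T j (D j x₀ t) ∂ν := by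
    rw [integral_finsetSum _ hD']
    exact Finset.sum_congr rfl fun j _ => ((T j).integral_comp_comm (hD j)).symm
  rw [h1]
  refine hasFDerivAt_integral_of_dominated_of_fderiv_le (s := s)
    (bound := fun t => ∑ j, ‖T j‖ * bound j t)
    (F' := fun x t => ∑ j, T j (D j x t)) hs
    (Eventually.of_forall fun x => (hF x).aestronglyMeasurable) (hF x₀)
    (Finset.aestronglyMeasurable_fun_sum _ fun j hj => (hD' j hj).aestronglyMeasurable)
    (Eventually.of_forall fun t x hx => (norm_sum_le _ _).trans (Finset.sum_le_sum fun j _ => ?_))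
    (integrable_finsetSum _ fun j _ => (hb j).const_mul _)
    (Eventually.of_forall fun t x _ => hd t x)
  exact ((T j).le_opNorm _).trans (mul_le_mul_of_nonneg_left (hle j t x hx) (norm_nonneg _))

/-! ### Oscillatory integrals of amplitudes are symbols. -/

section OscOfAmplitude

variable {d : ℕ} {ι : Type*} {μ r₁ r₂ r₃ r₄ : ℝ} {A : ι → AmpSpace d → ℂ}

/-- The oscillatory integral of an amplitude in the variables `(Y, Z)`. -/
def ampOsc (A : AmpSpace d → ℂ) (X : Phase d) : ℂ := oscIntegral moyalPhase fun Q => A (X, Q)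

theorem HasBounds.exists_hasOscIntegral
    (h : HasBounds ampDir ampCost (ampWeight μ r₁ r₂ r₃ r₄) A) (i : ι) (X : Phase d) :
    ∃ I, HasOscIntegral moyalPhase (fun Q => A i (X, Q)) I := by
  obtain ⟨I, hI⟩ := ampConverges μ r₁ r₂ r₃ r₄ A h
  exact ⟨I (i, X), hI.hasOscIntegral (p := (i, X)) contDiff_moyalPhase.continuous
    (h.continuous_slice i X) (h.polyBounded_slice i X)⟩

theorem HasBounds.oscConv (h : HasBounds ampDir ampCost (ampWeight μ r₁ r₂ r₃ r₄) A) :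
    OscConv moyalPhase (fun p : ι × Phase d => bracket p.2.2 ^ μ) (fun p Q => A p.1 (p.2, Q))
      (fun p => ampOsc (A p.1) p.2) := by
  obtain ⟨I, hI⟩ := ampConverges μ r₁ r₂ r₃ r₄ A h
  have : (fun p => ampOsc (A p.1) p.2) = I := funext fun p =>
    (hI.hasOscIntegral contDiff_moyalPhase.continuous
      (h.continuous_slice p.1 p.2) (h.polyBounded_slice p.1 p.2)).oscIntegral_eq
  rwa [this]

theorem exists_bracket_rpow_le_on_ball (μ : ℝ) (X₀ : Phase d) :
    ∃ K, ∀ X ∈ Metric.ball X₀ 1, bracket X.2 ^ μ ≤ K := by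
  obtain ⟨K, hK⟩ := (isCompact_closedBall X₀ 1).exists_bound_of_continuousOn
    ((continuous_bracket_rpow μ).comp continuous_snd).continuousOn
  exact ⟨K, fun X hX => (le_abs_self _).trans (hK X (Metric.ball_subset_closedBall hX))⟩

theorem HasBounds.dirDeriv_inl_inl (h : HasBounds ampDir ampCost (ampWeight μ r₁ r₂ r₃ r₄) A)
    (j : Fin d) : HasBounds ampDir ampCost (ampWeight μ (r₁ + 2) (r₂ + 2) r₃ r₄)
      (fun i => MagneticWeyl.dirDeriv (ampDir (Sum.inl (Sum.inl j))) (A i)) := by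
  have := h.dirDeriv (Sum.inl (Sum.inl j))
  simpa only [ampCost, Sum.elim_inl, baseCost_mul_ampWeight] using this

/-- The order drops by one, as a symbol estimate demands; the higher powers of `⟨η⟩` and `⟨ζ⟩` are
harmless because `ampConverges` admits all exponents. -/
theorem HasBounds.dirDeriv_inl_inr (h : HasBounds ampDir ampCost (ampWeight μ r₁ r₂ r₃ r₄) A)
    (j : Fin d) : HasBounds ampDir ampCost (ampWeight (μ - 1) r₁ r₂ (r₃ + 1) (r₄ + 1))
      (fun i => MagneticWeyl.dirDeriv (ampDir (Sum.inl (Sum.inr j))) (A i)) := by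
  have := h.dirDeriv (Sum.inl (Sum.inr j))
  convert this using 2 with u
  simp only [ampCost, Sum.elim_inl, Sum.elim_inr, ampWeight, pairWeight,
    Real.rpow_sub_one (bracket_pos _).ne', Real.rpow_add_one (bracket_pos _).ne']
  ring

theorem HasBounds.dirDeriv_inl (h : HasBounds ampDir ampCost (ampWeight μ r₁ r₂ r₃ r₄) A)
    (j : Fin d ⊕ Fin d) : ∃ ν s₁ s₂ s₃ s₄, HasBounds ampDir ampCost (ampWeight ν s₁ s₂ s₃ s₄)
      (fun i => MagneticWeyl.dirDeriv (ampDir (Sum.inl j)) (A i)) := by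
  rcases j with j | j
  · exact ⟨_, _, _, _, _, h.dirDeriv_inl_inl j⟩
  · exact ⟨_, _, _, _, _, h.dirDeriv_inl_inr j⟩

theorem dirDeriv_slice {F : AmpSpace d → ℂ} (hF : ContDiff ℝ ∞ F) (j : Fin d ⊕ Fin d)
    (Q : Phase d × Phase d) :
    dirDeriv (phaseDir j) (fun X => F (X, Q)) = fun X => dirDeriv (ampDir (Sum.inl j)) F (X, Q) := by
  funext X
  have h1 := (hF.differentiable (by simp) (X, Q)).hasFDerivAt
  have h2 := HasFDerivAt.comp (f := fun X : Phase d => (X, Q)) X h1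
    (hasFDerivAt_prodMk_left (𝕜 := ℝ) X Q)
  have h3 : fderiv ℝ (fun X => F (X, Q)) X = _ := h2.fderiv
  simp only [dirDeriv]
  rw [h3]
  rfl

/-- For fixed `ε` the cutoff makes everything integrable; a dominating function exists because
`⟨ξ⟩^ν` is bounded on a ball around `X₀`. -/
theorem hasFDerivAt_regInt {a : AmpSpace d → ℂ}
    (h : HasBounds ampDir ampCost (ampWeight μ r₁ r₂ r₃ r₄) (fun _ : Unit => a))
    (χ : 𝓢(Phase d × Phase d, ℂ)) {ε : ℝ} (hε : 0 < ε) (X₀ : Phase d) :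
    HasFDerivAt (fun X => regInt moyalPhase χ ε fun Q => a (X, Q))
      (∑ j, (phaseCoord j).smulRight
        (regInt moyalPhase χ ε fun Q => dirDeriv (ampDir (Sum.inl j)) a (X₀, Q))) X₀ := by
  have hs : ContDiff ℝ ∞ a := h.smooth ()
  set e : Phase d × Phase d → ℂ := fun Q =>
    χ (ε • Q) * Complex.exp (Complex.I * (moyalPhase Q : ℂ)) with he
  have hreg : ∀ b, regInt moyalPhase χ ε b = ∫ Q, e Q * b Q := fun b => rfl
  have hint : ∀ {b : Phase d × Phase d → ℂ}, Continuous b → PolyBounded b →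
      Integrable fun Q => e Q * b Q := fun hb pb =>
    integrable_regularized contDiff_moyalPhase.continuous χ hε hb pb
  clear_value e
  have hda : ∀ j, ∃ ν s₁ s₂ s₃ s₄, HasBounds ampDir ampCost (ampWeight ν s₁ s₂ s₃ s₄)
    (fun _ : Unit => dirDeriv (ampDir (Sum.inl j)) a) := h.dirDeriv_inl
  have hdint : ∀ j X, Integrable fun Q => e Q * dirDeriv (ampDir (Sum.inl j)) a (X, Q) := by
    intro j X
    obtain ⟨ν, s₁, s₂, s₃, s₄, hj⟩ := hda j
    exact hint (hj.continuous_slice () X) (hj.polyBounded_slice () X)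
  have hbd : ∀ j : Fin d ⊕ Fin d, ∃ (C : ℝ) (w : Phase d × Phase d → ℝ),
      Integrable (fun Q => C * ‖e Q * (w Q : ℂ)‖) ∧
      ∀ Q, ∀ X ∈ Metric.ball X₀ 1,
        ‖e Q * dirDeriv (ampDir (Sum.inl j)) a (X, Q)‖ ≤ C * ‖e Q * (w Q : ℂ)‖ := by
    intro j
    obtain ⟨ν, s₁, s₂, s₃, s₄, hj⟩ := hda j
    obtain ⟨C, hC⟩ := hj.isBigO.bound
    obtain ⟨K, hK⟩ := exists_bracket_rpow_le_on_ball ν X₀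
    refine ⟨|C| * K, pairWeight s₁ s₂ s₃ s₄, ?_, fun Q X hX => ?_⟩
    · exact (hint (Complex.continuous_ofReal.comp (continuous_pairWeight s₁ s₂ s₃ s₄))
        (polyBounded_pairWeight _ _ _ _)).norm.const_mul _
    · have h1 := eventually_top.1 hC ((), (X, Q))
      have hp := pairWeight_pos s₁ s₂ s₃ s₄ Q
      have hb := Real.rpow_nonneg (bracket_pos X.2).le ν
      simp only [ampWeight, norm_mul, Real.norm_of_nonneg hp.le, Real.norm_of_nonneg hb] at h1
      rw [norm_mul, norm_mul, Complex.norm_real, Real.norm_of_nonneg hp.le]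
      calc ‖e Q‖ * ‖dirDeriv (ampDir (Sum.inl j)) a (X, Q)‖
          ≤ ‖e Q‖ * (|C| * (K * pairWeight s₁ s₂ s₃ s₄ Q)) := by
            refine mul_le_mul_of_nonneg_left (h1.trans ?_) (norm_nonneg _)
            exact mul_le_mul (le_abs_self C) (mul_le_mul_of_nonneg_right (hK X hX) hp.le)
              (by positivity) (abs_nonneg C)
        _ = _ := by ring
  choose C w hw hb using hbd
  simp only [hreg]
  refine hasFDerivAt_integral_sum_clm
    (fun j => ContinuousLinearMap.smulRightL ℝ (Phase d) ℂ (phaseCoord j)) (Metric.ball_mem_nhds X₀ one_pos)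
    (fun X => hint (h.continuous_slice () X) (h.polyBounded_slice () X))
    (fun j => hdint j X₀) hw (fun j Q X hX => hb j Q X hX) fun Q X => ?_
  have hsl : ContDiff ℝ ∞ fun X => a (X, Q) := hs.comp (contDiff_prodMk_left Q)
  refine (((hsl.differentiable (by simp) X).hasFDerivAt).const_mul (e Q)).congr_fderiv ?_
  rw [fderiv_eq_sum_dirDeriv phaseCoord sum_phaseCoord, Finset.smul_sum]
  refine Finset.sum_congr rfl fun j _ => ?_
  rw [dirDeriv_slice hs]
  exact smul_smulRight _ _ _

/-- The regularized integrals and their derivatives converge uniformly on a ball with rate `ε`, by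
`HasBounds.oscConv`, so the limit may be differentiated. -/
theorem hasFDerivAt_ampOsc {a : AmpSpace d → ℂ}
    (h : HasBounds ampDir ampCost (ampWeight μ r₁ r₂ r₃ r₄) (fun _ : Unit => a)) (X₀ : Phase d) :
    HasFDerivAt (ampOsc a) (∑ j, (phaseCoord j).smulRight
      (ampOsc (dirDeriv (ampDir (Sum.inl j)) a) X₀)) X₀ := by
  obtain ⟨χ, hχ⟩ := exists_schwartz_apply_zero (V := Phase d × Phase d)
  let ε : ℕ → ℝ := fun n => 1 / ((n : ℝ) + 1)
  have hε : ∀ n, 0 < ε n := fun n => Nat.one_div_pos_of_nat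
  have hε1 : ∀ n, ε n ≤ 1 := fun n => by
    simp only [ε]
    rw [div_le_one (by positivity)]
    linarith [(Nat.cast_nonneg n : (0 : ℝ) ≤ n)]
  have hε0 : Tendsto ε atTop (𝓝 0) := tendsto_one_div_add_atTop_nhds_zero_nat
  have hconv : ∀ {b : AmpSpace d → ℂ} {ν s₁ s₂ s₃ s₄ : ℝ},
      HasBounds ampDir ampCost (ampWeight ν s₁ s₂ s₃ s₄) (fun _ : Unit => b) →
      ∃ K, ∀ n, ∀ X ∈ Metric.ball X₀ 1,
        ‖regInt moyalPhase χ (ε n) (fun Q => b (X, Q)) - ampOsc b X‖ ≤ K * ε n := by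
    intro b ν s₁ s₂ s₃ s₄ hb
    obtain ⟨C, hC⟩ := (hb.oscConv.conv χ).bound
    obtain ⟨K, hK⟩ := exists_bracket_rpow_le_on_ball ν X₀
    refine ⟨|C| * K, fun n X hX => ?_⟩
    have h1 := eventually_top.1 hC (((), X), ⟨ε n, hε n, hε1 n⟩)
    have hbr := Real.rpow_nonneg (bracket_pos X.2).le ν
    simp only [hχ, one_mul, norm_mul, Real.norm_of_nonneg (hε n).le, Real.norm_of_nonneg hbr] at h1
    refine h1.trans ((mul_le_mul (le_abs_self C) (mul_le_mul_of_nonneg_left (hK X hX) (hε n).le)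
      (mul_nonneg (hε n).le hbr) (abs_nonneg C)).trans (le_of_eq ?_))
    ring
  have hder : ∀ j, ∃ K, ∀ n, ∀ X ∈ Metric.ball X₀ 1,
      ‖regInt moyalPhase χ (ε n) (fun Q => dirDeriv (ampDir (Sum.inl j)) a (X, Q)) -
        ampOsc (dirDeriv (ampDir (Sum.inl j)) a) X‖ ≤ K * ε n := fun j => by
    obtain ⟨ν, s₁, s₂, s₃, s₄, hj⟩ := h.dirDeriv_inl j
    exact hconv hj
  choose K hK using hder
  have hlim : ∀ c : ℝ, Tendsto (fun n => c * ε n) atTop (𝓝 0) := fun c => by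
    simpa using hε0.const_mul c
  refine hasFDerivAt_of_tendstoUniformlyOn (l := atTop) (s := Metric.ball X₀ 1)
    (f := fun n X => regInt moyalPhase χ (ε n) fun Q => a (X, Q))
    (f' := fun n X => ∑ j, (phaseCoord j).smulRight
      (regInt moyalPhase χ (ε n) fun Q => dirDeriv (ampDir (Sum.inl j)) a (X, Q)))
    (g' := fun X => ∑ j, (phaseCoord j).smulRight
      (ampOsc (dirDeriv (ampDir (Sum.inl j)) a) X))
    Metric.isOpen_ball ?_ (fun n X _ => hasFDerivAt_regInt h χ (hε n) X) ?_
    (Metric.mem_ball_self one_pos)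
  · rw [Metric.tendstoUniformlyOn_iff]
    intro δ hδ
    filter_upwards [(hlim (∑ j, ‖phaseCoord (d := d) j‖ * K j)).eventually (gt_mem_nhds hδ)]
      with n hn X hX
    refine lt_of_le_of_lt ?_ hn
    rw [dist_comm, dist_eq_norm, ← Finset.sum_sub_distrib, Finset.sum_mul]
    refine (norm_sum_le _ _).trans (Finset.sum_le_sum fun j _ => ?_)
    have e1 : ∀ z z' : ℂ, (phaseCoord j).smulRight z - (phaseCoord j).smulRight z' =
        (phaseCoord (d := d) j).smulRight (z - z') := fun z z' => by
      ext v <;> simp [mul_sub]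
    rw [e1, ContinuousLinearMap.norm_smulRight_apply, mul_assoc]
    exact mul_le_mul_of_nonneg_left (hK j n X hX) (norm_nonneg _)
  · intro X hX
    obtain ⟨K, hK⟩ := hconv h
    rw [tendsto_iff_norm_sub_tendsto_zero]
    exact squeeze_zero (fun _ => norm_nonneg _) (fun n => hK n X hX) (hlim K)

theorem dirDeriv_ampOsc {a : AmpSpace d → ℂ}
    (h : HasBounds ampDir ampCost (ampWeight μ r₁ r₂ r₃ r₄) (fun _ : Unit => a))
    (j : Fin d ⊕ Fin d) :
    dirDeriv (phaseDir j) (ampOsc a) = ampOsc (dirDeriv (ampDir (Sum.inl j)) a) := by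
  classical
  funext X
  rw [dirDeriv, (hasFDerivAt_ampOsc h X).fderiv]
  have hc : ∀ k : Fin d ⊕ Fin d, phaseCoord k (phaseDir j) = if k = j then (1 : ℝ) else 0 := by
    rintro (k | k) <;> rcases j with j | j <;>
      simp [phaseCoord, prodCoord, phaseDir, prodDir, stdVec]
  simp [hc, -Fintype.sum_sum_type]

/-- The oscillatory integrals of a family of amplitudes form a family of symbols. -/
theorem HasBounds.ampOsc (h : HasBounds ampDir ampCost (ampWeight μ r₁ r₂ r₃ r₄) A) :
    HasBounds phaseDir phaseCost (fun X => bracket X.2 ^ μ)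
      (fun i => MagneticWeyl.ampOsc (A i)) := by
  refine ⟨fun i => ?_, fun n => ?_⟩
  -- The orders are existentially quantified because differentiation changes them.
  · let S : Set (Phase d → ℂ) := {F | ∃ (a : AmpSpace d → ℂ) (ν s₁ s₂ s₃ s₄ : ℝ),
      HasBounds ampDir ampCost (ampWeight ν s₁ s₂ s₃ s₄) (fun _ : Unit => a) ∧
      F = MagneticWeyl.ampOsc a}
    refine contDiff_of_dirDeriv_mem phaseCoord sum_phaseCoord S ?_ ?_ _
      ⟨A i, _, _, _, _, _, h.reindex fun _ => i, rfl⟩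
    · rintro F ⟨a, ν, s₁, s₂, s₃, s₄, ha, rfl⟩ X
      exact (hasFDerivAt_ampOsc ha X).differentiableAt
    · rintro F ⟨a, ν, s₁, s₂, s₃, s₄, ha, rfl⟩ j
      obtain ⟨ν', s₁', s₂', s₃', s₄', hj⟩ := ha.dirDeriv_inl j
      exact ⟨_, _, _, _, _, _, hj, dirDeriv_ampOsc ha j⟩
  · induction n generalizing μ r₁ r₂ r₃ r₄ A with
    | zero => exact h.oscConv.isBigO
    | succ n ih =>
      refine ⟨h.oscConv.isBigO, fun j => ?_⟩
      have h1 : ∀ i, _ := fun i => dirDeriv_ampOsc (h.reindex fun _ : Unit => i) j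
      simp only [h1]
      rcases j with j | j
      · simpa [phaseCost] using ih (h.dirDeriv_inl_inl j)
      · have := ih (h.dirDeriv_inl_inr j)
        convert this using 2 with X
        simp only [phaseCost, Sum.elim_inr, Real.rpow_sub_one (bracket_pos _).ne']
        ring

end OscOfAmplitude

/-! ### The magnetic phase factor. -/

section Flux

variable {d : ℕ}

theorem MagneticField.form_apply (B : MagneticField d) (x a b : Conf d) :
    B.form x ![a, b] = ∑ r : Fin 2 → Fin d, a (r 0) * b (r 1) * (B.comp (r 0) (r 1)).1 x := by
  have h1 : (![a, b] : Fin 2 → Conf d) = fun i => ∑ j, (![a, b] i) j • stdVec j := by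
    funext i
    exact (sum_stdCoord _).symm
  have h2 := (B.form x).toMultilinearMap.map_sum
    (fun (i : Fin 2) (j : Fin d) => (![a, b] i) j • stdVec j)
  rw [h1]
  refine h2.trans (Finset.sum_congr rfl fun r _ => ?_)
  rw [MultilinearMap.map_smul_univ]
  simp only [Fin.prod_univ_two, Matrix.cons_val_zero, Matrix.cons_val_one, smul_eq_mul]
  congr 1
  change B.form x (fun i => stdVec (r i)) = B.form x ![stdVec (r 0), stdVec (r 1)]
  congr 1
  funext i
  fin_cases i <;> rfl

theorem integral_unitInterval (h : ℝ → ℝ) : ∫ t : unitInterval, h t = ∫ t in (0 : ℝ)..1, h t := by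
  rw [intervalIntegral.integral_of_le zero_le_one, ← integral_Icc_eq_integral_Ioc]
  exact integral_subtype_comap measurableSet_Icc h

/-- The substitution `t = s t'` has Jacobian `s` and maps the unit square onto the triangle; the
fixed compact product domain fits `HasBounds.paramIntegral`. -/
theorem intervalIntegral_triangle (F : ℝ → ℝ → ℝ) (hF : Continuous fun q : ℝ × ℝ => F q.1 q.2) :
    ∫ s in (0 : ℝ)..1, ∫ t in (0 : ℝ)..s, F s t =
      ∫ q : unitInterval × unitInterval, (q.1 : ℝ) * F q.1 (q.1 * q.2) := by
  have hint : Integrable (fun q : unitInterval × unitInterval => (q.1 : ℝ) * F q.1 (q.1 * q.2)) := by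
    refine integrable_of_continuous_compact (T := unitInterval × unitInterval) ?_
    have : Continuous fun q : unitInterval × unitInterval => F q.1 (q.1 * q.2) :=
      hF.comp (f := fun q : unitInterval × unitInterval => ((q.1 : ℝ), (q.1 * q.2 : ℝ)))
        (by fun_prop)
    fun_prop
  rw [← integral_unitInterval]
  have h1 := integral_prod (μ := (volume : Measure unitInterval))
    (ν := (volume : Measure unitInterval)) _ hint
  refine Eq.trans ?_ h1.symm
  congr 1
  funext s
  change _ = ∫ t : unitInterval, (s : ℝ) * F s (s * t)
  rw [integral_const_mul, integral_unitInterval (fun t => F s (s * t)),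
    intervalIntegral.mul_integral_comp_mul_left]
  simp

/-- The point of the triangle `<x-y-z, x+y-z, x-y+z>` with parameters `(s, st)`, as a linear
function of `(X, (Y, Z))`. -/
def trianglePoint (q : unitInterval × unitInterval) : AmpSpace d →L[ℝ] Conf d :=
  (ContinuousLinearMap.fst ℝ _ _).comp (ContinuousLinearMap.fst ℝ _ _) +
    ((2 * q.1 - 1 - 2 * (q.1 * q.2) : ℝ) • projY +
      (2 * (q.1 * q.2) - 1 : ℝ) • projZ).comp (ContinuousLinearMap.snd ℝ _ _)

theorem trianglePoint_apply (q : unitInterval × unitInterval) (u : AmpSpace d) :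
    trianglePoint q u = u.1.1 + ((2 * q.1 - 1 - 2 * (q.1 * q.2) : ℝ) • u.2.1.1 +
      (2 * (q.1 * q.2) - 1 : ℝ) • u.2.2.1) := rfl

theorem continuous_trianglePoint :
    Continuous (trianglePoint : unitInterval × unitInterval → AmpSpace d →L[ℝ] Conf d) := by
  have h1 : Continuous fun q : unitInterval × unitInterval =>
      (2 * q.1 - 1 - 2 * (q.1 * q.2) : ℝ) := by fun_prop
  have h2 : Continuous fun q : unitInterval × unitInterval => (2 * (q.1 * q.2) - 1 : ℝ) := by
    fun_prop
  have h3 : Continuous fun q : unitInterval × unitInterval =>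
      (2 * q.1 - 1 - 2 * (q.1 * q.2) : ℝ) • (projY : Phase d × Phase d →L[ℝ] Conf d) +
      (2 * (q.1 * q.2) - 1 : ℝ) • projZ :=
    (h1.smul continuous_const).add (h2.smul continuous_const)
  have h4 : Continuous fun T : Phase d × Phase d →L[ℝ] Conf d =>
      T.comp (ContinuousLinearMap.snd ℝ (Phase d) (Phase d × Phase d)) :=
    continuous_id.clm_comp continuous_const
  have h5 := h4.comp h3
  exact (continuous_const (y := (ContinuousLinearMap.fst ℝ (Conf d) (Conf d)).comp
    (ContinuousLinearMap.fst ℝ (Phase d) (Phase d × Phase d)))).add h5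

/-- The mean over the triangle of a function on `𝓧`. -/
def triangleMean (b : Conf d → ℂ) (u : AmpSpace d) : ℂ :=
  ∫ q : unitInterval × unitInterval, (q.1 : ℝ) • b (trianglePoint q u)

/-- The logarithm of `ω^B`, as a function of `(X, (Y, Z))`. -/
def MagneticField.logOmega (B : MagneticField d) (u : AmpSpace d) : ℂ :=
  ∑ r : Fin 2 → Fin d, -Complex.I * ((((2 * u.2.1.1 (r 0) : ℝ) : ℂ) *
    ((2 * u.2.2.1 (r 1) - 2 * u.2.1.1 (r 1) : ℝ) : ℂ)) *
      triangleMean (fun x => ((B.comp (r 0) (r 1)).1 x : ℂ)) u)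

/-- The edge vectors of the triangle are `2y` and `2z - 2y`, independent of `x`. Bilinearity of `B`
takes their coordinates out of the integral and leaves the means of the components. -/
theorem MagneticField.omega_eq (B : MagneticField d) (u : AmpSpace d) :
    B.omega u.1.1 u.2.1.1 u.2.2.1 = Complex.exp (B.logOmega u) := by
  have hc : ∀ j k, Continuous (B.comp j k).1 := fun j k => (B.comp j k).2.1.continuous
  unfold MagneticField.omega MagneticField.Omega MagneticField.flux
  obtain ⟨⟨x, ξ⟩, ⟨y, η⟩, z, ζ⟩ := u
  simp only
  have e1 : x + y - z - (x - y - z) = (2 : ℝ) • y := by rw [two_smul]; abel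
  have e2 : x - y + z - (x + y - z) = (2 : ℝ) • z - (2 : ℝ) • y := by
    rw [two_smul, two_smul]; abel
  simp only [e1, e2, B.form_apply]
  rw [intervalIntegral_triangle (fun s t => ∑ r : Fin 2 → Fin d, ((2 : ℝ) • y) (r 0) *
    ((2 : ℝ) • z - (2 : ℝ) • y) (r 1) * (B.comp (r 0) (r 1)).1
      (x - y - z + s • (2 : ℝ) • y + t • ((2 : ℝ) • z - (2 : ℝ) • y)))]
  · rw [← integral_complex_ofReal, MagneticField.logOmega, ← Finset.mul_sum]
    congr 2
    simp only [triangleMean, ← integral_const_mul]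
    rw [← integral_finsetSum]
    · congr 1
      funext q
      have e3 : x - y - z + (q.1 : ℝ) • (2 : ℝ) • y +
          ((q.1 : ℝ) * q.2) • ((2 : ℝ) • z - (2 : ℝ) • y) =
          trianglePoint q ((x, ξ), (y, η), (z, ζ)) := by
        rw [trianglePoint_apply]
        module
      rw [e3]
      push_cast
      rw [Finset.mul_sum]
      refine Finset.sum_congr rfl fun r _ => ?_
      simp
      ring
    · intro r _
      refine Integrable.const_mul (integrable_of_continuous_compact ?_) _
      have h1 : Continuous fun q : unitInterval × unitInterval =>
          trianglePoint q ((x, ξ), (y, η), (z, ζ)) := by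
        simp only [trianglePoint_apply]; fun_prop
      have h2 := (hc (r 0) (r 1)).comp h1
      have h3 : Continuous fun q : unitInterval × unitInterval =>
          ((B.comp (r 0) (r 1)).1 (trianglePoint q ((x, ξ), (y, η), (z, ζ))) : ℂ) :=
        Complex.continuous_ofReal.comp h2
      exact (continuous_subtype_val.comp continuous_fst).smul h3
  · refine continuous_finsetSum _ fun r _ => continuous_const.mul ((hc _ _).comp ?_)
    fun_prop

/-- The coordinates of `AmpSpace d`. -/
def ampCoord : AmpIndex d → AmpSpace d →L[ℝ] ℝ :=
  prodCoord phaseCoord (prodCoord phaseCoord phaseCoord)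

theorem sum_ampCoord (u : AmpSpace d) : ∑ j, ampCoord j u • ampDir j = u :=
  sum_prodCoord sum_phaseCoord (sum_prodCoord sum_phaseCoord sum_phaseCoord) u

/-- The cost `1` for derivatives in the variables `x, y, z`, and `0` for derivatives in the
variables `ξ, η, ζ`. -/
def fluxCost : AmpIndex d → AmpSpace d → ℝ :=
  Sum.elim (Sum.elim (fun _ _ => 1) (fun _ _ => 0))
    (Sum.elim (Sum.elim (fun _ _ => 1) (fun _ _ => 0)) (Sum.elim (fun _ _ => 1) (fun _ _ => 0)))

/-- The number of the coordinate. -/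
def ampIndexCoord : AmpIndex d → Fin d :=
  Sum.elim (Sum.elim id id) (Sum.elim (Sum.elim id id) (Sum.elim id id))

/-- The coefficients of `trianglePoint`. -/
def triangleCoeff : AmpIndex d → unitInterval × unitInterval → ℝ :=
  Sum.elim (Sum.elim (fun _ _ => 1) (fun _ _ => 0))
    (Sum.elim (Sum.elim (fun _ q => 2 * q.1 - 1 - 2 * (q.1 * q.2)) (fun _ _ => 0))
      (Sum.elim (fun _ q => 2 * (q.1 * q.2) - 1) (fun _ _ => 0)))

variable {ι : Type*}

/-- The position `(X, (Y, Z))` enters only through `trianglePoint`, whose coefficients are bounded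
on the unit square and vanish for `ξ, η, ζ`. -/
theorem hasBounds_triangleMean {b : ι → Conf d → ℂ}
    (hb : HasBounds stdVec (fun _ _ => 1) (fun _ => 1) b) :
    HasBounds ampDir fluxCost (fun _ => 1) (fun i => triangleMean (b i)) := by
  refine HasBounds.paramIntegral (T := unitInterval × unitInterval) (k := ampIndexCoord)
    (c := triangleCoeff) sum_ampCoord sum_stdCoord ?_ ?_ ?_ ?_ hb
    (ρ := fun q => (q.1 : ℝ)) (by fun_prop) ?_
  · exact continuous_trianglePoint
  · rintro ((j | j) | ((j | j) | (j | j))) q <;>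
      simp [trianglePoint_apply, ampDir, prodDir, phaseDir, pairDir, triangleCoeff, ampIndexCoord]
  · rintro ((j | j) | ((j | j) | (j | j))) <;> simp only [triangleCoeff, Sum.elim_inl, Sum.elim_inr]
      <;> fun_prop
  · have hbd : ∀ {c : unitInterval × unitInterval → ℝ}, Continuous c →
        (fun q : (unitInterval × unitInterval) × AmpSpace d => c q.1) =O[⊤] fun _ => (1 : ℝ) := by
      intro c hc
      obtain ⟨C, hC⟩ := isCompact_univ.exists_bound_of_continuousOn hc.continuousOn
      exact IsBigO.of_bound C (Eventually.of_forall fun q => by simpa using hC q.1 (Set.mem_univ _))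
    rintro ((j | j) | ((j | j) | (j | j))) <;>
      simp only [triangleCoeff, fluxCost, Sum.elim_inl, Sum.elim_inr]
    · exact isBigO_refl _ _
    · exact isBigO_refl _ _
    · exact hbd (c := fun q => 2 * (q.1 : ℝ) - 1 - 2 * (q.1 * q.2)) (by fun_prop)
    · exact isBigO_refl _ _
    · exact hbd (c := fun q => 2 * ((q.1 : ℝ) * q.2) - 1) (by fun_prop)
    · exact isBigO_refl _ _
  · refine IsBigO.of_bound 1 (Eventually.of_forall fun q => ?_)
    rw [norm_one, mul_one, Real.norm_of_nonneg q.1.1.2.1]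
    exact q.1.1.2.2

theorem hasBounds_fluxCost_coord (a b : ℝ) (k : Fin d) :
    HasBounds ampDir fluxCost (fun u => bracket u.2.1.1 * bracket u.2.2.1)
      (fun (_ : ι) u => ((a * u.2.1.1 k + b * u.2.2.1 k : ℝ) : ℂ)) := by
  have hw : ∀ u : AmpSpace d, 1 ≤ bracket u.2.1.1 * bracket u.2.2.1 := fun u =>
    one_le_mul_of_one_le_of_one_le (one_le_bracket _) (one_le_bracket _)
  have hc : ∀ c : ℝ, (fun _ : AmpSpace d => (c : ℂ)) =O[⊤]
      fun u => 1 * (bracket u.2.1.1 * bracket u.2.2.1) := fun c => by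
    simp only [one_mul]
    exact (IsBigO.of_norm_left
      (by simpa using (isBigO_const_of_one_le hw c).norm_left))
  refine HasBounds.linear (Complex.ofRealCLM.comp ((a • (stdCoord k).comp projY +
    b • (stdCoord k).comp projZ).comp (ContinuousLinearMap.snd ℝ (Phase d) (Phase d × Phase d))))
    ?_ ?_
  · refine IsBigO.of_bound (|a| + |b|) (Eventually.of_forall fun u => ?_)
    rw [Real.norm_of_nonneg (zero_le_one.trans (hw u))]
    change ‖((a * u.2.1.1 k + b * u.2.2.1 k : ℝ) : ℂ)‖ ≤ _
    rw [Complex.norm_real]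
    have hy := one_le_bracket u.2.1.1
    have hz := one_le_bracket u.2.2.1
    have h1 : |u.2.1.1 k| ≤ bracket u.2.1.1 * bracket u.2.2.1 :=
      ((PiLp.norm_apply_le u.2.1.1 k).trans (norm_le_bracket _)).trans
        (le_mul_of_one_le_right (by linarith) hz)
    have h2 : |u.2.2.1 k| ≤ bracket u.2.1.1 * bracket u.2.2.1 :=
      ((PiLp.norm_apply_le u.2.2.1 k).trans (norm_le_bracket _)).trans
        (le_mul_of_one_le_left (by linarith) hy)
    refine (abs_add_le _ _).trans ?_
    rw [abs_mul, abs_mul, add_mul]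
    exact add_le_add (mul_le_mul_of_nonneg_left h1 (abs_nonneg _))
      (mul_le_mul_of_nonneg_left h2 (abs_nonneg _))
  · have h0 : ∀ (j : AmpIndex d) (w : AmpSpace d → ℝ), (ampDir j).2.1.1 = 0 →
        (ampDir j).2.2.1 = 0 → (fun _ : AmpSpace d => ((a * (ampDir j).2.1.1 k +
          b * (ampDir j).2.2.1 k : ℝ) : ℂ)) =O[⊤] w := fun j w h1 h2 => by
      simp only [h1, h2, PiLp.zero_apply, mul_zero, add_zero, Complex.ofReal_zero]
      exact isBigO_zero _ _
    rintro ((j | j) | ((j | j) | (j | j)))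
    · exact hc _
    · exact h0 (Sum.inl (Sum.inr j)) _ rfl rfl
    · exact hc _
    · exact h0 (Sum.inr (Sum.inl (Sum.inr j))) _ rfl rfl
    · exact hc _
    · exact h0 (Sum.inr (Sum.inr (Sum.inr j))) _ rfl rfl

theorem triangleMean_ofReal (b : Conf d → ℝ) (u : AmpSpace d) :
    triangleMean (fun x => (b x : ℂ)) u =
      ((∫ q : unitInterval × unitInterval, (q.1 : ℝ) * b (trianglePoint q u) : ℝ) : ℂ) := by
  rw [triangleMean, ← integral_complex_ofReal]
  simp only [Complex.real_smul, Complex.ofReal_mul]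

theorem MagneticField.logOmega_re (B : MagneticField d) (u : AmpSpace d) :
    (B.logOmega u).re = 0 := by
  simp only [MagneticField.logOmega, triangleMean_ofReal, ← Complex.ofReal_mul, Complex.re_sum]
  refine Finset.sum_eq_zero fun r _ => ?_
  rw [Complex.mul_re, Complex.ofReal_im, mul_zero, sub_zero, Complex.neg_re, Complex.I_re, neg_zero,
    zero_mul]

/-- Two edge coordinates, each bounded by `⟨y⟩⟨z⟩`, and a bounded mean: this explains the square in
`baseCost`. -/
theorem hasBounds_logOmega {B : ι → MagneticField d}
    (hB : ∀ j k n, ∃ C, ∀ i, bcSeminorm d n ((B i).comp j k) ≤ C) :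
    HasBounds ampDir fluxCost baseCost (fun i => (B i).logOmega) := by
  refine HasBounds.sum Finset.univ fun r => HasBounds.const_mul ?_ _
  have h1 := hasBounds_fluxCost_coord (ι := ι) (d := d) 2 0 (r 0)
  have h2 := hasBounds_fluxCost_coord (ι := ι) (d := d) (-2) 2 (r 1)
  have h3 := hasBounds_triangleMean (hasBounds_of_bcSeminorm_le (hB (r 0) (r 1)))
  have h := (h1.mul h2).mul h3
  simp only [mul_one, ← sq, zero_mul, add_zero, neg_mul, neg_add_eq_sub] at h
  exact h

theorem fluxCost_isBigO (j : AmpIndex d) : fluxCost j =O[⊤] (ampCost j : AmpSpace d → ℝ) := by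
  rcases j with (j | j) | ((j | j) | (j | j))
  · exact isBigO_const_of_one_le one_le_baseCost _
  · exact isBigO_zero _ _
  · exact isBigO_const_of_one_le one_le_baseCost _
  · exact isBigO_zero _ _
  · exact isBigO_const_of_one_le one_le_baseCost _
  · exact isBigO_zero _ _

theorem fluxCost_mul_baseCost_isBigO (j : AmpIndex d) :
    (fun u => fluxCost j u * baseCost u) =O[⊤] (ampCost j : AmpSpace d → ℝ) := by
  have h0 : ∀ w : AmpSpace d → ℝ, (fun u : AmpSpace d => (0 : ℝ) * baseCost u) =O[⊤] w :=
    fun w => by simpa using isBigO_zero (E' := ℝ) w ⊤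
  have h1 : (fun u : AmpSpace d => (1 : ℝ) * baseCost u) =O[⊤] baseCost := by
    simpa using isBigO_refl (baseCost (d := d)) ⊤
  rcases j with (j | j) | ((j | j) | (j | j))
  · exact h1
  · exact h0 _
  · exact h1
  · exact h0 _
  · exact h1
  · exact h0 _

/-- A derivative of the exponent is `O(fluxCost j * baseCost)`, which is `O(ampCost j)`;
`HasBounds.cexp` then applies. -/
theorem hasBounds_omega {B : ι → MagneticField d}
    (hB : ∀ j k n, ∃ C, ∀ i, bcSeminorm d n ((B i).comp j k) ≤ C) :
    HasBounds ampDir ampCost (fun _ => 1)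
      (fun i u => (B i).omega u.1.1 u.2.1.1 u.2.2.1) := by
  have h := hasBounds_logOmega hB
  simp only [MagneticField.omega_eq]
  exact HasBounds.cexp h.smooth
    (fun j => ((h.dirDeriv j).mono (fluxCost_mul_baseCost_isBigO j)).mono_cost fluxCost_isBigO)
    fun i u => (B i).logOmega_re u

end Flux

/-! ### The Moyal amplitude. -/

section MoyalAmplitude

variable {d : ℕ} {ι : Type*} {m p : ℝ}

/-- Stated for a projection `P` so as to serve both `f(X-Y)` and `g(X-Z)`; for the same reason the
cost of a `ξ`-derivative contains `⟨η⟩` as well as `⟨ζ⟩`. -/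
theorem HasBounds.translate {a : ι → Phase d → ℂ}
    (h : HasBounds phaseDir phaseCost (fun X => bracket X.2 ^ m) a)
    (P : Phase d × Phase d →L[ℝ] Phase d)
    (hP : ∀ j, ∃ k, ∃ c : ℝ, P (pairDir j) = c • phaseDir k)
    (hb : ∀ Q, bracket (P Q).2 ≤ bracket Q.1.2 * bracket Q.2.2) :
    HasBounds ampDir ampCost (fun u => bracket (u.1.2 - (P u.2).2) ^ m)
      (fun i u => a i (u.1 - P u.2)) := by
  let T : AmpSpace d →L[ℝ] Phase d := ContinuousLinearMap.fst ℝ (Phase d) (Phase d × Phase d) -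
    P.comp (ContinuousLinearMap.snd ℝ (Phase d) (Phase d × Phase d))
  have hT : ∀ u, T u = u.1 - P u.2 := fun _ => rfl
  suffices H : ∀ j, ∃ k, ∃ c : ℝ, T (ampDir j) = c • phaseDir k ∧
      (fun u => c * phaseCost k (T u)) =O[⊤] (ampCost j : AmpSpace d → ℝ) from
    HasBounds.comp_clm h T H
  intro j
  have hone : ∀ k (X : Phase d), ‖phaseCost k X‖ ≤ 1 := by
    rintro (k | k) X
    · exact norm_one.le
    · change ‖(bracket X.2)⁻¹‖ ≤ 1
      rw [Real.norm_of_nonneg (inv_pos.2 (bracket_pos _)).le]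
      exact inv_le_one_of_one_le₀ (one_le_bracket _)
  have hO : ∀ (T : AmpSpace d → Phase d) (c : ℝ) (k) (w : AmpSpace d → ℝ), (∀ u, 1 ≤ w u) →
      (fun u => c * phaseCost k (T u)) =O[⊤] w := fun T c k w hw => by
    refine IsBigO.trans (IsBigO.of_bound 1 (Eventually.of_forall fun u => ?_))
      (isBigO_const_of_one_le hw c)
    rw [norm_mul, one_mul]
    exact mul_le_of_le_one_right (norm_nonneg c) (hone k _)
  rcases j with (j | j) | j
  · refine ⟨Sum.inl j, 1, by simp [hT, ampDir, prodDir, phaseDir], hO _ _ _ _ one_le_baseCost⟩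
  · refine ⟨Sum.inr j, 1, by simp [hT, ampDir, prodDir, phaseDir], IsBigO.of_bound 2
      (Eventually.of_forall fun u => ?_)⟩
    change ‖1 * (bracket (u.1.2 - (P u.2).2))⁻¹‖ ≤
      2 * ‖(bracket u.1.2)⁻¹ * (bracket u.2.1.2 * bracket u.2.2.2)‖
    have h1 := bracket_pos u.1.2
    have h2 := bracket_pos (u.1.2 - (P u.2).2)
    have h3 := bracket_pos u.2.1.2
    have h4 := bracket_pos u.2.2.2
    rw [one_mul, Real.norm_of_nonneg (by positivity), Real.norm_of_nonneg (by positivity),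
      inv_le_iff_one_le_mul₀ h2]
    -- The constant `2` above comes from `⟨ξ⟩ ≤ 2⟨ξ-v⟩⟨v⟩` with `v = (P u.2).2`.
    have h5 := bracket_le_sub u.1.2 (P u.2).2
    have h6 := mul_le_mul_of_nonneg_left (hb u.2) h2.le
    have h7 : 2 * ((bracket u.1.2)⁻¹ * (bracket u.2.1.2 * bracket u.2.2.2)) *
        bracket (u.1.2 - (P u.2).2) = (bracket u.1.2)⁻¹ *
          (2 * (bracket (u.1.2 - (P u.2).2) * (bracket u.2.1.2 * bracket u.2.2.2))) := by ring
    rw [h7, ← inv_mul_cancel₀ h1.ne']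
    exact mul_le_mul_of_nonneg_left (by linarith) (inv_pos.2 h1).le
  · obtain ⟨k, c, hk⟩ := hP j
    refine ⟨k, -c, ?_, hO _ _ _ _ ?_⟩
    · change (0 : Phase d) - P (pairDir j) = _
      rw [hk, zero_sub, neg_smul]
    · rcases j with (j | j) | (j | j)
      · exact one_le_baseCost
      · exact fun _ => le_rfl
      · exact one_le_baseCost
      · exact fun _ => le_rfl

theorem HasBounds.translate_fst {a : ι → Phase d → ℂ}
    (h : HasBounds phaseDir phaseCost (fun X => bracket X.2 ^ m) a) :
    HasBounds ampDir ampCost (ampWeight m 0 0 |m| 0) (fun i u => a i (u.1 - u.2.1)) := by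
  refine (h.translate (ContinuousLinearMap.fst ℝ _ _) ?_ fun Q =>
    le_mul_of_one_le_right (bracket_pos _).le (one_le_bracket _)).mono ?_
  · rintro (j | j)
    · exact ⟨j, 1, by simp [pairDir, prodDir]⟩
    · exact ⟨j, 0, by simp [pairDir, prodDir]⟩
  · refine IsBigO.of_bound (2 ^ |m|) (Eventually.of_forall fun u => ?_)
    rw [Real.norm_of_nonneg (Real.rpow_nonneg (bracket_pos _).le _),
      Real.norm_of_nonneg (ampWeight_pos _ _ _ _ _ _).le]
    simpa [ampWeight, pairWeight] using bracket_sub_rpow_le m u.1.2 u.2.1.2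

theorem HasBounds.translate_snd {a : ι → Phase d → ℂ}
    (h : HasBounds phaseDir phaseCost (fun X => bracket X.2 ^ m) a) :
    HasBounds ampDir ampCost (ampWeight m 0 0 0 |m|) (fun i u => a i (u.1 - u.2.2)) := by
  refine (h.translate (ContinuousLinearMap.snd ℝ _ _) ?_ fun Q =>
    le_mul_of_one_le_left (bracket_pos _).le (one_le_bracket _)).mono ?_
  · rintro (j | j)
    · exact ⟨j, 0, by simp [pairDir, prodDir]⟩
    · exact ⟨j, 1, by simp [pairDir, prodDir]⟩
  · refine IsBigO.of_bound (2 ^ |m|) (Eventually.of_forall fun u => ?_)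
    rw [Real.norm_of_nonneg (Real.rpow_nonneg (bracket_pos _).le _),
      Real.norm_of_nonneg (ampWeight_pos _ _ _ _ _ _).le]
    simpa [ampWeight, pairWeight] using bracket_sub_rpow_le m u.1.2 u.2.2.2

theorem hasBounds_moyalAmplitude {B : ι → MagneticField d} {f : ι → Symbol d m}
    {g : ι → Symbol d p} (hB : ∀ j k n, ∃ C, ∀ i, bcSeminorm d n ((B i).comp j k) ≤ C)
    (hf : ∀ k, ∃ C, ∀ i, symbolSeminorm d m k (f i) ≤ C)
    (hg : ∀ k, ∃ C, ∀ i, symbolSeminorm d p k (g i) ≤ C) :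
    HasBounds ampDir ampCost (ampWeight (m + p) 0 0 |m| |p|)
      (fun i u => moyalAmplitude (B i) (f i) (g i) u.1 u.2) := by
  refine (((hasBounds_omega hB).mul (hasBounds_of_symbolSeminorm_le hf).translate_fst).mul
    (hasBounds_of_symbolSeminorm_le hg).translate_snd).mono (IsBigO.of_bound 1
      (Eventually.of_forall fun u => le_of_eq ?_))
  rw [one_mul, one_mul, ampWeight_mul]
  simp only [add_zero, zero_add]

end MoyalAmplitude

/-! ### From bounded families to equicontinuity. -/

section Equicontinuity

variable {d : ℕ} {m p r : ℝ} {ι : Type*}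

/-- Families of symbols that are bounded in the Fréchet space `S^m_1(Ξ)`. -/
def SymbolBounded (f : ι → Symbol d m) : Prop := ∀ k, ∃ C, ∀ i, symbolSeminorm d m k (f i) ≤ C

theorem symbolBounded_const (f : Symbol d m) : SymbolBounded fun _ : ι => f :=
  fun _ => ⟨_, fun _ => le_rfl⟩

theorem symbolBounded_of_eventually {f : ℕ → Symbol d m}
    (h : ∀ k, ∃ C, ∀ᶠ n in atTop, symbolSeminorm d m k (f n) ≤ C) : SymbolBounded f := by
  intro k
  obtain ⟨C, hC⟩ := h k
  obtain ⟨D, hD⟩ := IsBoundedUnder.bddAbove_range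
    (show IsBoundedUnder (· ≤ ·) atTop fun n => symbolSeminorm d m k (f n) from ⟨C, hC⟩)
  exact ⟨D, fun n => hD ⟨n, rfl⟩⟩

theorem eventually_symbolSeminorm_sub_lt (f₀ : Symbol d m) (k : ℕ × ℕ) {δ : ℝ} (hδ : 0 < δ) :
    ∀ᶠ f in 𝓝 f₀, symbolSeminorm d m k (f - f₀) < δ := by
  have h : Continuous fun f => symbolSeminorm d m k (f - f₀) :=
    ((symbol_withSeminorms d m).continuous_seminorm k).comp (continuous_id.sub continuous_const)
  exact (h.tendsto f₀).eventually (gt_mem_nhds (by simpa using hδ))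

theorem eventually_atTop_of_small {a : ℕ → ℕ × ℕ → ℝ}
    (h : ∀ n, ∀ k ∈ Finset.range (n + 1) ×ˢ Finset.range (n + 1), a n k < ((n : ℝ) + 1)⁻¹)
    (k : ℕ × ℕ) : ∀ᶠ n : ℕ in atTop, ((n : ℝ) + 1) * a n k ≤ 1 ∧ a n k ≤ 1 := by
  filter_upwards [eventually_ge_atTop (max k.1 k.2)] with n hn
  have h1 := (h n k (Finset.mem_product.2 ⟨Finset.mem_range.2 (by omega),
    Finset.mem_range.2 (by omega)⟩)).le
  have h2 : (0 : ℝ) < (n : ℝ) + 1 := by positivity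
  refine ⟨(mul_le_mul_of_nonneg_left h1 h2.le).trans (mul_inv_cancel₀ h2.ne').le, h1.trans ?_⟩
  exact inv_le_one_of_one_le₀ (by linarith [Nat.cast_nonneg (α := ℝ) n])

theorem symbolSeminorm_natCast_smul (k : ℕ × ℕ) (n : ℕ) (f : Symbol d m) :
    symbolSeminorm d m k (((n : ℂ) + 1) • f) = ((n : ℝ) + 1) * symbolSeminorm d m k f := by
  rw [map_smul_eq_mul]
  congr 1
  have : ((n : ℂ) + 1) = ((n + 1 : ℕ) : ℂ) := by push_cast; rfl
  rw [this, Complex.norm_natCast]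
  push_cast
  rfl

/-- If equicontinuity failed at `q₀`, there would be `q n → q₀` fast enough for `(n+1)(q n - q₀)` to
be bounded, while the images stay `δ` apart. By bilinearity, `n + 1` times the difference of the
images is bounded, which is absurd for large `n`. -/
theorem equicontinuous_of_symbolBounded
    {T : ι → Symbol d m →ₗ[ℂ] Symbol d p →ₗ[ℂ] Symbol d r}
    (hT : ∀ (b : ℕ → ι) (f : ℕ → Symbol d m) (g : ℕ → Symbol d p), SymbolBounded f →
      SymbolBounded g → SymbolBounded fun n => T (b n) (f n) (g n)) :
    Equicontinuous fun i (q : Symbol d m × Symbol d p) => T i q.1 q.2 := by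
  have key : ∀ (q₀ : Symbol d m × Symbol d p) (k : ℕ × ℕ) (δ : ℝ), 0 < δ → ∀ᶠ q in 𝓝 q₀,
      ∀ i, symbolSeminorm d r k (T i q.1 q.2 - T i q₀.1 q₀.2) < δ := by
    rintro ⟨f₀, g₀⟩ k δ hδ
    by_contra hcon
    have hex : ∀ n : ℕ, ∃ (q : Symbol d m × Symbol d p) (i : ι),
        δ ≤ symbolSeminorm d r k (T i q.1 q.2 - T i f₀ g₀) ∧
        (∀ l ∈ Finset.range (n + 1) ×ˢ Finset.range (n + 1),
          symbolSeminorm d m l (q.1 - f₀) < ((n : ℝ) + 1)⁻¹) ∧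
        ∀ l ∈ Finset.range (n + 1) ×ˢ Finset.range (n + 1),
          symbolSeminorm d p l (q.2 - g₀) < ((n : ℝ) + 1)⁻¹ := fun n => by
      have h0 : (0 : ℝ) < ((n : ℝ) + 1)⁻¹ := by positivity
      have h1 : ∀ᶠ q : Symbol d m × Symbol d p in 𝓝 (f₀, g₀),
          ∀ l ∈ Finset.range (n + 1) ×ˢ Finset.range (n + 1),
          symbolSeminorm d m l (q.1 - f₀) < ((n : ℝ) + 1)⁻¹ :=
        (eventually_all_finset _).2 fun l _ =>
          (continuous_fst.tendsto (f₀, g₀)).eventually (eventually_symbolSeminorm_sub_lt f₀ l h0)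
      have h2 : ∀ᶠ q : Symbol d m × Symbol d p in 𝓝 (f₀, g₀),
          ∀ l ∈ Finset.range (n + 1) ×ˢ Finset.range (n + 1),
          symbolSeminorm d p l (q.2 - g₀) < ((n : ℝ) + 1)⁻¹ :=
        (eventually_all_finset _).2 fun l _ =>
          (continuous_snd.tendsto (f₀, g₀)).eventually (eventually_symbolSeminorm_sub_lt g₀ l h0)
      obtain ⟨q, hq, h3⟩ := ((not_eventually.1 hcon).and_eventually (h1.and h2)).exists
      push Not at hq
      obtain ⟨i, hi⟩ := hq
      exact ⟨q, i, hi, h3⟩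
    choose q b hδq hf hg using hex
    -- Each fixed seminorm is among those controlled at stage `n` once `n` is large, and the
    -- finitely many earlier terms do not affect boundedness.
    have bu : SymbolBounded fun n : ℕ => ((n : ℂ) + 1) • ((q n).1 - f₀) :=
      symbolBounded_of_eventually fun l => ⟨1, (eventually_atTop_of_small hf l).mono fun n h => by
        rw [symbolSeminorm_natCast_smul]; exact h.1⟩
    have bv : SymbolBounded fun n : ℕ => ((n : ℂ) + 1) • ((q n).2 - g₀) :=
      symbolBounded_of_eventually fun l => ⟨1, (eventually_atTop_of_small hg l).mono fun n h => by
        rw [symbolSeminorm_natCast_smul]; exact h.1⟩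
    have bg : SymbolBounded fun n : ℕ => (q n).2 :=
      symbolBounded_of_eventually fun l => ⟨1 + symbolSeminorm d p l g₀,
        (eventually_atTop_of_small hg l).mono fun n h => by
          have h1 := map_add_le_add (symbolSeminorm d p l) ((q n).2 - g₀) g₀
          rw [sub_add_cancel] at h1
          linarith [h.2]⟩
    obtain ⟨C, hC⟩ := hT b _ _ bu bg k
    obtain ⟨D, hD⟩ := hT b _ _ (symbolBounded_const f₀) bv k
    have hle : ∀ n : ℕ, ((n : ℝ) + 1) * δ ≤ C + D := fun n => by
      -- Telescoping: one variable is changed at a time, and the scalar goes to the factor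
      -- containing the difference.
      have e : ((n : ℂ) + 1) • (T (b n) (q n).1 (q n).2 - T (b n) f₀ g₀) =
          T (b n) (((n : ℂ) + 1) • ((q n).1 - f₀)) (q n).2 +
            T (b n) f₀ (((n : ℂ) + 1) • ((q n).2 - g₀)) := by
        simp only [map_smul, map_sub, LinearMap.smul_apply, LinearMap.sub_apply, ← smul_add,
          sub_add_sub_cancel]
      calc ((n : ℝ) + 1) * δ ≤ ((n : ℝ) + 1) *
            symbolSeminorm d r k (T (b n) (q n).1 (q n).2 - T (b n) f₀ g₀) :=
            mul_le_mul_of_nonneg_left (hδq n) (by positivity)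
        _ ≤ C + D := by
            rw [← symbolSeminorm_natCast_smul, e]
            exact (map_add_le_add _ _ _).trans (add_le_add (hC n) (hD n))
    obtain ⟨n, hn⟩ := exists_nat_gt ((C + D) / δ)
    have h1 := (div_lt_iff₀ hδ).1 hn
    linarith [hle n]
  intro q₀ U hU
  rw [uniformity_eq_comap_nhds_zero] at hU
  obtain ⟨V, hV, hVU⟩ := hU
  obtain ⟨⟨s, δ⟩, hδ, hsV⟩ := (symbol_withSeminorms d r).hasBasis_zero_ball.mem_iff.1 hV
  filter_upwards [(eventually_all_finset s).2 fun k _ => key q₀ k δ hδ] with q hq i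
  refine hVU (hsV ?_)
  rw [Seminorm.mem_ball_zero]
  exact Seminorm.finset_sup_apply_lt hδ fun k hk => hq k hk i

end Equicontinuity

/-! ### The magnetic Moyal product as a bilinear map. -/

section Moyal

variable {d : ℕ} {m p : ℝ} {ι : Type*}

theorem exists_hasOscIntegral_moyalAmplitude (B : MagneticField d) (f : Symbol d m)
    (g : Symbol d p) (X : Phase d) :
    ∃ I, HasOscIntegral moyalPhase (moyalAmplitude B f g X) I :=
  (hasBounds_moyalAmplitude (ι := Unit) (B := fun _ => B) (fun _ _ _ => ⟨_, fun _ => le_rfl⟩)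
    (symbolBounded_const f) (symbolBounded_const g)).exists_hasOscIntegral () X

theorem hasBounds_moyal {B : ι → MagneticField d} {f : ι → Symbol d m} {g : ι → Symbol d p}
    (hB : ∀ j k n, ∃ C, ∀ i, bcSeminorm d n ((B i).comp j k) ≤ C)
    (hf : SymbolBounded f) (hg : SymbolBounded g) :
    HasBounds phaseDir phaseCost (fun X => bracket X.2 ^ (m + p))
      (fun i => moyal (B i) (f i) (g i)) :=
  (hasBounds_moyalAmplitude hB hf hg).ampOsc.const_mul _

theorem moyal_mem (B : MagneticField d) (f : Symbol d m) (g : Symbol d p) :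
    moyal B f g ∈ symbolSubmodule d (m + p) :=
  (hasBounds_moyal (ι := Unit) (B := fun _ => B) (fun _ _ _ => ⟨_, fun _ => le_rfl⟩)
    (symbolBounded_const f) (symbolBounded_const g)).mem_symbolSubmodule

theorem HasOscIntegral.add {φ : Phase d × Phase d → ℝ} {a b : Phase d × Phase d → ℂ} {I J : ℂ}
    (ha : HasOscIntegral φ a I) (hb : HasOscIntegral φ b J) :
    HasOscIntegral φ (fun Q => a Q + b Q) (I + J) := by
  intro χ hχ
  obtain ⟨i1, t1⟩ := ha χ hχ
  obtain ⟨i2, t2⟩ := hb χ hχ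
  simp only [mul_add]
  refine ⟨fun ε hε => (i1 ε hε).add (i2 ε hε), (t1.add t2).congr' ?_⟩
  filter_upwards [self_mem_nhdsWithin] with ε hε
  exact (integral_add (i1 ε hε) (i2 ε hε)).symm

theorem HasOscIntegral.const_mul {φ : Phase d × Phase d → ℝ} {a : Phase d × Phase d → ℂ} {I : ℂ}
    (ha : HasOscIntegral φ a I) (c : ℂ) : HasOscIntegral φ (fun Q => c * a Q) (c * I) := by
  intro χ hχ
  obtain ⟨i1, t1⟩ := ha χ hχ
  simp only [mul_left_comm _ c]
  refine ⟨fun ε hε => (i1 ε hε).const_mul c, ?_⟩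
  simp only [integral_const_mul]
  exact t1.const_mul c

theorem moyal_add_left (B : MagneticField d) (f f' : Symbol d m) (g : Symbol d p) :
    moyal B (f.1 + f'.1) g = moyal B f g + moyal B f' g := by
  funext X
  obtain ⟨I, hI⟩ := exists_hasOscIntegral_moyalAmplitude B f g X
  obtain ⟨J, hJ⟩ := exists_hasOscIntegral_moyalAmplitude B f' g X
  have e : moyalAmplitude B (f.1 + f'.1) g X =
      fun Q => moyalAmplitude B f g X Q + moyalAmplitude B f' g X Q := by
    funext Q
    simp only [moyalAmplitude, Pi.add_apply]
    ring
  simp only [moyal, Pi.add_apply]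
  rw [e, (hI.add hJ).oscIntegral_eq, hI.oscIntegral_eq, hJ.oscIntegral_eq, mul_add]

theorem moyal_add_right (B : MagneticField d) (f : Symbol d m) (g g' : Symbol d p) :
    moyal B f (g.1 + g'.1) = moyal B f g + moyal B f g' := by
  funext X
  obtain ⟨I, hI⟩ := exists_hasOscIntegral_moyalAmplitude B f g X
  obtain ⟨J, hJ⟩ := exists_hasOscIntegral_moyalAmplitude B f g' X
  have e : moyalAmplitude B f (g.1 + g'.1) X =
      fun Q => moyalAmplitude B f g X Q + moyalAmplitude B f g' X Q := by
    funext Q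
    simp only [moyalAmplitude, Pi.add_apply]
    ring
  simp only [moyal, Pi.add_apply]
  rw [e, (hI.add hJ).oscIntegral_eq, hI.oscIntegral_eq, hJ.oscIntegral_eq, mul_add]

theorem moyal_smul_left (B : MagneticField d) (c : ℂ) (f : Symbol d m) (g : Symbol d p) :
    moyal B (c • f.1) g = c • moyal B f g := by
  funext X
  obtain ⟨I, hI⟩ := exists_hasOscIntegral_moyalAmplitude B f g X
  have e : moyalAmplitude B (c • f.1) g X = fun Q => c * moyalAmplitude B f g X Q := by
    funext Q
    simp only [moyalAmplitude, Pi.smul_apply, smul_eq_mul]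
    ring
  simp only [moyal, Pi.smul_apply, smul_eq_mul]
  rw [e, (hI.const_mul c).oscIntegral_eq, hI.oscIntegral_eq, mul_left_comm]

theorem moyal_smul_right (B : MagneticField d) (c : ℂ) (f : Symbol d m) (g : Symbol d p) :
    moyal B f (c • g.1) = c • moyal B f g := by
  funext X
  obtain ⟨I, hI⟩ := exists_hasOscIntegral_moyalAmplitude B f g X
  have e : moyalAmplitude B f (c • g.1) X = fun Q => c * moyalAmplitude B f g X Q := by
    funext Q
    simp only [moyalAmplitude, Pi.smul_apply, smul_eq_mul]
    ring
  simp only [moyal, Pi.smul_apply, smul_eq_mul]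
  rw [e, (hI.const_mul c).oscIntegral_eq, hI.oscIntegral_eq, mul_left_comm]

/-- The magnetic Moyal product as a bilinear map. -/
def moyalBilin (m p : ℝ) (B : MagneticField d) :
    Symbol d m →ₗ[ℂ] Symbol d p →ₗ[ℂ] Symbol d (m + p) :=
  LinearMap.mk₂ ℂ (fun f g => (⟨moyal B f g, moyal_mem B f g⟩ : symbolSubmodule d (m + p)))
    (fun f f' g => Subtype.ext (moyal_add_left B f f' g))
    (fun c f g => Subtype.ext (moyal_smul_left B c f g))
    (fun f g g' => Subtype.ext (moyal_add_right B f g g'))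
    (fun c f g => Subtype.ext (moyal_smul_right B c f g))

theorem equicontinuous_moyalBilin {B : ι → MagneticField d}
    (hB : ∀ j k n, ∃ C, ∀ i, bcSeminorm d n ((B i).comp j k) ≤ C) :
    Equicontinuous fun i (q : Symbol d m × Symbol d p) => moyalBilin m p (B i) q.1 q.2 :=
  equicontinuous_of_symbolBounded fun b _ _ hf hg =>
    (hasBounds_moyal (B := fun n => B (b n)) (fun j k n => (hB j k n).imp fun _ h i => h (b i))
      hf hg).symbolSeminorm_le

end Moyal

end MagneticWeyl

end

theorem proposition3p1 (d : ℕ) (m p : ℝ) :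
    -- the oscillatory integrals that define the product exist
    (∀ (B : MagneticWeyl.MagneticField d) (f : MagneticWeyl.Symbol d m)
        (g : MagneticWeyl.Symbol d p) (X : MagneticWeyl.Phase d),
      ∃ I : ℂ, MagneticWeyl.HasOscIntegral MagneticWeyl.moyalPhase
        (MagneticWeyl.moyalAmplitude B f g X) I) ∧
    -- the product is a bilinear map `T B` into the symbols of order `m + p`
    ∃ T : MagneticWeyl.MagneticField d →
        (MagneticWeyl.Symbol d m →ₗ[ℂ] MagneticWeyl.Symbol d p →ₗ[ℂ]
          MagneticWeyl.Symbol d (m + p)),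
      (∀ (B : MagneticWeyl.MagneticField d) (f : MagneticWeyl.Symbol d m)
        (g : MagneticWeyl.Symbol d p), (T B f g : MagneticWeyl.Phase d → ℂ) =
          MagneticWeyl.moyal B f g) ∧
      -- it is (jointly) continuous
      (∀ B : MagneticWeyl.MagneticField d,
        Continuous fun q : MagneticWeyl.Symbol d m × MagneticWeyl.Symbol d p =>
          T B q.1 q.2) ∧
      -- it is equicontinuous as long as the components of `B` stay in a bounded set
      (∀ 𝓑 : Set (MagneticWeyl.BCInf d), Bornology.IsVonNBounded ℝ 𝓑 →
        Equicontinuous fun (B : {B : MagneticWeyl.MagneticField d // ∀ j k, B.comp j k ∈ 𝓑})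
          (q : MagneticWeyl.Symbol d m × MagneticWeyl.Symbol d p) => T B.1 q.1 q.2) := by
  refine ⟨MagneticWeyl.exists_hasOscIntegral_moyalAmplitude, MagneticWeyl.moyalBilin m p,
    fun _ _ _ => rfl, fun B => ?_, fun 𝓑 h𝓑 => ?_⟩
  -- Continuity for one field is equicontinuity of a one-element family.
  · exact (MagneticWeyl.equicontinuous_moyalBilin (ι := Unit) (B := fun _ => B)
      fun _ _ _ => ⟨_, fun _ => le_rfl⟩).continuous ()
  · refine MagneticWeyl.equicontinuous_moyalBilin fun j k n => ?_
    obtain ⟨C, -, hC⟩ :=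
      ((MagneticWeyl.bcInf_withSeminorms d).isVonNBounded_iff_seminorm_bounded.1 h𝓑) n
    exact ⟨C, fun B => (hC _ (B.2 j k)).le⟩
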